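/- **Setting.** A *combinatorial tiling* is a two-dimensional CW-complex with pentagonal tiles that is homeomorphic to the plane. The subdivision $\omega$ halves every edge and replaces every pentagon $t$ by six pentagons: a central one, each of whose five vertices is joined to the midpoint of one edge of $t$, and five others, one at each vertex of $t$. Let $K_0$ be a single pentagon, $K_n=\omega^n(K_0)$, let $\iota_n:K_n\to K_{n+1}$ be the embedding that carries the central pentagon to the central pentagon, and $K=\varinjlim K_n$. Fix any decoration of the tiles of $K$ by symbols from a finite set $D$ (a marking of the flags of each tile; decorations may break the symmetries of the pentagon). A tiling $L$, with tiles decorated by symbols from $D$, is *locally isomorphic* to $K$ if every patch (finite set of tiles) of $L$ is isomorphic, by a cell-preserving and decoration preserving map, to a patch of $K$. For such $L$, $L_{\mathrm{aff}}$ is the space $L$ in which every tile is a regular Euclidean pentagon of edge length one, with the path metric $d_L$ (infimum of the lengths of piecewise straight paths), and $B(x,r,L)=\{y : d_L(x,y)\le r\}$. The *continuous hull* $\Omega$ is the set of isomorphism classes $[L,x]$ with $L$ a decorated combinatorial tiling locally isomorphic to $K$ and $x\in L_{\mathrm{aff}}$; here $(L,x)\cong(L',x')$ if some homeomorphism $L_{\mathrm{aff}}\to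 L'_{\mathrm{aff}}$ that is cell-preserving, decoration preserving and isometric on each cell maps $x$ to $x'$. The metric of $\Omega$ is $$d([L,x],[L',x'])=\min\bigl(\tfrac1{\sqrt2},\ \inf\Lambda\bigr),\qquad \inf\emptyset=\infty,$$ where $\varepsilon>0$ belongs to $\Lambda$ if there are maps $\varphi:B(x,1/\varepsilon,L)\to L'$ and $\varphi':B(x',1/\varepsilon,L')\to L$ with $d_{L'}(\varphi(x),x')\le\varepsilon$ and $d_L(\varphi'(x'),x)\le\varepsilon$ that are cell-preserving, are isometries, and preserve the decorations and the degrees of the vertices. The space $\Omega$ carries the topology in which a set is open if and only if it contains, with each of its points $a$, a ball $\{b : d(a,b)<r\}$ with $r>0$. The *discrete hull*, viewed inside $\Omega$, is $$\Xi=\{[L,v]\in\Omega : v \text{ is a vertex of } L\}.$$ **Proposition.** The discrete hull $\Xi$ is a compact and closed subset of $\Omega$. -/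

import Mathlib

open Set

noncomputable section

namespace PentHull

/-! ## Pentagonal complexes, subdivision, and the complex `K` -/

/-- A two-dimensional complex with pentagonal tiles, given combinatorially: `T` is the set of
tiles and `vert t 0, …, vert t 4` are the vertices of the tile `t` in cyclic order.  An edge is the
pair of its end points.  Elements of `V` that are not vertices of a tile play no role. -/
structure PentComplex where
  V : Type
  T : Type
  vert : T → ZMod 5 → V

/-- Index-preserving maps of complexes, used for the embeddings `K_n → K_{n+1}`. -/
structure PentComplex.Hom (L M : PentComplex) where
  onV : L.V → M.V
  onT : L.T → M.T
  compat : ∀ t i, onV (L.vert t i) = M.vert (onT t) i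

/-- The subdivision `ω`: every edge is halved, every tile `t` is replaced by a central pentagon
with new vertices `(t, 0), …, (t, 4)`, where `(t, i)` is joined to the midpoint of the edge from
vertex `i` to vertex `i + 1`, and by five pentagons, one at each vertex `i` of `t`. -/
def PentComplex.subdiv (L : PentComplex) : PentComplex where
  V := L.V ⊕ (Sym2 L.V ⊕ (L.T × ZMod 5))
  T := L.T × Option (ZMod 5)
  vert := fun x j => match x with
    | (t, none) => Sum.inr (Sum.inr (t, j))
    | (t, some i) =>
      (![Sum.inl (L.vert t i),
         Sum.inr (Sum.inl s(L.vert t i, L.vert t (i + 1))),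
         Sum.inr (Sum.inr (t, i)),
         Sum.inr (Sum.inr (t, i - 1)),
         Sum.inr (Sum.inl s(L.vert t (i - 1), L.vert t i))] :
        Fin 5 → L.V ⊕ (Sym2 L.V ⊕ (L.T × ZMod 5))) j

/-- The subdivision of a map. -/
def PentComplex.Hom.subdiv {L M : PentComplex} (f : L.Hom M) : L.subdiv.Hom M.subdiv where
  onV := Sum.map f.onV (Sum.map (Sym2.map f.onV) (Prod.map f.onT id))
  onT := Prod.map f.onT id
  compat := by
    rintro ⟨t, _ | i⟩ j
    · rfl
    · change Fin 5 at j
      fin_cases j <;> simp [PentComplex.subdiv, f.compat]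

/-- A single pentagon. -/
def pentagonComplex : PentComplex where
  V := ZMod 5
  T := Unit
  vert := fun _ i => i

/-- `K_n = ωⁿ(K_0)`. -/
def Kn : ℕ → PentComplex
  | 0 => pentagonComplex
  | n + 1 => (Kn n).subdiv

/-- The embedding `K_n → K_{n+1}` that carries the central pentagon to the central pentagon. -/
def iota : ∀ n, (Kn n).Hom (Kn (n + 1))
  | 0 => { onV := fun i => Sum.inr (Sum.inr ((), i))
           onT := fun _ => ((), none)
           compat := fun _ _ => rfl }
  | n + 1 => (iota n).subdiv

/-- The relation that identifies `a` in `F n` with its image in `F (n + 1)`. -/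
def limRel {F : ℕ → Type} (f : ∀ n, F n → F (n + 1)) (a b : Σ n, F n) : Prop :=
  b = ⟨a.1 + 1, f a.1 a.2⟩

/-- The pentagonal complex `K`, the direct limit of `K_0 → K_1 → K_2 → ⋯`. -/
def K : PentComplex where
  V := Quot (limRel fun n => (iota n).onV)
  T := Quot (limRel fun n => (iota n).onT)
  vert := Quot.lift (fun a i => Quot.mk _ ⟨a.1, (Kn a.1).vert a.2 i⟩) (by
    rintro ⟨n, t⟩ b rfl
    funext i
    apply Quot.sound
    simp only [limRel, (iota n).compat])

/-! ## Decorations and local isomorphism -/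

/-- A symmetry of the pentagon: it maps vertex `i` to vertex `shift + sign * i`. -/
structure PentSym where
  shift : ZMod 5
  sign : ℤˣ

/-- Action on vertices. -/
def PentSym.act (σ : PentSym) (i : ZMod 5) : ZMod 5 := σ.shift + ((σ.sign : ℤ) : ZMod 5) * i

/-- The flags of a pentagon: `(i, η)` is the vertex `i` together with the edge that joins it to
the vertex `i + η`. -/
abbrev Flag : Type := ZMod 5 × ℤˣ

/-- Action on flags. -/
def PentSym.actFlag (σ : PentSym) (f : Flag) : Flag := (σ.act f.1, σ.sign * f.2)

/-- A decoration of `L` by symbols from `D`: every tile is marked, through its flags, so that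
decorations without any symmetry are allowed. -/
def Decoration (L : PentComplex) (D : Type*) : Type _ := L.T → Flag → D

namespace PentComplex

variable {D : Type*}

/-- The vertices of a set of tiles. -/
def vertsOf (L : PentComplex) (P : Set L.T) : Set L.V := {v | ∃ t ∈ P, ∃ i, L.vert t i = v}

/-- The edges of `L`. -/
def edges (L : PentComplex) : Set (Sym2 L.V) := {e | ∃ t i, e = s(L.vert t i, L.vert t (i + 1))}

/-- The degree of a vertex: the number of edges that contain it. -/
def degree (L : PentComplex) (v : L.V) : ℕ := {e | e ∈ L.edges ∧ v ∈ e}.ncard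

/-- The subcomplexes formed by the tiles in `P` and by the tiles in `Q` are isomorphic, by a
cell-preserving and decoration preserving isomorphism. -/
def PatchIso (L M : PentComplex) (dL : Decoration L D) (dM : Decoration M D)
    (P : Set L.T) (Q : Set M.T) : Prop :=
  ∃ (τ : L.T → M.T) (g : L.V → M.V), BijOn τ P Q ∧ BijOn g (L.vertsOf P) (M.vertsOf Q) ∧
    ∀ t ∈ P, ∃ σ : PentSym, (∀ i, g (L.vert t i) = M.vert (τ t) (σ.act i)) ∧
      ∀ f, dM (τ t) (σ.actFlag f) = dL t f

/-- `L` is locally isomorphic to `M`: every patch (finite set of tiles) of `L` is isomorphic to a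
patch of `M`. -/
def LocallyIsomorphic (L M : PentComplex) (dL : Decoration L D) (dM : Decoration M D) : Prop :=
  ∀ P : Set L.T, P.Finite → ∃ Q : Set M.T, Q.Finite ∧ PatchIso L M dL dM P Q

end PentComplex

/-! ## The space `L_aff` -/

/-- Vertex `i` of the regular pentagon of side length one centred at the origin. -/
def cornerC (i : ZMod 5) : ℂ :=
  ((1 / (2 * Real.sin (Real.pi / 5)) : ℝ) : ℂ) *
    Complex.exp (((2 * Real.pi * (i.val : ℝ) / 5 : ℝ) : ℂ) * Complex.I)

/-- The regular Euclidean pentagon of side length one. -/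
def pentagon : Set ℂ := convexHull ℝ (range cornerC)

/-- The pentagon as a metric space, with the Euclidean metric. -/
abbrev Pentagon : Type := pentagon

/-- Vertex `i` of the pentagon. -/
def corner (i : ZMod 5) : Pentagon := ⟨cornerC i, subset_convexHull ℝ _ (mem_range_self i)⟩

/-- The point at distance `s` from vertex `i` on the edge from vertex `i` to vertex `i + η`. -/
def edgePt (i : ZMod 5) (η : ℤˣ) (s : unitInterval) : Pentagon :=
  ⟨AffineMap.lineMap (cornerC i) (cornerC (i + ((η : ℤ) : ZMod 5))) (s : ℝ),
    (convex_convexHull ℝ (range cornerC)).lineMap_mem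
      (corner i).2 (corner (i + ((η : ℤ) : ZMod 5))).2 s.2⟩

namespace PentComplex

variable {D : Type*}

/-- Copies of the pentagon, one for each tile, are glued along common vertices and common
edges. -/
inductive Glue (L : PentComplex) : (Σ _ : L.T, Pentagon) → (Σ _ : L.T, Pentagon) → Prop
  | vertex {t t' : L.T} {i j : ZMod 5} (h : L.vert t i = L.vert t' j) :
      Glue L ⟨t, corner i⟩ ⟨t', corner j⟩
  | edge {t t' : L.T} {i j : ZMod 5} (η : ℤˣ) (h₀ : L.vert t i = L.vert t' j)
      (h₁ : L.vert t (i + 1) = L.vert t' (j + ((η : ℤ) : ZMod 5))) (s : unitInterval) :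
      Glue L ⟨t, edgePt i 1 s⟩ ⟨t', edgePt j η s⟩

/-- The underlying space of the complex: unit regular pentagons pasted together in the pattern of
`L`. -/
def Space (L : PentComplex) : Type := Quot L.Glue

/-- The CW topology (the quotient topology of the disjoint union of the pentagons). -/
instance (L : PentComplex) : TopologicalSpace L.Space :=
  inferInstanceAs (TopologicalSpace (Quot L.Glue))

/-- The point `p` of the tile `t`. -/
def pt (L : PentComplex) (t : L.T) (p : Pentagon) : L.Space := Quot.mk _ ⟨t, p⟩

/-- `L.PathLen x y ℓ`: there is a path of length `ℓ` from `x` to `y` that consists of finitely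
many straight segments, each inside one tile. -/
inductive PathLen (L : PentComplex) : L.Space → L.Space → ℝ → Prop
  | nil (x : L.Space) : PathLen L x x 0
  | cons (t : L.T) (p q : Pentagon) {y : L.Space} {l : ℝ} (h : PathLen L (L.pt t q) y l) :
      PathLen L (L.pt t p) y (dist p q + l)

/-- The path metric of `L_aff`. -/
def affDist (L : PentComplex) (x y : L.Space) : ℝ := sInf {l | L.PathLen x y l}

/-- The closed ball of `L_aff`. -/
def ball (L : PentComplex) (x : L.Space) (r : ℝ) : Set L.Space := {y | L.affDist x y ≤ r}

/-- The point `x` is a vertex. -/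
def IsVertex (L : PentComplex) (x : L.Space) : Prop := ∃ t i, x = L.pt t (corner i)

/-- On the subset `S`, the map `φ` is cell-preserving, isometric on each cell, and preserves the
decorations: on every tile whose interior meets `S` it is the restriction of an isometry onto a
tile with the same decoration. -/
def IsCellMapOn {L M : PentComplex} (dL : Decoration L D) (dM : Decoration M D)
    (S : Set L.Space) (φ : L.Space → M.Space) : Prop :=
  ∀ t, (∃ p : Pentagon, (p : ℂ) ∈ interior pentagon ∧ L.pt t p ∈ S) →
    ∃ (t' : M.T) (σ : PentSym) (ρ : Pentagon ≃ᵢ Pentagon),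
      (∀ i, ρ (corner i) = corner (σ.act i)) ∧
      (∀ p, L.pt t p ∈ S → φ (L.pt t p) = M.pt t' (ρ p)) ∧
      ∀ f, dM t' (σ.actFlag f) = dL t f

/-- On the subset `S`, the map `φ` preserves the degree of the vertices. -/
def PreservesDegreeOn {L M : PentComplex} (S : Set L.Space) (φ : L.Space → M.Space) : Prop :=
  ∀ t i t' j, L.pt t (corner i) ∈ S → φ (L.pt t (corner i)) = M.pt t' (corner j) →
    L.degree (L.vert t i) = M.degree (M.vert t' j)

end PentComplex

/-! ## The continuous hull `Ω` and the discrete hull `Ξ` -/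

universe u

/-- A combinatorial tiling (a complex homeomorphic to the plane), decorated, that is locally
isomorphic to `K` with the decoration `δ`. -/
structure Tiling {D : Type u} (δ : Decoration K D) where
  cpx : PentComplex
  dec : Decoration cpx D
  plane : Nonempty (cpx.Space ≃ₜ EuclideanSpace ℝ (Fin 2))
  locIso : cpx.LocallyIsomorphic K dec δ

/-- A tiling with a distinguished point. -/
structure Pointed {D : Type u} (δ : Decoration K D) extends Tiling δ where
  point : cpx.Space

variable {D : Type u} {δ : Decoration K D}

/-- Isomorphism of pointed tilings: a homeomorphism that is cell-preserving, decoration preserving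
and isometric on each cell and that matches the distinguished points. -/
def Pointed.Iso (X Y : Pointed δ) : Prop :=
  ∃ φ : X.cpx.Space ≃ₜ Y.cpx.Space, PentComplex.IsCellMapOn X.dec Y.dec univ φ ∧
    PentComplex.IsCellMapOn Y.dec X.dec univ φ.symm ∧ φ X.point = Y.point

theorem isCellMapOn_univ_comp {L M N : PentComplex} {dL : Decoration L D} {dM : Decoration M D}
    {dN : Decoration N D} {φ : L.Space → M.Space} {ψ : M.Space → N.Space}
    (hφ : PentComplex.IsCellMapOn dL dM univ φ) (hψ : PentComplex.IsCellMapOn dM dN univ ψ) :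
    PentComplex.IsCellMapOn dL dN univ (ψ ∘ φ) := by
  rintro t ⟨p, hp, -⟩
  obtain ⟨t', σ, ρ, h1, h2, h3⟩ := hφ t ⟨p, hp, mem_univ _⟩
  obtain ⟨t'', σ', ρ', h1', h2', h3'⟩ := hψ t' ⟨p, hp, mem_univ _⟩
  refine ⟨t'', ⟨σ'.act σ.shift, σ'.sign * σ.sign⟩, ρ.trans ρ', fun i => ?_, fun q _ => ?_,
    fun f => ?_⟩
  · rw [IsometryEquiv.trans_apply, h1, h1']
    congr 1
    simp [PentSym.act]
    ring
  · simp [h2 q (mem_univ _), h2' _ (mem_univ _)]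
  · rw [← h3, ← h3']
    congr 1
    simp [PentSym.actFlag, PentSym.act, mul_assoc]
    ring

instance pointedSetoid (δ : Decoration K D) : Setoid (Pointed δ) where
  r := Pointed.Iso
  iseqv := by
    have key : ∀ X : Pointed δ, PentComplex.IsCellMapOn X.dec X.dec univ id := by
      intro X t _
      refine ⟨t, ⟨0, 1⟩, IsometryEquiv.refl _, fun i => ?_, fun p _ => rfl, fun f => ?_⟩
      · rw [show PentSym.act ⟨0, 1⟩ i = i by simp [PentSym.act]]
        rfl
      · simp [PentSym.act, PentSym.actFlag]
    refine ⟨fun X => ⟨Homeomorph.refl _, key X, key X, rfl⟩, ?_, ?_⟩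
    · rintro X Y ⟨φ, h1, h2, h3⟩
      exact ⟨φ.symm, h2, h1, by simp [← h3]⟩
    · rintro X Y Z ⟨φ, h1, h2, h3⟩ ⟨ψ, k1, k2, k3⟩
      refine ⟨φ.trans ψ, isCellMapOn_univ_comp (φ := φ) (ψ := ψ) h1 k1,
        isCellMapOn_univ_comp (φ := ψ.symm) (ψ := φ.symm) k2 h2, ?_⟩
      simp [h3, k3]

/-- The continuous hull `Ω`: isomorphism classes of tilings with a distinguished point. -/
def Omega (δ : Decoration K D) : Type (max 1 u) := Quotient (pointedSetoid δ)

/-- The class of a pointed tiling. -/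
def cls (X : Pointed δ) : Omega δ := Quotient.mk (pointedSetoid δ) X

/-- There is a map `φ : B(x, 1/ε, L) → L'` with `d(φ(x), x') ≤ ε` that is cell-preserving, is an
isometry, and preserves the decorations and the degree of the vertices. -/
def Approx (ε : ℝ) (X Y : Pointed δ) : Prop :=
  ∃ φ : X.cpx.Space → Y.cpx.Space,
    PentComplex.IsCellMapOn X.dec Y.dec (X.cpx.ball X.point (1 / ε)) φ ∧
    (∀ y ∈ X.cpx.ball X.point (1 / ε), ∀ z ∈ X.cpx.ball X.point (1 / ε),
      Y.cpx.affDist (φ y) (φ z) = X.cpx.affDist y z) ∧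
    PentComplex.PreservesDegreeOn (X.cpx.ball X.point (1 / ε)) φ ∧
    Y.cpx.affDist (φ X.point) Y.point ≤ ε

/-- The set `Λ` of admissible `ε`; the condition does not depend on the representatives. -/
def Lam (a b : Omega δ) : Set ℝ :=
  {ε | 0 < ε ∧ ∃ X Y : Pointed δ, cls X = a ∧ cls Y = b ∧ Approx ε X Y ∧ Approx ε Y X}

/-- The metric of `Ω`, `min (1/√2, inf Λ)`, where the infimum of the empty set is infinite. -/
def hullDist (a b : Omega δ) : ℝ := sInf (insert (1 / Real.sqrt 2) (Lam a b))

/-- The topology of the metric `hullDist`. -/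
instance (δ : Decoration K D) : TopologicalSpace (Omega δ) where
  IsOpen U := ∀ a ∈ U, ∃ r > 0, ∀ b, hullDist a b < r → b ∈ U
  isOpen_univ := fun _ _ => ⟨1, one_pos, fun _ _ => mem_univ _⟩
  isOpen_inter := by
    rintro U W hU hW a ⟨h1, h2⟩
    obtain ⟨r, hr, h⟩ := hU a h1
    obtain ⟨r', hr', h'⟩ := hW a h2
    exact ⟨min r r', lt_min hr hr', fun b hb =>
      ⟨h b (hb.trans_le (min_le_left _ _)), h' b (hb.trans_le (min_le_right _ _))⟩⟩
  isOpen_sUnion := by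
    rintro S hS a ⟨U, hU, ha⟩
    obtain ⟨r, hr, h⟩ := hS U hU a ha
    exact ⟨r, hr, fun b hb => ⟨U, hU, h b hb⟩⟩

/-- The discrete hull `Ξ`, inside `Ω`: the classes of tilings whose distinguished point is a
vertex. -/
def Xi (δ : Decoration K D) : Set (Omega δ) :=
  {a | ∃ X : Pointed δ, X.cpx.IsVertex X.point ∧ a = cls X}

end PentHull

end

open Set

noncomputable section
namespace PentHull

/-! ## Complete fans in the plane -/

/-! Compactness is a diagonal argument along an ultrafilter `F` that contains `Xi δ`. Each class is
represented by a tiling with a base tile that has the distinguished vertex as a corner. A tile of a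
tiling has at most 20 adjacent tiles, itself included, so these can be numbered, and a word in the
numbers names a tile of every tiling. Words that name the same tile for `F`-almost every class are
identified, and similarly for vertices; this gives a limit complex, decorated because a map to the
finite set `D` is constant on a member of `F`. There are finitely many words of length at most `n`,
so almost every tiling matches the limit on the ball of `n` adjacency steps
(`PointedFamily.eventually_ballRel`). A matching of combinatorial balls is an isometry on smaller
metric balls (`BallRel.exists_isometry`), whence convergence in `hullDist`.

The difficulty is that the limit must again be a plane. Local isomorphism to `K`, connectedness and
the property that every edge lies in two tiles hold for the limit. The last one holds for tilings of
the plane, since a small circle around a point of a free edge would contract inside its tile while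
avoiding that point (`exists_opposite_of_plane`). Conversely, these properties force a plane
(`LocEmb.nonempty_homeomorph`): in `K` every combinatorial ball lies in an open disc of controlled
size (`exists_disc_inBall`), embeddings of patches carry these discs over to the complex, and a
monotone union of open discs is a plane by the theorem of Brown. The discs in `K` come from
self-similarity: `K` is its own subdivision, so deflation is a homeomorphism of `K`, and after
enough deflations a ball is so small that it fits into the open star of one vertex or tile. Open
stars are discs because every vertex of `K` lies in a cycle of three or four tiles (`K_full`).

Points of a complex are handled through the functions that are linear on the five triangles of each
tile, given by values at vertices and centres. They separate points (`evP_separates`), so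
injectivity, and agreement of maps under the gluing, reduce to formulas for their values.

Closedness has its own proof and is not derived from compactness. The distance to the nearest corner
of the tile is 1-Lipschitz for the path metric, is preserved by cell maps and vanishes exactly at
the vertices. A class where it is `c > 0` has no point of `Xi δ` within `min c (1 / √2)`. -/

/-- A complete fan of `n` cones in the plane, with continuous piecewise linear coordinates. -/
structure Fan (n : ℕ) where
  ray : ZMod n → ℂ
  coord : ZMod n → ℂ → ℝ
  cont : ∀ j, Continuous (coord j)
  exists_cone : ∀ z, ∃ (j : ZMod n) (x y : ℝ), 0 ≤ x ∧ 0 ≤ y ∧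
    z = (x : ℂ) * ray j + (y : ℂ) * ray (j + 1)
  coord_cone : ∀ (j : ZMod n) (x y : ℝ), 0 ≤ x → 0 ≤ y → ∀ k,
    coord k ((x : ℂ) * ray j + (y : ℂ) * ray (j + 1)) =
      (if k = j then x else 0) + (if k = j + 1 then y else 0)

/-- The determinant of two vectors of the plane. -/
def cdet (z w : ℂ) : ℝ := z.re * w.im - z.im * w.re

theorem cdet_comb_right (z a b : ℂ) (x y : ℝ) :
    cdet z ((x : ℂ) * a + (y : ℂ) * b) = x * cdet z a + y * cdet z b := by
  simp [cdet]; ring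

theorem cdet_comb_left (z a b : ℂ) (x y : ℝ) :
    cdet ((x : ℂ) * a + (y : ℂ) * b) z = x * cdet a z + y * cdet b z := by
  simp [cdet]; ring

theorem cdet_self (z : ℂ) : cdet z z = 0 := by simp [cdet]; ring

theorem cdet_swap (z w : ℂ) : cdet z w = - cdet w z := by simp [cdet]; ring

theorem continuous_cdet_left (w : ℂ) : Continuous fun z => cdet z w := by
  unfold cdet; fun_prop

theorem continuous_cdet_right (w : ℂ) : Continuous fun z => cdet w z := by
  unfold cdet; fun_prop

theorem cdet_sum {ι : Type*} (s : Finset ι) (f : ι → ℂ) (z : ℂ) :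
    cdet (∑ i ∈ s, f i) z = ∑ i ∈ s, cdet (f i) z := by
  simp [cdet, Complex.re_sum, Complex.im_sum, Finset.sum_mul, Finset.sum_sub_distrib]

/-- Cramer's rule. -/
theorem eq_comb_of_cdet {a b : ℂ} (h : cdet a b ≠ 0) (z : ℂ) :
    z = ((cdet z b / cdet a b : ℝ) : ℂ) * a + ((cdet a z / cdet a b : ℝ) : ℂ) * b := by
  apply Complex.ext
  · simp only [Complex.add_re, Complex.mul_re, Complex.ofReal_re, Complex.ofReal_im]
    field_simp
    simp only [cdet]; ring
  · simp only [Complex.add_im, Complex.mul_im, Complex.ofReal_re, Complex.ofReal_im]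
    field_simp
    simp only [cdet]; ring

/-- In a cyclic sequence with a positive and a non-positive member, some positive member is
followed by a non-positive one. -/
theorem exists_pos_followed_by_nonpos {n : ℕ} [NeZero n] (f : ZMod n → ℝ) {a b : ZMod n}
    (ha : 0 < f a) (hb : f b ≤ 0) : ∃ j, 0 < f j ∧ f (j + 1) ≤ 0 := by
  by_contra! h
  have key : ∀ k : ℕ, 0 < f (a + k) := by
    intro k
    induction k with
    | zero => simpa using ha
    | succ k ih => have := h _ ih; push_cast; rwa [← add_assoc]
  have := key (b - a).val
  rw [ZMod.natCast_zmod_val] at this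
  simp at this
  linarith

/-- The fan of a cyclic sequence of vectors with angles at most a right angle. -/
def fanOfDet {n : ℕ} [NeZero n] (e : ZMod n → ℂ) (s : ℝ) (hs : 0 < s)
    (h1 : ∀ j, cdet (e j) (e (j + 1)) = s) (h2 : ∀ j, 0 ≤ cdet (e (j - 1)) (e (j + 1)))
    (h3 : ∀ j k, k ≠ j - 1 → k ≠ j → (cdet (e (j - 1)) (e k) ≤ 0 ∧ cdet (e (j - 1)) (e (k + 1)) ≤ 0) ∨
      (cdet (e k) (e (j + 1)) ≤ 0 ∧ cdet (e (k + 1)) (e (j + 1)) ≤ 0))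
    (h4 : ∑ j, e j = 0) : Fan n where
  ray := e
  -- On the two cones at the ray `e j` the coefficient of `e j` is one of the two determinants
  -- divided by `s`, and by `h2` it is the smaller one. On every other cone `h3` makes one
  -- determinant non-positive, so the positive part vanishes.
  coord := fun j z => max 0 (min (cdet (e (j - 1)) z) (cdet z (e (j + 1)))) / s
  cont := fun j => ((continuous_const.max ((continuous_cdet_right _).min
    (continuous_cdet_left _)))).div_const _
  exists_cone := by
    intro z
    by_cases hz : ∀ j, cdet (e j) z = 0
    · refine ⟨0, 0, 0, le_rfl, le_rfl, ?_⟩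
      have := eq_comb_of_cdet (a := e 0) (b := e (0 + 1)) (by rw [h1]; exact hs.ne') z
      rw [cdet_swap z, hz, hz] at this
      simpa using this
    -- The rays sum to zero, hence so do the determinants with `z`. They are not all zero, so along
    -- the cycle the sign passes somewhere from positive to non-positive, and the cone at that place
    -- contains `z`.
    have hsum : ∑ j, cdet (e j) z = 0 := by rw [← cdet_sum, h4]; simp [cdet]
    obtain ⟨a, ha⟩ : ∃ a, 0 < cdet (e a) z := by
      by_contra! h
      exact hz fun j => (Finset.sum_eq_zero_iff_of_nonpos (fun j _ => h j)).1 hsum j (Finset.mem_univ _)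
    obtain ⟨b, hb⟩ : ∃ b, cdet (e b) z ≤ 0 := by
      by_contra! h
      exact hz fun j => (Finset.sum_eq_zero_iff_of_nonneg (fun j _ => (h j).le)).1 hsum j
        (Finset.mem_univ _)
    obtain ⟨j, hj, hj'⟩ := exists_pos_followed_by_nonpos (fun j => cdet (e j) z) ha hb
    refine ⟨j, _, _, ?_, ?_, eq_comb_of_cdet (by rw [h1]; exact hs.ne') z⟩
    · rw [h1, cdet_swap]; exact div_nonneg (by linarith) hs.le
    · rw [h1]; exact div_nonneg hj.le hs.le
  coord_cone := by
    intro j x y hx hy k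
    have hne : j + 1 ≠ j := by
      intro h; have := h1 j; rw [h, cdet_self] at this; exact hs.ne this
    by_cases hk : k = j
    · subst hk
      rw [if_pos rfl, if_neg hne.symm, add_zero, cdet_comb_right, cdet_comb_left, h1, cdet_self]
      have := h1 (k - 1)
      rw [sub_add_cancel] at this
      rw [this, min_eq_right (by nlinarith [h2 k, mul_nonneg hy (h2 k)]), max_eq_right (by positivity)]
      field_simp; ring
    by_cases hk' : k = j + 1
    · subst hk'
      rw [if_neg hne, if_pos rfl, zero_add, cdet_comb_right, cdet_comb_left, h1, add_sub_cancel_right,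
        cdet_self, h1]
      have := h2 (j + 1)
      rw [add_sub_cancel_right] at this
      rw [min_eq_left (by nlinarith [mul_nonneg hx this]), max_eq_right (by positivity)]
      field_simp; ring
    · rw [if_neg hk, if_neg hk', add_zero, div_eq_zero_iff]
      left
      rw [max_eq_left]
      rw [cdet_comb_right, cdet_comb_left, min_le_iff]
      rcases h3 k j (fun h => hk' (by rw [h]; ring)) (Ne.symm hk) with h | h
      · left; nlinarith [mul_nonneg hx (neg_nonneg.2 h.1), mul_nonneg hy (neg_nonneg.2 h.2)]
      · right; nlinarith [mul_nonneg hx (neg_nonneg.2 h.1), mul_nonneg hy (neg_nonneg.2 h.2)]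

/-- The vector with integral coordinates. -/
def gaussC (p : ℤ × ℤ) : ℂ := ⟨p.1, p.2⟩

theorem cdet_gaussC (p q : ℤ × ℤ) :
    cdet (gaussC p) (gaussC q) = ((p.1 * q.2 - p.2 * q.1 : ℤ) : ℝ) := by
  simp [cdet, gaussC]

/-- The four quadrants. -/
def quadrantFan : Fan 4 :=
  fanOfDet (fun j => gaussC ((![(1, 0), (0, 1), (-1, 0), (0, -1)] : Fin 4 → ℤ × ℤ) j)) 1 one_pos
    (by
      simp only [cdet_gaussC]; norm_cast)
    (by
      simp only [cdet_gaussC]; norm_cast)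
    (by
      simp only [cdet_gaussC]; norm_cast)
    (by
      change ∑ j : Fin 4, _ = _
      simp [Fin.sum_univ_four, gaussC, Complex.ext_iff])

/-- Three cones that cover the plane. -/
def tripodFan : Fan 3 where
  ray := fun j => gaussC ((![(1, 0), (0, 1), (-1, -1)] : Fin 3 → ℤ × ℤ) j)
  -- The three rays sum to zero, so a constant may be subtracted from the coefficients `(z.re, z.im,
  -- 0)`; subtracting their minimum makes them non-negative with one of them zero. `fanOfDet` does
  -- not apply, since its hypothesis `h2` fails for these rays.
  coord := fun j z => (![z.re, z.im, 0] : Fin 3 → ℝ) j - min (min z.re z.im) 0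
  cont := by
    intro j
    change Fin 3 at j
    fin_cases j <;> simp <;> fun_prop
  exists_cone := by
    intro z
    rcases le_total 0 z.re with h1 | h1 <;> rcases le_total 0 z.im with h2 | h2
    · exact ⟨0, z.re, z.im, h1, h2, by apply Complex.ext <;> simp [gaussC]⟩
    · exact ⟨2, -z.im, z.re - z.im, by linarith, by linarith, by
        rw [show (2 : ZMod 3) + 1 = 0 from rfl]
        apply Complex.ext <;> simp [gaussC]⟩
    · exact ⟨1, z.im - z.re, -z.re, by linarith, by linarith, by
        rw [show (1 : ZMod 3) + 1 = 2 from rfl]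
        apply Complex.ext <;> simp [gaussC]⟩
    · rcases le_total z.re z.im with h | h
      · exact ⟨1, z.im - z.re, -z.re, by linarith, by linarith, by
          rw [show (1 : ZMod 3) + 1 = 2 from rfl]
          apply Complex.ext <;> simp [gaussC]⟩
      · exact ⟨2, -z.im, z.re - z.im, by linarith, by linarith, by
          rw [show (2 : ZMod 3) + 1 = 0 from rfl]
          apply Complex.ext <;> simp [gaussC]⟩
  coord_cone := by
    intro j x y hx hy k
    have hj : (j = 0 ∧ j + 1 = 1) ∨ (j = 1 ∧ j + 1 = 2) ∨ (j = 2 ∧ j + 1 = 0) := by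
      revert j; decide
    have hk : k = 0 ∨ k = 1 ∨ k = 2 := by revert k; decide
    rcases hj with ⟨h1, h2⟩ | ⟨h1, h2⟩ | ⟨h1, h2⟩ <;> rw [h2, h1]
    · have hm : min (min x y) 0 = 0 := min_eq_right (le_min hx hy)
      rcases hk with rfl | rfl | rfl <;> simp (decide := true) [gaussC, hm]
    · have hm : min (min (-y) (x + -y)) 0 = -y := by
        have h : -y ≤ x + -y := by linarith
        rw [min_eq_left h, min_eq_left (by linarith)]
      rcases hk with rfl | rfl | rfl <;> simp (decide := true) [gaussC, hm]
    · have hm : min (min (-x + y) (-x)) 0 = -x := by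
        rw [min_eq_right (by linarith : -x ≤ -x + y), min_eq_left (by linarith)]
      rcases hk with rfl | rfl | rfl <;> simp (decide := true) [gaussC, hm]

/-! ## The regular pentagon -/

/-- The radius of the circumscribed circle. -/
def pentR : ℝ := 1 / (2 * Real.sin (Real.pi / 5))

theorem sin_pi_div_five_pos : 0 < Real.sin (Real.pi / 5) :=
  Real.sin_pos_of_pos_of_lt_pi (by positivity) (by linarith [Real.pi_pos])

theorem pentR_pos : 0 < pentR := by
  have := sin_pi_div_five_pos
  unfold pentR; positivity

theorem cornerC_re (i : ZMod 5) : (cornerC i).re = pentR * Real.cos (2 * Real.pi * i.val / 5) := by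
  unfold cornerC pentR
  rw [Complex.re_ofReal_mul, Complex.exp_ofReal_mul_I_re]

theorem cornerC_im (i : ZMod 5) : (cornerC i).im = pentR * Real.sin (2 * Real.pi * i.val / 5) := by
  unfold cornerC pentR
  rw [Complex.im_ofReal_mul, Complex.exp_ofReal_mul_I_im]

theorem cos_sin_two_pi_mul (i j : ZMod 5) :
    Real.cos (2 * Real.pi * (j.val : ℝ) / 5 - 2 * Real.pi * (i.val : ℝ) / 5) =
      Real.cos (2 * Real.pi * ((j - i).val : ℝ) / 5) ∧
    Real.sin (2 * Real.pi * (j.val : ℝ) / 5 - 2 * Real.pi * (i.val : ℝ) / 5) =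
      Real.sin (2 * Real.pi * ((j - i).val : ℝ) / 5) := by
  obtain ⟨m, hm⟩ : ∃ m : ℤ, (j.val : ℤ) - i.val = (j - i).val + 5 * m := by
    have : (((j.val : ℤ) - i.val - (j - i).val : ℤ) : ZMod 5) = 0 := by
      push_cast; simp
    obtain ⟨m, hm⟩ := (ZMod.intCast_zmod_eq_zero_iff_dvd _ 5).1 this
    exact ⟨m, by push_cast at hm; linarith⟩
  have hm' : (j.val : ℝ) - i.val = (j - i).val + 5 * m := by exact_mod_cast hm
  have : 2 * Real.pi * (j.val : ℝ) / 5 - 2 * Real.pi * (i.val : ℝ) / 5 =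
      2 * Real.pi * ((j - i).val : ℝ) / 5 + m * (2 * Real.pi) := by
    rw [← sub_div, ← mul_sub, hm']; ring
  rw [this]
  exact ⟨Real.cos_add_int_mul_two_pi _ _, Real.sin_add_int_mul_two_pi _ _⟩

theorem cdet_cornerC (i j : ZMod 5) :
    cdet (cornerC i) (cornerC j) = pentR ^ 2 * Real.sin (2 * Real.pi * ((j - i).val : ℝ) / 5) := by
  rw [← (cos_sin_two_pi_mul i j).2, Real.sin_sub]
  simp only [cdet, cornerC_re, cornerC_im]; ring

/-- The two positive values of the determinant of two corners. -/
def sinOne : ℝ := Real.sin (2 * Real.pi / 5)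
def sinTwo : ℝ := Real.sin (Real.pi / 5)

theorem sinOne_pos : 0 < sinOne :=
  Real.sin_pos_of_pos_of_lt_pi (by positivity) (by linarith [Real.pi_pos])

theorem sinTwo_pos : 0 < sinTwo := sin_pi_div_five_pos

theorem sin_val (k : ZMod 5) : Real.sin (2 * Real.pi * (k.val : ℝ) / 5) =
    (![0, sinOne, sinTwo, -sinTwo, -sinOne] : Fin 5 → ℝ) k := by
  change Fin 5 at k
  fin_cases k
  · simp [ZMod.val]
  · simp [ZMod.val, sinOne]
  · change Real.sin (2 * Real.pi * (2 : ℕ) / 5) = Real.sin (Real.pi / 5)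
    rw [← Real.sin_pi_sub]; congr 1; push_cast; ring
  · change Real.sin (2 * Real.pi * (3 : ℕ) / 5) = -Real.sin (Real.pi / 5)
    rw [← Real.sin_add_pi]; congr 1; push_cast; ring
  · change Real.sin (2 * Real.pi * (4 : ℕ) / 5) = -Real.sin (2 * Real.pi / 5)
    rw [← Real.sin_two_pi_sub]; congr 1; push_cast; ring

theorem cdet_corner_add (i k : ZMod 5) : cdet (cornerC i) (cornerC (i + k)) =
    pentR ^ 2 * (![0, sinOne, sinTwo, -sinTwo, -sinOne] : Fin 5 → ℝ) k := by
  rw [cdet_cornerC, add_sub_cancel_left, sin_val]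

theorem cdet_corner_one (i : ZMod 5) :
    cdet (cornerC i) (cornerC (i + 1)) = pentR ^ 2 * sinOne := cdet_corner_add i 1

/-- The determinants of the corners with a fixed corner cancel in pairs, so the sum has determinant
zero with two independent vectors. -/
theorem sum_cornerC : ∑ i, cornerC i = 0 := by
  have h : ∀ i j : ZMod 5, cdet (cornerC (i + 1)) (cornerC i) = - (pentR ^ 2 * sinOne) := by
    intro i j; rw [cdet_swap, cdet_corner_one]
  have key : ∀ j : ZMod 5, cdet (∑ i, cornerC i) (cornerC j) = 0 := by
    intro j
    rw [cdet_sum, ← Equiv.sum_comp (Equiv.addLeft j)]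
    simp only [Equiv.coe_addLeft]
    simp only [fun k => (cdet_swap (cornerC (j + k)) (cornerC j)), cdet_corner_add]
    change ∑ k : Fin 5, _ = _
    simp [Fin.sum_univ_five]
  have h1 := cdet_corner_one 0
  have hpos : 0 < pentR ^ 2 * sinOne := mul_pos (pow_pos pentR_pos 2) sinOne_pos
  have := eq_comb_of_cdet (a := cornerC 0) (b := cornerC (0 + 1)) (by rw [h1]; exact hpos.ne')
    (∑ i, cornerC i)
  rw [cdet_swap (cornerC 0) (∑ i, cornerC i), key, key] at this
  simpa using this

/-- The fan of the five corners of the pentagon. -/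
def pentFan : Fan 5 :=
  fanOfDet cornerC (pentR ^ 2 * sinOne) (mul_pos (pow_pos pentR_pos 2) sinOne_pos) cdet_corner_one
    (by
      intro j
      have := cdet_corner_add (j - 1) 2
      rw [show j - 1 + 2 = j + 1 by ring] at this
      rw [this]
      have := sinTwo_pos
      change 0 ≤ pentR ^ 2 * sinTwo
      positivity)
    (by
      intro j k h1 h2
      have hp := pow_pos pentR_pos 2
      have hA := mul_pos hp sinOne_pos
      have hB := mul_pos hp sinTwo_pos
      have hk : k = j + 1 ∨ k = j + 2 ∨ k = j + 3 := by
        clear hA hB hp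
        revert j k; decide
      rcases hk with rfl | rfl | rfl
      · right
        have e1 := cdet_corner_add (j + 1) 0
        have e2 := cdet_corner_add (j + 1 + 1) 4
        rw [show j + 1 + 1 + 4 = j + 1 + 5 by ring, show (5 : ZMod 5) = 0 from rfl, add_zero] at e2
        rw [add_zero] at e1
        rw [e1, e2]
        refine ⟨by simp, ?_⟩
        change pentR ^ 2 * -sinOne ≤ 0
        linarith
      · right
        have e1 := cdet_corner_add (j + 2) 4
        have e2 := cdet_corner_add (j + 2 + 1) 3
        rw [show j + 2 + 4 = j + 1 + 5 by ring, show (5 : ZMod 5) = 0 from rfl, add_zero] at e1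
        rw [show j + 2 + 1 + 3 = j + 1 + 5 by ring, show (5 : ZMod 5) = 0 from rfl, add_zero] at e2
        rw [e1, e2]
        constructor
        · change pentR ^ 2 * -sinOne ≤ 0
          linarith
        · change pentR ^ 2 * -sinTwo ≤ 0
          linarith
      · left
        have e1 := cdet_corner_add (j - 1) 4
        have e2 := cdet_corner_add (j - 1) 0
        rw [show j - 1 + 4 = j + 3 by ring] at e1
        rw [show j - 1 + 0 = j + 3 + 1 - 5 by ring, show (5 : ZMod 5) = 0 from rfl, sub_zero] at e2
        rw [e1, e2]
        refine ⟨?_, by simp⟩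
        change pentR ^ 2 * -sinOne ≤ 0
        linarith)
    sum_cornerC

theorem dist_cornerC_sq (i j : ZMod 5) : dist (cornerC i) (cornerC j) ^ 2 =
    pentR ^ 2 * (2 - 2 * Real.cos (2 * Real.pi * ((j - i).val : ℝ) / 5)) := by
  rw [← (cos_sin_two_pi_mul i j).1, Real.cos_sub, Complex.dist_eq, ← Complex.normSq_eq_norm_sq,
    Complex.normSq_apply]
  simp only [Complex.sub_re, Complex.sub_im, cornerC_re, cornerC_im]
  have h1 := Real.sin_sq_add_cos_sq (2 * Real.pi * (i.val : ℝ) / 5)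
  have h2 := Real.sin_sq_add_cos_sq (2 * Real.pi * (j.val : ℝ) / 5)
  linear_combination pentR ^ 2 * (h1 + h2)

theorem pentR_sq_mul : pentR ^ 2 * (4 * sinTwo ^ 2) = 1 := by
  have := sinTwo_pos
  unfold pentR
  change (1 / (2 * sinTwo)) ^ 2 * (4 * sinTwo ^ 2) = 1
  field_simp
  norm_num

theorem cos_val (k : ZMod 5) : Real.cos (2 * Real.pi * (k.val : ℝ) / 5) =
    (![1, Real.cos (2 * Real.pi / 5), -Real.cos (Real.pi / 5), -Real.cos (Real.pi / 5),
      Real.cos (2 * Real.pi / 5)] : Fin 5 → ℝ) k := by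
  change Fin 5 at k
  fin_cases k
  · simp [ZMod.val]
  · simp [ZMod.val]
  · change Real.cos (2 * Real.pi * (2 : ℕ) / 5) = -Real.cos (Real.pi / 5)
    rw [← Real.cos_pi_sub]; congr 1; push_cast; ring
  · change Real.cos (2 * Real.pi * (3 : ℕ) / 5) = -Real.cos (Real.pi / 5)
    rw [← Real.cos_add_pi]; congr 1; push_cast; ring
  · change Real.cos (2 * Real.pi * (4 : ℕ) / 5) = Real.cos (2 * Real.pi / 5)
    rw [← Real.cos_two_pi_sub]; congr 1; push_cast; ring

theorem sinTwo_sq : sinTwo ^ 2 = (5 - √5) / 8 := by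
  have h := Real.sin_sq_add_cos_sq (Real.pi / 5)
  have h5 : √5 ^ 2 = 5 := Real.sq_sqrt (by norm_num)
  rw [Real.cos_pi_div_five] at h
  unfold sinTwo
  nlinarith

theorem dist_cornerC_succ (i : ZMod 5) : dist (cornerC i) (cornerC (i + 1)) = 1 := by
  have := dist_cornerC_sq i (i + 1)
  rw [add_sub_cancel_left, cos_val] at this
  have e : Real.cos (2 * Real.pi / 5) = 1 - 2 * sinTwo ^ 2 := by
    rw [show 2 * Real.pi / 5 = 2 * (Real.pi / 5) by ring, Real.cos_two_mul, Real.cos_sq']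
    unfold sinTwo; ring
  have h : dist (cornerC i) (cornerC (i + 1)) ^ 2 = 1 := by
    rw [this, ← pentR_sq_mul]
    change pentR ^ 2 * (2 - 2 * Real.cos (2 * Real.pi / 5)) = _
    rw [e]; ring
  nlinarith [dist_nonneg (x := cornerC i) (y := cornerC (i + 1))]

/-- A diagonal has the golden ratio as its length, with square about 2.6. The bound 2 suffices for
`one_le_dist_edgePt`. -/
theorem two_le_dist_sq {i j : ZMod 5} (h0 : j ≠ i) (h1 : j ≠ i + 1) (h2 : j ≠ i - 1) :
    2 ≤ dist (cornerC i) (cornerC j) ^ 2 := by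
  rw [dist_cornerC_sq, cos_val]
  have hk : j - i = 2 ∨ j - i = 3 := by revert i j; decide
  have key : 2 ≤ pentR ^ 2 * (2 - 2 * -Real.cos (Real.pi / 5)) := by
    have h4 := pentR_sq_mul
    have hR : 0 < pentR ^ 2 := pow_pos pentR_pos 2
    rw [sinTwo_sq] at h4
    rw [Real.cos_pi_div_five]
    have h5 : 2 ≤ √5 := Real.le_sqrt_of_sq_le (by norm_num)
    nlinarith
  rcases hk with h | h <;> rw [h]
  · exact key
  · exact key

/-- The square of the distance to a point of a segment. -/
theorem dist_lineMap_sq (z a b : ℂ) (s : ℝ) : dist (AffineMap.lineMap a b s) z ^ 2 =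
    (1 - s) * dist a z ^ 2 + s * dist b z ^ 2 - s * (1 - s) * dist a b ^ 2 := by
  simp only [Complex.dist_eq, ← Complex.normSq_eq_norm_sq, Complex.normSq_apply,
    AffineMap.lineMap_apply, vsub_eq_sub, vadd_eq_add, Complex.real_smul, Complex.sub_re,
    Complex.sub_im, Complex.add_re, Complex.add_im, Complex.mul_re, Complex.mul_im,
    Complex.ofReal_re, Complex.ofReal_im]
  ring

theorem dist_cornerC_unit (i : ZMod 5) (η : ℤˣ) :
    dist (cornerC i) (cornerC (i + ((η : ℤ) : ZMod 5))) = 1 := by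
  rcases Int.units_eq_one_or η with rfl | rfl
  · simpa using dist_cornerC_succ i
  · have := dist_cornerC_succ (i - 1)
    rw [sub_add_cancel, dist_comm] at this
    simpa [sub_eq_add_neg] using this

theorem dist_edgePt_left (i : ZMod 5) (η : ℤˣ) (s : unitInterval) :
    dist (edgePt i η s) (corner i) = s := by
  rw [Subtype.dist_eq]
  simp only [edgePt, corner]
  rw [dist_lineMap_left, dist_cornerC_unit, mul_one, Real.norm_of_nonneg s.2.1]

theorem dist_edgePt_right (i : ZMod 5) (η : ℤˣ) (s : unitInterval) :
    dist (edgePt i η s) (corner (i + ((η : ℤ) : ZMod 5))) = 1 - s := by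
  rw [Subtype.dist_eq]
  simp only [edgePt, corner]
  rw [dist_lineMap_right, dist_cornerC_unit, mul_one, Real.norm_of_nonneg (by linarith [s.2.2])]

/-- This makes the cone with apex at a third corner irrelevant on an edge, see `coneP_edgePt`. In
the formula `dist_lineMap_sq` it is enough that one end of the edge has squared distance at least 2
from the third corner and the other at least 1. -/
theorem one_le_dist_edgePt {i j : ZMod 5} (η : ℤˣ) (s : unitInterval) (h0 : j ≠ i)
    (h1 : j ≠ i + ((η : ℤ) : ZMod 5)) : 1 ≤ dist (edgePt i η s) (corner j) := by
  have hs0 := s.2.1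
  have hs1 := s.2.2
  have key : 1 ≤ dist (edgePt i η s) (corner j) ^ 2 := by
    rw [Subtype.dist_eq]
    simp only [edgePt, corner]
    rw [dist_lineMap_sq, dist_cornerC_unit]
    by_cases h2 : j = i - ((η : ℤ) : ZMod 5)
    · have e1 : dist (cornerC i) (cornerC j) = 1 := by
        have := dist_cornerC_unit i (-η)
        rwa [show i + (((-η : ℤˣ) : ℤ) : ZMod 5) = j by rw [h2]; push_cast; ring] at this
      have e2 : 2 ≤ dist (cornerC (i + ((η : ℤ) : ZMod 5))) (cornerC j) ^ 2 := by
        apply two_le_dist_sq <;> rw [h2] <;> clear h0 h1 h2 e1 <;> revert i η <;> decide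
      rw [e1]
      nlinarith
    · have e1 : 2 ≤ dist (cornerC i) (cornerC j) ^ 2 := by
        apply two_le_dist_sq <;> revert i j η <;> decide
      by_cases h3 : j = i + 2 * ((η : ℤ) : ZMod 5)
      · have e2 : dist (cornerC (i + ((η : ℤ) : ZMod 5))) (cornerC j) = 1 := by
          have := dist_cornerC_unit (i + ((η : ℤ) : ZMod 5)) η
          rwa [show i + ((η : ℤ) : ZMod 5) + ((η : ℤ) : ZMod 5) = j by rw [h3]; ring] at this
        rw [e2]
        nlinarith
      · have e2 : 2 ≤ dist (cornerC (i + ((η : ℤ) : ZMod 5))) (cornerC j) ^ 2 := by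
          clear e1
          apply two_le_dist_sq <;> revert i j η <;> decide
        nlinarith
  nlinarith [dist_nonneg (x := edgePt i η s) (y := corner j)]

/-! ## Weights of the points of the pentagon -/

/-- The weight of the corner `i` in the fan with apex the centre of the pentagon. -/
def wt (i : ZMod 5) (z : ℂ) : ℝ := pentFan.coord i z

theorem continuous_wt (i : ZMod 5) : Continuous (wt i) := pentFan.cont i

theorem wt_cone {j : ZMod 5} {x y : ℝ} (hx : 0 ≤ x) (hy : 0 ≤ y) (k : ZMod 5) :
    wt k ((x : ℂ) * cornerC j + (y : ℂ) * cornerC (j + 1)) =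
      (if k = j then x else 0) + (if k = j + 1 then y else 0) :=
  pentFan.coord_cone j x y hx hy k

theorem exists_cone_cornerC (z : ℂ) : ∃ (j : ZMod 5) (x y : ℝ), 0 ≤ x ∧ 0 ≤ y ∧
    z = (x : ℂ) * cornerC j + (y : ℂ) * cornerC (j + 1) := pentFan.exists_cone z

theorem wt_nonneg (i : ZMod 5) (z : ℂ) : 0 ≤ wt i z := by
  obtain ⟨j, x, y, hx, hy, rfl⟩ := exists_cone_cornerC z
  rw [wt_cone hx hy]
  split_ifs <;> linarith

theorem sum_wt_cone {j : ZMod 5} {x y : ℝ} (hx : 0 ≤ x) (hy : 0 ≤ y) :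
    ∑ k, wt k ((x : ℂ) * cornerC j + (y : ℂ) * cornerC (j + 1)) = x + y := by
  simp [wt_cone hx hy, Finset.sum_add_distrib]

theorem sum_wt_mul (z : ℂ) : ∑ i, (wt i z : ℂ) * cornerC i = z := by
  obtain ⟨j, x, y, hx, hy, rfl⟩ := exists_cone_cornerC z
  simp only [wt_cone hx hy]
  push_cast
  simp [add_mul, Finset.sum_add_distrib, apply_ite (fun r : ℝ => (r : ℂ))]

theorem wt_smul (i : ZMod 5) {r : ℝ} (hr : 0 ≤ r) (z : ℂ) : wt i ((r : ℂ) * z) = r * wt i z := by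
  obtain ⟨j, x, y, hx, hy, rfl⟩ := exists_cone_cornerC z
  have : (r : ℂ) * ((x : ℂ) * cornerC j + (y : ℂ) * cornerC (j + 1)) =
    ((r * x : ℝ) : ℂ) * cornerC j + ((r * y : ℝ) : ℂ) * cornerC (j + 1) := by push_cast; ring
  rw [this, wt_cone (mul_nonneg hr hx) (mul_nonneg hr hy), wt_cone hx hy]
  split_ifs <;> ring

theorem sinTwo_le_sinOne : sinTwo ≤ sinOne := by
  have h : sinOne = 2 * sinTwo * Real.cos (Real.pi / 5) := by
    unfold sinOne sinTwo
    rw [← Real.sin_two_mul]; congr 1; ring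
  have h5 : 2 ≤ √5 := Real.le_sqrt_of_sq_le (by norm_num)
  rw [h, Real.cos_pi_div_five]
  nlinarith [sinTwo_pos]

/-- The linear functional that is one on an edge of the pentagon is at most one on the pentagon. -/
theorem cdet_add_cdet_le {z : ℂ} (hz : z ∈ pentagon) (j : ZMod 5) :
    cdet z (cornerC (j + 1)) + cdet (cornerC j) z ≤ pentR ^ 2 * sinOne := by
  have hp := pow_pos pentR_pos 2
  have hA := mul_pos hp sinOne_pos
  have hB := mul_pos hp sinTwo_pos
  have hAB := mul_le_mul_of_nonneg_left sinTwo_le_sinOne hp.le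
  have hlin : IsLinearMap ℝ fun z : ℂ => cdet z (cornerC (j + 1)) + cdet (cornerC j) z :=
    ⟨fun a b => by simp [cdet]; ring, fun a b => by simp [cdet]; ring⟩
  refine convexHull_min ?_ (convex_halfSpace_le hlin (pentR ^ 2 * sinOne)) hz
  rintro _ ⟨k, rfl⟩
  have e1 := cdet_corner_add j (k - j)
  have e2 := cdet_corner_add k (j + 1 - k)
  rw [add_sub_cancel] at e1 e2
  simp only [mem_ofPred_eq, e1, e2]
  have hk : (k - j = 0 ∧ j + 1 - k = 1) ∨ (k - j = 1 ∧ j + 1 - k = 0) ∨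
      (k - j = 2 ∧ j + 1 - k = 4) ∨ (k - j = 3 ∧ j + 1 - k = 3) ∨ (k - j = 4 ∧ j + 1 - k = 2) := by
    clear e1 e2 hlin
    revert j k; decide
  rcases hk with ⟨h1, h2⟩ | ⟨h1, h2⟩ | ⟨h1, h2⟩ | ⟨h1, h2⟩ | ⟨h1, h2⟩ <;> rw [h1, h2]
  · change pentR ^ 2 * sinOne + pentR ^ 2 * 0 ≤ _; linarith
  · change pentR ^ 2 * 0 + pentR ^ 2 * sinOne ≤ _; linarith
  · change pentR ^ 2 * -sinOne + pentR ^ 2 * sinTwo ≤ _; linarith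
  · change pentR ^ 2 * -sinTwo + pentR ^ 2 * -sinTwo ≤ _; linarith
  · change pentR ^ 2 * sinTwo + pentR ^ 2 * -sinOne ≤ _; linarith

theorem zero_mem_pentagon : (0 : ℂ) ∈ pentagon := by
  have h := (convex_convexHull ℝ (range cornerC)).sum_mem (t := Finset.univ)
    (w := fun _ : ZMod 5 => (1 / 5 : ℝ)) (z := cornerC) (fun _ _ => by norm_num) (by simp)
    (fun i _ => (corner i).2)
  rwa [← Finset.smul_sum, sum_cornerC, smul_zero] at h

theorem cone_mem_pentagon {i j : ZMod 5} {x y : ℝ} (hx : 0 ≤ x) (hy : 0 ≤ y) (hxy : x + y ≤ 1) :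
    (x : ℂ) * cornerC i + (y : ℂ) * cornerC j ∈ pentagon := by
  have h := (convex_convexHull ℝ (range cornerC)).sum_mem (t := Finset.univ)
    (w := (![x, y, 1 - x - y] : Fin 3 → ℝ)) (z := (![cornerC i, cornerC j, 0] : Fin 3 → ℂ))
    (by intro k _; fin_cases k <;> simp <;> linarith) (by simp [Fin.sum_univ_three])
    (by
      intro k _
      fin_cases k
      · exact (corner i).2
      · exact (corner j).2
      · exact zero_mem_pentagon)
  simpa [pentagon, Fin.sum_univ_three] using h

/-- The sum of the weights is the gauge of the pentagon: on the cone over an edge it is the linear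
functional that equals one on that edge. -/
theorem mem_pentagon_iff (z : ℂ) : z ∈ pentagon ↔ ∑ i, wt i z ≤ 1 := by
  constructor
  · intro h
    obtain ⟨j, x, y, hx, hy, rfl⟩ := exists_cone_cornerC z
    have := cdet_add_cdet_le h j
    rw [cdet_comb_left, cdet_comb_right, cdet_self, cdet_self, cdet_corner_one] at this
    rw [sum_wt_cone hx hy]
    have hA := mul_pos (pow_pos pentR_pos 2) sinOne_pos
    by_contra! h
    nlinarith
  · intro h
    obtain ⟨j, x, y, hx, hy, rfl⟩ := exists_cone_cornerC z
    rw [sum_wt_cone hx hy] at h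
    exact cone_mem_pentagon hx hy h

/-- The weight of the centre of the pentagon. -/
def ctr (z : ℂ) : ℝ := 1 - ∑ i, wt i z

theorem continuous_ctr : Continuous ctr := by
  unfold ctr
  exact continuous_const.sub (continuous_finsetSum _ fun i _ => continuous_wt i)

theorem ctr_nonneg (p : Pentagon) : 0 ≤ ctr p := sub_nonneg.2 ((mem_pentagon_iff _).1 p.2)

/-- The point with weights `x`, `y` at two corners. -/
def conePt (i j : ZMod 5) (x y : ℝ) (hx : 0 ≤ x) (hy : 0 ≤ y) (hxy : x + y ≤ 1) : Pentagon :=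
  ⟨(x : ℂ) * cornerC i + (y : ℂ) * cornerC j, cone_mem_pentagon hx hy hxy⟩

theorem exists_conePt (p : Pentagon) : ∃ (j : ZMod 5) (x y : ℝ) (hx : 0 ≤ x) (hy : 0 ≤ y)
    (hxy : x + y ≤ 1), p = conePt j (j + 1) x y hx hy hxy := by
  obtain ⟨j, x, y, hx, hy, h⟩ := exists_cone_cornerC p
  have := (mem_pentagon_iff _).1 p.2
  rw [h, sum_wt_cone hx hy] at this
  exact ⟨j, x, y, hx, hy, this, Subtype.ext h⟩

theorem wt_conePt {j : ZMod 5} {x y : ℝ} (hx : 0 ≤ x) (hy : 0 ≤ y) (hxy : x + y ≤ 1)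
    (k : ZMod 5) : wt k (conePt j (j + 1) x y hx hy hxy) =
      (if k = j then x else 0) + (if k = j + 1 then y else 0) := wt_cone hx hy k

theorem ctr_conePt {j : ZMod 5} {x y : ℝ} (hx : 0 ≤ x) (hy : 0 ≤ y) (hxy : x + y ≤ 1) :
    ctr (conePt j (j + 1) x y hx hy hxy) = 1 - x - y := by
  unfold ctr conePt
  rw [sum_wt_cone hx hy]; ring

theorem pentagon_ext {p q : Pentagon} (h : ∀ i, wt i p = wt i q) : p = q := by
  apply Subtype.ext
  rw [← sum_wt_mul p, ← sum_wt_mul q]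
  simp [h]

theorem edgePt_one_eq (i : ZMod 5) (s : unitInterval) :
    edgePt i 1 s = conePt i (i + 1) (1 - s) s (by linarith [s.2.2]) s.2.1 (by linarith) := by
  apply Subtype.ext
  simp only [edgePt, conePt, AffineMap.lineMap_apply, vsub_eq_sub, vadd_eq_add, Complex.real_smul]
  push_cast
  ring

theorem edgePt_neg (i : ZMod 5) (s : unitInterval) :
    edgePt i (-1) s = edgePt (i - 1) 1 (unitInterval.symm s) := by
  apply Subtype.ext
  simp only [edgePt, AffineMap.lineMap_apply, vsub_eq_sub, vadd_eq_add, Complex.real_smul]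
  simp [← sub_eq_add_neg]
  ring

theorem edgePt_add_one_neg (i : ZMod 5) (s : unitInterval) :
    edgePt (i + 1) (-1) s = edgePt i 1 (unitInterval.symm s) := by
  rw [edgePt_neg, add_sub_cancel_right]

theorem edgePt_zero (i : ZMod 5) (η : ℤˣ) : edgePt i η 0 = corner i := by
  apply Subtype.ext
  simp [edgePt, corner]

theorem edgePt_one (i : ZMod 5) (η : ℤˣ) :
    edgePt i η 1 = corner (i + ((η : ℤ) : ZMod 5)) := by
  apply Subtype.ext
  simp [edgePt, corner]

theorem wt_edgePt_one (i : ZMod 5) (s : unitInterval) (k : ZMod 5) : wt k (edgePt i 1 s) =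
    (if k = i then 1 - (s : ℝ) else 0) + (if k = i + 1 then (s : ℝ) else 0) := by
  rw [edgePt_one_eq, wt_conePt]

theorem wt_edgePt (i : ZMod 5) (η : ℤˣ) (s : unitInterval) (k : ZMod 5) : wt k (edgePt i η s) =
    (if k = i then 1 - (s : ℝ) else 0) + (if k = i + ((η : ℤ) : ZMod 5) then (s : ℝ) else 0) := by
  rcases Int.units_eq_one_or η with rfl | rfl
  · simpa using wt_edgePt_one i s k
  · rw [edgePt_neg, wt_edgePt_one, add_comm, sub_add_cancel]
    simp [sub_eq_add_neg]

theorem ctr_edgePt (i : ZMod 5) (η : ℤˣ) (s : unitInterval) : ctr (edgePt i η s) = 0 := by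
  unfold ctr
  simp [wt_edgePt, Finset.sum_add_distrib]

theorem exists_edgePt_of_ctr {p : Pentagon} (h : ctr p = 0) : ∃ i s, p = edgePt i 1 s := by
  obtain ⟨j, x, y, hx, hy, hxy, rfl⟩ := exists_conePt p
  rw [ctr_conePt] at h
  refine ⟨j, ⟨y, hy, by linarith⟩, ?_⟩
  rw [edgePt_one_eq]
  congr 1
  simp; linarith

/-- The centre of the pentagon. -/
def centre : Pentagon := ⟨0, zero_mem_pentagon⟩

theorem wt_centre (i : ZMod 5) : wt i centre = 0 := by
  have := wt_smul i le_rfl (0 : ℂ)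
  simpa [centre] using this

theorem ctr_centre : ctr centre = 1 := by simp [ctr, wt_centre]

theorem zero_mem_interior_pentagon : (0 : ℂ) ∈ interior pentagon := by
  rw [mem_interior]
  refine ⟨{z | 0 < ctr z}, fun z hz => (mem_pentagon_iff z).2 (by
    unfold ctr at hz; simp at hz; linarith), isOpen_lt continuous_const continuous_ctr, ?_⟩
  have := ctr_centre
  simp only [centre] at this
  simp [this]

theorem isCompact_pentagon : IsCompact pentagon := (finite_range cornerC).isCompact_convexHull ℝ

instance : CompactSpace Pentagon := isCompact_iff_compactSpace.1 isCompact_pentagon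

theorem pentR_le_one : pentR ≤ 1 := by
  have h := pentR_sq_mul
  have h5 : √5 ≤ 3 := Real.sqrt_le_iff.2 ⟨by norm_num, by norm_num⟩
  rw [sinTwo_sq] at h
  nlinarith [pentR_pos]

theorem dist_centre_corner_le (i : ZMod 5) : dist centre (corner i) ≤ 1 := by
  rw [Subtype.dist_eq, dist_comm, Complex.dist_eq]
  simp only [centre, corner, sub_zero]
  unfold cornerC
  rw [norm_mul, Complex.norm_exp_ofReal_mul_I, mul_one, Complex.norm_real,
    ← pentR.eq_1, Real.norm_of_nonneg pentR_pos.le]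
  exact pentR_le_one

end PentHull
namespace PentHull

/-! ## Symmetries of the pentagon -/

theorem wt_cone_unit {j : ZMod 5} {x y : ℝ} (hx : 0 ≤ x) (hy : 0 ≤ y) (η : ℤˣ) (k : ZMod 5) :
    wt k ((x : ℂ) * cornerC j + (y : ℂ) * cornerC (j + ((η : ℤ) : ZMod 5))) =
      (if k = j then x else 0) + (if k = j + ((η : ℤ) : ZMod 5) then y else 0) := by
  rcases Int.units_eq_one_or η with rfl | rfl
  · simpa using wt_cone hx hy k
  · have := wt_cone (j := j - 1) hy hx k
    rw [sub_add_cancel] at this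
    simp only [Units.val_neg, Units.val_one, Int.cast_neg, Int.cast_one, ← sub_eq_add_neg]
    rw [add_comm, this, add_comm]

namespace PentSym

theorem unit_mul_self (η : ℤˣ) : ((η : ℤ) : ZMod 5) * ((η : ℤ) : ZMod 5) = 1 := by
  rcases Int.units_eq_one_or η with rfl | rfl <;> simp

theorem act_injective (σ : PentSym) : Function.Injective σ.act := by
  intro i j h
  simp only [act, add_right_inj] at h
  have := congrArg (fun x => ((σ.sign : ℤ) : ZMod 5) * x) h
  simpa [← mul_assoc, unit_mul_self] using this

theorem act_add (σ : PentSym) (i : ZMod 5) (η : ℤˣ) : σ.act (i + ((η : ℤ) : ZMod 5)) =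
    σ.act i + (((σ.sign * η : ℤˣ) : ℤ) : ZMod 5) := by
  simp [act]; ring

theorem act_add_one (σ : PentSym) (i : ZMod 5) : σ.act (i + 1) =
    σ.act i + ((σ.sign : ℤ) : ZMod 5) := by
  simpa using σ.act_add i 1

/-- The inverse symmetry. -/
def inv (σ : PentSym) : PentSym := ⟨-(((σ.sign : ℤ) : ZMod 5) * σ.shift), σ.sign⟩

theorem inv_act (σ : PentSym) (i : ZMod 5) : σ.inv.act (σ.act i) = i := by
  simp only [act, inv]
  linear_combination i * unit_mul_self σ.sign

theorem act_inv (σ : PentSym) (i : ZMod 5) : σ.act (σ.inv.act i) = i := by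
  apply σ.inv.act_injective
  rw [inv_act]

/-- The action of a symmetry on the pentagon. -/
def pent (σ : PentSym) (p : Pentagon) : Pentagon :=
  ⟨∑ i, (wt i p : ℂ) * cornerC (σ.act i), by
    obtain ⟨j, x, y, hx, hy, hxy, rfl⟩ := exists_conePt p
    have := cone_mem_pentagon (i := σ.act j) (j := σ.act (j + 1)) hx hy hxy
    simpa [wt_conePt, add_mul, Finset.sum_add_distrib, apply_ite (fun r : ℝ => (r : ℂ))] using this⟩

theorem wt_pent_act (σ : PentSym) (p : Pentagon) (k : ZMod 5) :
    wt (σ.act k) (σ.pent p) = wt k p := by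
  obtain ⟨j, x, y, hx, hy, hxy, rfl⟩ := exists_conePt p
  have : ((σ.pent (conePt j (j + 1) x y hx hy hxy) : Pentagon) : ℂ) =
      (x : ℂ) * cornerC (σ.act j) + (y : ℂ) * cornerC (σ.act j + ((σ.sign : ℤ) : ZMod 5)) := by
    simp [pent, wt_conePt, add_mul, Finset.sum_add_distrib, apply_ite (fun r : ℝ => (r : ℂ)),
      act_add_one]
  rw [this, wt_cone_unit hx hy, wt_conePt, ← act_add_one]
  simp only [σ.act_injective.eq_iff]

theorem sum_act {M : Type*} [AddCommMonoid M] (σ : PentSym) (f : ZMod 5 → M) :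
    ∑ i, f (σ.act i) = ∑ i, f i :=
  Function.Bijective.sum_comp (Finite.injective_iff_bijective.1 σ.act_injective) f

theorem ctr_pent (σ : PentSym) (p : Pentagon) : ctr (σ.pent p) = ctr p := by
  unfold ctr
  rw [← σ.sum_act]
  simp [wt_pent_act]

theorem pent_inv (σ : PentSym) (p : Pentagon) : σ.pent (σ.inv.pent p) = p := by
  apply pentagon_ext
  intro i
  conv_lhs => rw [← σ.act_inv i]
  rw [wt_pent_act, wt_pent_act]

theorem continuous_pent (σ : PentSym) : Continuous σ.pent := by
  apply Continuous.subtype_mk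
  refine continuous_finsetSum _ fun i _ => ?_
  exact (Complex.continuous_ofReal.comp ((continuous_wt i).comp continuous_subtype_val)).mul
    continuous_const

theorem pent_edgePt (σ : PentSym) (i : ZMod 5) (η : ℤˣ) (s : unitInterval) :
    σ.pent (edgePt i η s) = edgePt (σ.act i) (σ.sign * η) s := by
  apply pentagon_ext
  intro k
  obtain ⟨k, rfl⟩ : ∃ l, k = σ.act l := ⟨_, (σ.act_inv k).symm⟩
  rw [wt_pent_act, wt_edgePt, wt_edgePt, ← act_add]
  simp only [σ.act_injective.eq_iff]

theorem pent_corner (σ : PentSym) (i : ZMod 5) : σ.pent (corner i) = corner (σ.act i) := by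
  rw [← edgePt_zero i 1, pent_edgePt, edgePt_zero]

end PentSym

/-! ## The space of a complex -/

namespace PentComplex

variable (L : PentComplex)

/-- The vertices of every tile are distinct. -/
def InjVert : Prop := ∀ t, Function.Injective (L.vert t)

/-- The piecewise linear function on a tile with given values at the vertices and the centre. -/
def evP (H : L.V ⊕ L.T → ℝ) (t : L.T) (p : Pentagon) : ℝ :=
  ∑ i, wt i p * H (Sum.inl (L.vert t i)) + ctr p * H (Sum.inr t)

theorem continuous_evP (H : L.V ⊕ L.T → ℝ) (t : L.T) : Continuous (L.evP H t) := by
  unfold evP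
  refine (continuous_finsetSum _ fun i _ => ?_).add ?_
  · exact ((continuous_wt i).comp continuous_subtype_val).mul continuous_const
  · exact (continuous_ctr.comp continuous_subtype_val).mul continuous_const

/-- The weight of the centre vanishes on an edge, so only the two end points matter. For this reason
the functions respect the gluing. -/
theorem evP_edgePt (H : L.V ⊕ L.T → ℝ) (t : L.T) (i : ZMod 5) (η : ℤˣ) (s : unitInterval) :
    L.evP H t (edgePt i η s) = (1 - s) * H (Sum.inl (L.vert t i)) +
      s * H (Sum.inl (L.vert t (i + ((η : ℤ) : ZMod 5)))) := by
  unfold evP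
  simp [wt_edgePt, ctr_edgePt, add_mul, Finset.sum_add_distrib]

theorem evP_corner (H : L.V ⊕ L.T → ℝ) (t : L.T) (i : ZMod 5) :
    L.evP H t (corner i) = H (Sum.inl (L.vert t i)) := by
  rw [← edgePt_zero i 1, evP_edgePt]; simp

theorem evP_conePt (H : L.V ⊕ L.T → ℝ) (t : L.T) (j : ZMod 5) {x y : ℝ} (hx : 0 ≤ x) (hy : 0 ≤ y)
    (hxy : x + y ≤ 1) : L.evP H t (conePt j (j + 1) x y hx hy hxy) =
      x * H (Sum.inl (L.vert t j)) + y * H (Sum.inl (L.vert t (j + 1))) +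
        (1 - x - y) * H (Sum.inr t) := by
  unfold evP
  rw [ctr_conePt]
  simp [wt_conePt, add_mul, Finset.sum_add_distrib]

theorem evP_eq_of_glue (H : L.V ⊕ L.T → ℝ) {a b : Σ _ : L.T, Pentagon} (h : L.Glue a b) :
    L.evP H a.1 a.2 = L.evP H b.1 b.2 := by
  cases h with
  | vertex h => simp only [evP_corner, h]
  | edge η h₀ h₁ s => simp only [evP_edgePt, h₀, h₁, Units.val_one, Int.cast_one]

/-- The piecewise linear function with given values at the vertices and the centres. -/
def ev (H : L.V ⊕ L.T → ℝ) : L.Space → ℝ :=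
  Quot.lift (fun a => L.evP H a.1 a.2) fun _ _ h => L.evP_eq_of_glue H h

theorem ev_pt (H : L.V ⊕ L.T → ℝ) (t : L.T) (p : Pentagon) : L.ev H (L.pt t p) = L.evP H t p := rfl

theorem exists_pt (x : L.Space) : ∃ t p, x = L.pt t p := by
  obtain ⟨⟨t, p⟩, rfl⟩ := Quot.exists_rep x
  exact ⟨t, p, rfl⟩

theorem continuous_pt (t : L.T) : Continuous (L.pt t) :=
  continuous_quot_mk.comp continuous_sigmaMk

theorem isOpen_space_iff {U : Set L.Space} : IsOpen U ↔ ∀ t, IsOpen {p | L.pt t p ∈ U} := by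
  refine (isQuotientMap_quot_mk (r := L.Glue)).isOpen_preimage.symm.trans ?_
  rw [isOpen_sigma_iff]
  rfl

theorem continuous_space_iff {X : Type*} [TopologicalSpace X] {f : L.Space → X} :
    Continuous f ↔ ∀ t, Continuous fun p => f (L.pt t p) := by
  refine (isQuotientMap_quot_mk (r := L.Glue)).continuous_iff.trans ?_
  rw [continuous_sigma_iff]
  rfl

theorem continuous_ev (H : L.V ⊕ L.T → ℝ) : Continuous (L.ev H) :=
  L.continuous_space_iff.2 fun t => L.continuous_evP H t

variable {L}

open scoped Classical in
theorem evP_single_inl (hL : L.InjVert) (t : L.T) (p : Pentagon) (i : ZMod 5) :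
    L.evP (Pi.single (Sum.inl (L.vert t i)) 1) t p = wt i p := by
  unfold evP
  simp only [Pi.single_apply, Sum.inl.injEq, (hL t).eq_iff]
  simp

open scoped Classical in
theorem evP_single_inl_of_notMem {t : L.T} {v : L.V} (h : ∀ i, L.vert t i ≠ v) (p : Pentagon) :
    L.evP (Pi.single (Sum.inl v) 1) t p = 0 := by
  unfold evP
  simp [h]

open scoped Classical in
theorem evP_single_inr (t t' : L.T) (p : Pentagon) :
    L.evP (Pi.single (Sum.inr t') 1) t p = if t = t' then ctr p else 0 := by
  unfold evP
  simp [Pi.single_apply]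

theorem add_one_ne_self (i : ZMod 5) : i + 1 ≠ i := by
  revert i; decide

/-- The functions that are one at a single vertex or centre are enough. The one of a centre
recognises a tile and its interior points; those at the ends of an edge recover the position on the
edge. The cases run through the possible coincidences of the end points. As a consequence `Glue`
needs no equivalence closure: two points of the disjoint union are identified only when they are
equal or directly glued. -/
theorem evP_separates (hL : L.InjVert) {t t' : L.T} {p p' : Pentagon}
    (h : ∀ H, L.evP H t p = L.evP H t' p') : (t = t' ∧ p = p') ∨ L.Glue ⟨t, p⟩ ⟨t', p'⟩ := by
  classical
  have same : t = t' → p = p' := by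
    rintro rfl
    apply pentagon_ext
    intro i
    have := h (Pi.single (Sum.inl (L.vert t i)) 1)
    rwa [evP_single_inl hL, evP_single_inl hL] at this
  by_cases hp : ctr p = 0
  swap
  · left
    have := h (Pi.single (Sum.inr t) 1)
    rw [evP_single_inr, evP_single_inr, if_pos rfl] at this
    by_cases ht : t' = t
    · exact ⟨ht.symm, same ht.symm⟩
    · rw [if_neg ht] at this; exact absurd this hp
  by_cases hp' : ctr p' = 0
  swap
  · left
    have := h (Pi.single (Sum.inr t') 1)
    rw [evP_single_inr, evP_single_inr, if_pos rfl] at this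
    by_cases ht : t = t'
    · exact ⟨ht, same ht⟩
    · rw [if_neg ht] at this; exact absurd this.symm hp'
  right
  obtain ⟨i, s, rfl⟩ := exists_edgePt_of_ctr hp
  obtain ⟨j, s', rfl⟩ := exists_edgePt_of_ctr hp'
  simp only [evP_edgePt, Units.val_one, Int.cast_one] at h
  have hab : L.vert t (i + 1) ≠ L.vert t i := fun e => add_one_ne_self i (hL t e)
  have hab' : L.vert t' (j + 1) ≠ L.vert t' j := fun e => add_one_ne_self j (hL t' e)
  have ha := h (Pi.single (Sum.inl (L.vert t i)) 1)
  have hb := h (Pi.single (Sum.inl (L.vert t (i + 1))) 1)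
  simp only [Pi.single_apply, Sum.inl.injEq, if_true, if_neg hab, if_neg hab.symm] at ha hb
  by_cases h1 : L.vert t' j = L.vert t i
  · have h2 : L.vert t' (j + 1) ≠ L.vert t i := fun e => hab' (e.trans h1.symm)
    rw [if_pos h1, if_neg h2] at ha
    have hs : s = s' := Subtype.ext (by linarith)
    subst hs
    rw [if_neg (fun e => hab (e.symm.trans h1))] at hb
    by_cases h3 : L.vert t' (j + 1) = L.vert t (i + 1)
    · have := Glue.edge (L := L) 1 h1.symm (by simpa using h3.symm) s
      simpa using this
    · rw [if_neg h3] at hb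
      have hs : s = 0 := Subtype.ext (show (s : ℝ) = 0 by linarith)
      subst hs
      rw [edgePt_zero, edgePt_zero]
      exact Glue.vertex h1.symm
  rw [if_neg h1] at ha
  by_cases h2 : L.vert t' (j + 1) = L.vert t i
  · rw [if_pos h2] at ha
    rw [if_neg (fun e : L.vert t' (j + 1) = L.vert t (i + 1) => hab (e.symm.trans h2))] at hb
    have hs : s' = unitInterval.symm s := Subtype.ext (show (s' : ℝ) = 1 - s by linarith)
    subst hs
    by_cases h3 : L.vert t' j = L.vert t (i + 1)
    · have := Glue.edge (L := L) (t := t) (t' := t') (i := i) (j := j + 1) (-1) h2.symm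
        (by simpa using h3.symm) s
      rwa [edgePt_add_one_neg] at this
    · rw [if_neg h3] at hb
      have hs : s = 0 := Subtype.ext (show (s : ℝ) = 0 by linarith)
      subst hs
      rw [edgePt_zero, unitInterval.symm_zero, edgePt_one]
      exact Glue.vertex (by simpa using h2.symm)
  rw [if_neg h2] at ha
  have hs : s = 1 := Subtype.ext (show (s : ℝ) = 1 by linarith)
  subst hs
  by_cases h3 : L.vert t' j = L.vert t (i + 1)
  · rw [if_pos h3, if_neg (fun e => hab' (e.trans h3.symm))] at hb
    have hs : s' = 0 := Subtype.ext (show (s' : ℝ) = 0 by simp at hb; linarith)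
    subst hs
    rw [edgePt_zero, edgePt_one]
    exact Glue.vertex (by simpa using h3.symm)
  · rw [if_neg h3] at hb
    by_cases h4 : L.vert t' (j + 1) = L.vert t (i + 1)
    · rw [if_pos h4] at hb
      have hs : s' = 1 := Subtype.ext (show (s' : ℝ) = 1 by simp at hb; linarith)
      subst hs
      rw [edgePt_one, edgePt_one]
      exact Glue.vertex (by simpa using h4.symm)
    · rw [if_neg h4] at hb
      simp at hb

theorem pt_eq_iff (hL : L.InjVert) {t t' : L.T} {p p' : Pentagon} :
    L.pt t p = L.pt t' p' ↔ (t = t' ∧ p = p') ∨ L.Glue ⟨t, p⟩ ⟨t', p'⟩ := by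
  constructor
  · intro h
    exact evP_separates hL fun H => by rw [← ev_pt, h, ev_pt]
  · rintro (⟨rfl, rfl⟩ | h)
    · rfl
    · exact Quot.sound h

theorem eq_of_ev (hL : L.InjVert) {x y : L.Space} (h : ∀ H, L.ev H x = L.ev H y) : x = y := by
  obtain ⟨t, p, rfl⟩ := L.exists_pt x
  obtain ⟨t', p', rfl⟩ := L.exists_pt y
  exact (pt_eq_iff hL).2 (evP_separates hL h)

theorem pt_injective (hL : L.InjVert) (t : L.T) : Function.Injective (L.pt t) := by
  intro p q h
  apply pentagon_ext
  classical
  intro i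
  rw [← evP_single_inl hL t, ← evP_single_inl hL t, ← ev_pt, h, ev_pt]

theorem vert_eq_of_pt_corner_eq {t t' : L.T} {i j : ZMod 5}
    (h : L.pt t (corner i) = L.pt t' (corner j)) : L.vert t i = L.vert t' j := by
  classical
  have := congrArg (L.ev (Pi.single (Sum.inl (L.vert t i)) 1)) h
  simp only [ev_pt, evP_corner, Pi.single_apply, Sum.inl.injEq, if_true] at this
  by_contra hne
  simp [Ne.symm hne] at this

/-- Two tiles are adjacent when they have a common vertex. -/
def Adj (L : PentComplex) (t t' : L.T) : Prop := ∃ i j, L.vert t i = L.vert t' j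

theorem Adj.refl (t : L.T) : L.Adj t t := ⟨0, 0, rfl⟩

theorem Adj.symm {t t' : L.T} (h : L.Adj t t') : L.Adj t' t := by
  obtain ⟨i, j, h⟩ := h
  exact ⟨j, i, h.symm⟩

theorem adj_of_pt_eq (hL : L.InjVert) {t t' : L.T} {p p' : Pentagon}
    (h : L.pt t p = L.pt t' p') : L.Adj t t' := by
  rcases (pt_eq_iff hL).1 h with ⟨rfl, -⟩ | hg
  · exact Adj.refl t
  · cases hg with
    | vertex h₀ => exact ⟨_, _, h₀⟩
    | edge η h₀ h₁ s => exact ⟨_, _, h₀⟩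

/-- The tiles that a chain of `n` adjacencies joins to `t₀`. -/
inductive InBall (L : PentComplex) (t₀ : L.T) : ℕ → L.T → Prop
  | base : InBall L t₀ 0 t₀
  | step {n : ℕ} {t t' : L.T} (h : InBall L t₀ n t) (h' : L.Adj t t') : InBall L t₀ (n + 1) t'

theorem InBall.mono {t₀ t : L.T} {n m : ℕ} (h : L.InBall t₀ n t) (hm : n ≤ m) :
    L.InBall t₀ m t := by
  induction m, hm using Nat.le_induction with
  | base => exact h
  | succ m _ ih => exact ih.step (Adj.refl t)

theorem InBall.trans {t₀ t t' : L.T} {n m : ℕ} (h : L.InBall t₀ n t) (h' : L.InBall t m t') :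
    L.InBall t₀ (n + m) t' := by
  induction h' with
  | base => exact h
  | step _ h2 ih => exact ih.step h2

/-! ## Maps of complexes that may turn and reflect the tiles -/

/-- A map of complexes that may turn and reflect the tiles. -/
structure TMap (A L : PentComplex) where
  onV : A.V → L.V
  onT : A.T → L.T
  rot : A.T → PentSym
  compat : ∀ t i, onV (A.vert t i) = L.vert (onT t) ((rot t).act i)

/-- A map of complexes that preserves the indices, as a map that may turn the tiles. -/
def Hom.toTMap {A L : PentComplex} (f : A.Hom L) : TMap A L where
  onV := f.onV
  onT := f.onT
  rot := fun _ => ⟨0, 1⟩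
  compat := by simp [PentSym.act, f.compat]

namespace TMap

variable {A : PentComplex} (f : TMap A L)

theorem glue {a b : Σ _ : A.T, Pentagon} (h : A.Glue a b) :
    L.pt (f.onT a.1) ((f.rot a.1).pent a.2) = L.pt (f.onT b.1) ((f.rot b.1).pent b.2) := by
  cases h with
  | vertex h =>
    simp only [PentSym.pent_corner]
    exact Quot.sound (Glue.vertex (by rw [← f.compat, ← f.compat, h]))
  | @edge t t' i j η h₀ h₁ s =>
    simp only [PentSym.pent_edgePt, mul_one]
    have e0 : L.vert (f.onT t) ((f.rot t).act i) = L.vert (f.onT t') ((f.rot t').act j) := by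
      rw [← f.compat, ← f.compat, h₀]
    have e1 : L.vert (f.onT t) ((f.rot t).act i + (((f.rot t).sign : ℤ) : ZMod 5)) =
        L.vert (f.onT t') ((f.rot t').act j + ((((f.rot t').sign * η : ℤˣ) : ℤ) : ZMod 5)) := by
      rw [← PentSym.act_add, ← PentSym.act_add_one, ← f.compat, ← f.compat, h₁]
    rcases Int.units_eq_one_or (f.rot t).sign with hs | hs
    · rw [hs] at e1 ⊢
      exact Quot.sound (Glue.edge _ e0 (by simpa using e1) s)
    · rw [hs] at e1 ⊢
      rw [edgePt_neg]
      set k := (f.rot t).act i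
      set l := (f.rot t').act j
      set ζ := (f.rot t').sign * η
      -- `Glue.edge` wants the positive direction in its first tile, so an edge that the symmetry
      -- reverses is traversed from its other end.
      have e2 : edgePt l ζ s = edgePt (l + ((ζ : ℤ) : ZMod 5)) (-ζ) (unitInterval.symm s) := by
        rcases Int.units_eq_one_or ζ with h | h
        · rw [h]; simp [edgePt_add_one_neg]
        · rw [h, edgePt_neg]; simp [sub_eq_add_neg]
      rw [e2]
      refine Quot.sound (Glue.edge (-ζ) ?_ ?_ _)
      · simpa [sub_eq_add_neg] using e1
      · simpa using e0

/-- The map of the spaces. -/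
def map : A.Space → L.Space :=
  Quot.lift (fun a => L.pt (f.onT a.1) ((f.rot a.1).pent a.2)) fun _ _ h => f.glue h

theorem map_pt (t : A.T) (p : Pentagon) :
    f.map (A.pt t p) = L.pt (f.onT t) ((f.rot t).pent p) := rfl

theorem continuous_map : Continuous f.map :=
  A.continuous_space_iff.2 fun t => (L.continuous_pt (f.onT t)).comp (f.rot t).continuous_pent

theorem ev_map (H : L.V ⊕ L.T → ℝ) (x : A.Space) :
    L.ev H (f.map x) = A.ev (H ∘ Sum.map f.onV f.onT) x := by
  obtain ⟨t, p, rfl⟩ := A.exists_pt x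
  rw [map_pt, ev_pt, ev_pt]
  unfold evP
  rw [PentSym.ctr_pent, ← (f.rot t).sum_act]
  simp [PentSym.wt_pent_act, f.compat]

/-- The map is injective on the tiles and on the vertices of the tiles. -/
def Inj : Prop := Function.Injective f.onT ∧
  ∀ t i t' j, f.onV (A.vert t i) = f.onV (A.vert t' j) → A.vert t i = A.vert t' j

variable {f}

theorem injVert (f : TMap A L) (hL : L.InjVert) : A.InjVert := by
  intro t i j h
  have := congrArg f.onV h
  rw [f.compat, f.compat] at this
  exact (f.rot t).act_injective (hL _ this)

/-- Values on `A` are extended to values `H'` on `L`, by zero off the image. Every piecewise linear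
function of `A` thus factors through `f.map`, and these functions separate points. -/
theorem Inj.map_injective (hf : f.Inj) (hL : L.InjVert) : Function.Injective f.map := by
  classical
  intro x y h
  refine eq_of_ev (f.injVert hL) fun H => ?_
  let H' : L.V ⊕ L.T → ℝ := Sum.elim
    (fun w => if h : ∃ t i, f.onV (A.vert t i) = w then H (Sum.inl (A.vert h.choose h.choose_spec.choose))
      else 0) (fun u => if h : ∃ t, f.onT t = u then H (Sum.inr h.choose) else 0)
  have key : ∀ z, L.ev H' (f.map z) = A.ev H z := by
    intro z
    obtain ⟨t, p, rfl⟩ := A.exists_pt z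
    rw [ev_map, ev_pt, ev_pt]
    unfold evP
    have e1 : ∀ i, (H' ∘ Sum.map f.onV f.onT) (Sum.inl (A.vert t i)) = H (Sum.inl (A.vert t i)) := by
      intro i
      have hex : ∃ t' j, f.onV (A.vert t' j) = f.onV (A.vert t i) := ⟨t, i, rfl⟩
      simp only [H', Function.comp, Sum.map_inl, Sum.elim_inl, dif_pos hex]
      rw [hf.2 _ _ _ _ hex.choose_spec.choose_spec]
    have e2 : (H' ∘ Sum.map f.onV f.onT) (Sum.inr t) = H (Sum.inr t) := by
      have hex : ∃ t', f.onT t' = f.onT t := ⟨t, rfl⟩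
      simp only [H', Function.comp, Sum.map_inr, Sum.elim_inr, dif_pos hex]
      rw [hf.1 hex.choose_spec]
    simp only [e1, e2]
  rw [← key, ← key, h]

/-- Openness is tested tile by tile, and on the tiles in the image `f` is a symmetry of the
pentagon. The hypothesis `h` excludes the failure at the boundary, where a tile outside the image
touches the image of `O`. -/
theorem Inj.isOpen_image (hf : f.Inj) (hL : L.InjVert) {O : Set A.Space} (hO : IsOpen O)
    (h : ∀ t' p', L.pt t' p' ∈ f.map '' O → t' ∈ range f.onT) : IsOpen (f.map '' O) := by
  rw [isOpen_space_iff]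
  intro t'
  by_cases ht : t' ∈ range f.onT
  · obtain ⟨t, rfl⟩ := ht
    have : {p | L.pt (f.onT t) p ∈ f.map '' O} = (f.rot t).inv.pent ⁻¹' {p | A.pt t p ∈ O} := by
      ext p
      have e : f.map (A.pt t ((f.rot t).inv.pent p)) = L.pt (f.onT t) p := by
        rw [map_pt, PentSym.pent_inv]
      simp only [mem_ofPred_eq, mem_preimage]
      rw [← e, (hf.map_injective hL).mem_set_image]
    rw [this]
    exact (A.isOpen_space_iff.1 hO t).preimage (PentSym.continuous_pent _)
  · convert isOpen_empty
    ext p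
    simp only [mem_ofPred_eq, mem_empty_iff_false, iff_false]
    exact fun hp => ht (h t' p hp)

end TMap

end PentComplex

end PentHull
namespace PentHull

/-! ## A monotone union of open discs is homeomorphic to the plane -/

/-- The map adds `c - b` times a tent function with support in `[a, d]` and peak one at `b`. The
tent descends with slope `1 / (d - b)` and `c - b < d - b`, so the sum stays strictly increasing. -/
theorem exists_stretch {a b c d : ℝ} (hab : a < b) (hbc : b ≤ c) (hcd : c < d) :
    ∃ l : ℝ ≃o ℝ, (∀ x ≤ a, l x = x) ∧ l b = c ∧ ∀ x, d ≤ x → l x = x := by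
  have hbd : b < d := hbc.trans_lt hcd
  have h1 : 0 < b - a := sub_pos.2 hab
  have h2 : 0 < d - b := sub_pos.2 hbd
  set hat : ℝ → ℝ := fun x => max 0 (min ((x - a) / (b - a)) ((d - x) / (d - b))) with hhat
  set f : ℝ → ℝ := fun x => x + (c - b) * hat x with hf
  have hcont : Continuous f := by simp only [hf, hhat]; fun_prop
  have hlo : ∀ x ≤ a, hat x = 0 := fun x hx =>
    max_eq_left (min_le_of_left_le (div_nonpos_of_nonpos_of_nonneg (by linarith) h1.le))
  have hhi : ∀ x, d ≤ x → hat x = 0 := fun x hx =>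
    max_eq_left (min_le_of_right_le (div_nonpos_of_nonpos_of_nonneg (by linarith) h2.le))
  have hb : hat b = 1 := by
    simp only [hhat]
    rw [div_self h1.ne', div_self h2.ne']; simp
  have hstep : ∀ x y, x < y → hat x ≤ hat y + (y - x) / (d - b) := by
    intro x y hxy
    have hpos : 0 ≤ (y - x) / (d - b) := div_nonneg (by linarith) h2.le
    refine max_le (add_nonneg (le_max_left _ _) hpos) ?_
    rcases min_cases ((y - a) / (b - a)) ((d - y) / (d - b)) with ⟨h, -⟩ | ⟨h, -⟩
    · have e : (x - a) / (b - a) ≤ (y - a) / (b - a) := by gcongr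
      calc min ((x - a) / (b - a)) ((d - x) / (d - b)) ≤ (x - a) / (b - a) := min_le_left _ _
        _ ≤ hat y := by simp only [hhat]; rw [h]; exact e.trans (le_max_right _ _)
        _ ≤ _ := by linarith
    · calc min ((x - a) / (b - a)) ((d - x) / (d - b)) ≤ (d - x) / (d - b) := min_le_right _ _
        _ = (d - y) / (d - b) + (y - x) / (d - b) := by rw [← add_div]; congr 1; ring
        _ ≤ _ := by simp only [hhat]; rw [h]; gcongr; exact le_max_right _ _
  have hmono : StrictMono f := by
    intro x y hxy
    simp only [hf]
    have h3 := hstep x y hxy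
    have h4 : (c - b) * ((y - x) / (d - b)) < y - x := by
      rw [mul_div_assoc', div_lt_iff₀ h2, mul_comm]
      exact mul_lt_mul_of_pos_left (by linarith) (by linarith)
    nlinarith [mul_le_mul_of_nonneg_left h3 (sub_nonneg.2 hbc)]
  have hsurj : Function.Surjective f := by
    refine hcont.surjective ?_ ?_
    · refine Filter.tendsto_id.congr' ?_
      filter_upwards [Filter.eventually_ge_atTop d] with x hx
      simp [hf, hhi x hx]
    · refine Filter.tendsto_id.congr' ?_
      filter_upwards [Filter.eventually_le_atBot a] with x hx
      simp [hf, hlo x hx]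
  refine ⟨StrictMono.orderIsoOfSurjective f hmono hsurj, fun x hx => ?_, ?_, fun x hx => ?_⟩
  · simp [hf, hlo x hx]
  · simp [hf, hb]
  · simp [hf, hhi x hx]

/-- The radial map of the plane with a given change of the radius. -/
def radialMap (l : ℝ ≃o ℝ) (z : ℂ) : ℂ := ((l ‖z‖ / ‖z‖ : ℝ) : ℂ) * z

theorem norm_radialMap {l : ℝ ≃o ℝ} (h0 : l 0 = 0) (z : ℂ) : ‖radialMap l z‖ = l ‖z‖ := by
  have hn : 0 ≤ l ‖z‖ := by rw [← h0]; exact l.monotone (norm_nonneg z)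
  by_cases hz : z = 0
  · simp [radialMap, hz, h0]
  · have := norm_pos_iff.2 hz
    unfold radialMap
    rw [norm_mul, Complex.norm_real, Real.norm_of_nonneg (by positivity)]
    field_simp

theorem radialMap_eq_self {l : ℝ ≃o ℝ} {z : ℂ} (h : l ‖z‖ = ‖z‖) : radialMap l z = z := by
  by_cases hz : z = 0
  · simp [radialMap, hz]
  · unfold radialMap
    rw [h, div_self (norm_ne_zero_iff.2 hz)]; simp

/-- The quotient of the radii is problematic only at the origin, and near it the map is the
identity. -/
theorem continuous_radialMap {l : ℝ ≃o ℝ} {a : ℝ} (ha : 0 < a) (h : ∀ x ≤ a, l x = x) :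
    Continuous (radialMap l) := by
  rw [continuous_iff_continuousAt]
  intro z
  by_cases hz : z = 0
  · subst hz
    refine continuousAt_id.congr ?_
    filter_upwards [Metric.closedBall_mem_nhds (0 : ℂ) ha] with z hz
    exact (radialMap_eq_self (h _ (by simpa using hz))).symm
  · refine ContinuousAt.mul ?_ continuousAt_id
    refine Complex.continuous_ofReal.continuousAt.comp ?_
    exact (l.continuous.continuousAt.comp continuous_norm.continuousAt).div
      continuous_norm.continuousAt (norm_ne_zero_iff.2 hz)

theorem radialMap_symm_apply {l : ℝ ≃o ℝ} (h0 : l 0 = 0) (z : ℂ) :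
    radialMap l.symm (radialMap l z) = z := by
  by_cases hz : z = 0
  · simp [radialMap, hz]
  · have hpos := norm_pos_iff.2 hz
    have hn : 0 < l ‖z‖ := by rw [← h0]; exact l.strictMono hpos
    have e := norm_radialMap h0 z
    rw [radialMap, e]
    unfold radialMap
    rw [← mul_assoc, ← Complex.ofReal_mul, OrderIso.symm_apply_apply]
    rw [show ‖z‖ / l ‖z‖ * (l ‖z‖ / ‖z‖) = 1 by field_simp]
    simp

theorem exists_radial {a b c d : ℝ} (ha : 0 < a) (hab : a < b) (hbc : b ≤ c) (hcd : c < d) :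
    ∃ e : ℂ ≃ₜ ℂ, (∀ z, ‖z‖ ≤ a → e z = z) ∧ (∀ z, d ≤ ‖z‖ → e z = z) ∧
      ∀ z, ‖e z‖ ≤ c ↔ ‖z‖ ≤ b := by
  obtain ⟨l, h1, h2, h3⟩ := exists_stretch hab hbc hcd
  have h0 : l 0 = 0 := h1 0 ha.le
  have h1' : ∀ x ≤ a, l.symm x = x := fun x hx => by
    rw [OrderIso.symm_apply_eq, h1 x hx]
  refine ⟨⟨⟨radialMap l, radialMap l.symm, radialMap_symm_apply h0, fun z => ?_⟩,
    continuous_radialMap ha h1, continuous_radialMap ha h1'⟩, fun z hz => radialMap_eq_self (h1 _ hz),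
    fun z hz => radialMap_eq_self (h3 _ hz), fun z => ?_⟩
  · have := radialMap_symm_apply (l := l.symm) (h1' 0 ha.le) z
    rwa [OrderIso.symm_symm] at this
  · change ‖radialMap l z‖ ≤ c ↔ _
    rw [norm_radialMap h0, ← h2, l.le_iff_le]

section Brown

variable {X : Type*} [TopologicalSpace X]

open Topology

/-- A homeomorphism of a disc with compact support extends to the whole space. -/
theorem exists_extension [T2Space X] {ψ : ℂ → X} (hψ : IsOpenEmbedding ψ) (e : ℂ ≃ₜ ℂ) {d : ℝ}
    (he : ∀ z, d ≤ ‖z‖ → e z = z) :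
    ∃ h : X ≃ₜ X, (∀ z, h (ψ z) = ψ (e z)) ∧ ∀ x, x ∉ ψ '' Metric.ball 0 d → h x = x := by
  have aux : ∀ e : ℂ ≃ₜ ℂ, (∀ z, d ≤ ‖z‖ → e z = z) → ∃ f : X → X, Continuous f ∧
      (∀ z, f (ψ z) = ψ (e z)) ∧ ∀ x, x ∉ range ψ → f x = x := by
    classical
    intro e he
    let f : X → X := fun x => if h : x ∈ range ψ then ψ (e h.choose) else x
    have h1 : ∀ z, f (ψ z) = ψ (e z) := by
      intro z
      have hz : ψ z ∈ range ψ := mem_range_self z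
      simp only [f, dif_pos hz]
      rw [hψ.injective hz.choose_spec]
    have h2 : ∀ x, x ∉ range ψ → f x = x := fun x hx => dif_neg hx
    refine ⟨f, ?_, h1, h2⟩
    rw [continuous_iff_continuousAt]
    intro x
    by_cases hx : x ∈ range ψ
    · obtain ⟨z, rfl⟩ := hx
      rw [← hψ.continuousAt_iff]
      have : f ∘ ψ = ψ ∘ e := funext h1
      rw [this]
      exact (hψ.continuous.comp e.continuous).continuousAt
    -- The Hausdorff property enters here: the image of the closed disc is closed, so around a point
    -- outside the chart the map is the identity.
    · have hK : IsCompact (ψ '' Metric.closedBall 0 d) :=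
        (isCompact_closedBall (0 : ℂ) d).image hψ.continuous
      refine continuousAt_id.congr ?_
      have hmem : (ψ '' Metric.closedBall 0 d)ᶜ ∈ 𝓝 x :=
        hK.isClosed.isOpen_compl.mem_nhds fun ⟨z, _, hz⟩ => hx ⟨z, hz⟩
      filter_upwards [hmem] with y hy
      by_cases hy' : y ∈ range ψ
      · obtain ⟨z, rfl⟩ := hy'
        have hz : d ≤ ‖z‖ := by
          by_contra! hlt
          exact hy ⟨z, by simpa using hlt.le, rfl⟩
        rw [h1, he z hz]; rfl
      · rw [h2 y hy']; rfl
  have he' : ∀ z, d ≤ ‖z‖ → e.symm z = z := fun z hz => by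
    rw [Homeomorph.symm_apply_eq, he z hz]
  obtain ⟨f, hf, f1, f2⟩ := aux e he
  obtain ⟨g, hg, g1, g2⟩ := aux e.symm he'
  refine ⟨⟨⟨f, g, fun x => ?_, fun x => ?_⟩, hf, hg⟩, f1, fun x hx => ?_⟩
  · by_cases hx : x ∈ range ψ
    · obtain ⟨z, rfl⟩ := hx
      rw [f1, g1, e.symm_apply_apply]
    · rw [f2 x hx, g2 x hx]
  · by_cases hx : x ∈ range ψ
    · obtain ⟨z, rfl⟩ := hx
      rw [g1, f1, e.apply_symm_apply]
    · rw [g2 x hx, f2 x hx]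
  · change f x = x
    by_cases hx' : x ∈ range ψ
    · obtain ⟨z, rfl⟩ := hx'
      rw [f1, he z (by by_contra! hlt; exact hx ⟨z, by simpa using hlt, rfl⟩)]
    · exact f2 x hx'

/-- An embedded disc can be changed outside a smaller disc so that it covers a compact set. -/
theorem exists_engulfing [T2Space X] {f ψ : ℂ → X} (hf : IsOpenEmbedding f)
    (hψ : IsOpenEmbedding ψ) {R : ℝ} (hR : 0 < R)
    (hfψ : f '' Metric.closedBall 0 (R + 1) ⊆ range ψ) {C : Set X} (hC : IsCompact C)
    (hCψ : C ⊆ range ψ) :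
    ∃ f' : ℂ → X, IsOpenEmbedding f' ∧ (∀ z, ‖z‖ ≤ R → f' z = f z) ∧
      C ⊆ f' '' Metric.ball 0 (R + 1) := by
  obtain ⟨z₀, hz₀⟩ : f 0 ∈ range ψ := hfψ ⟨0, by simp; linarith, rfl⟩
  -- A translation of the chart `ψ` gives both discs the same centre.
  wlog h0 : z₀ = 0 generalizing ψ z₀
  · have hψ' : IsOpenEmbedding (ψ ∘ Homeomorph.addRight z₀) :=
      hψ.comp (Homeomorph.addRight z₀).isOpenEmbedding
    have hr : range (ψ ∘ Homeomorph.addRight z₀) = range ψ :=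
      (Homeomorph.addRight z₀).surjective.range_comp ψ
    exact this hψ' (by rwa [hr]) (by rwa [hr]) 0 (by simp [hz₀]) rfl
  subst h0
  obtain ⟨δ, hδ, hδf⟩ : ∃ δ > 0, ψ '' Metric.closedBall 0 δ ⊆ f '' Metric.ball 0 (R + 1) := by
    have : ψ ⁻¹' (f '' Metric.ball 0 (R + 1)) ∈ 𝓝 0 :=
      ((hf.isOpenMap _ Metric.isOpen_ball).preimage hψ.continuous).mem_nhds
        ⟨0, by simp; linarith, hz₀.symm⟩
    obtain ⟨δ, hδ, h⟩ := Metric.nhds_basis_closedBall.mem_iff.1 this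
    exact ⟨δ, hδ, image_subset_iff.2 h⟩
  obtain ⟨ε, hε, hεψ⟩ : ∃ ε > 0, f '' Metric.closedBall 0 ε ⊆ ψ '' Metric.closedBall 0 (δ / 2) := by
    have : f ⁻¹' (ψ '' Metric.ball 0 (δ / 2)) ∈ 𝓝 0 :=
      ((hψ.isOpenMap _ Metric.isOpen_ball).preimage hf.continuous).mem_nhds
        ⟨0, by simp; linarith, hz₀⟩
    obtain ⟨ε, hε, h⟩ := Metric.nhds_basis_closedBall.mem_iff.1 this
    exact ⟨ε, hε, (image_subset_iff.2 h).trans (image_mono Metric.ball_subset_closedBall)⟩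
  -- `g` shrinks `f '' closedBall 0 R` into `f '' closedBall 0 ε`
  obtain ⟨eg, eg1, eg2, eg3⟩ := exists_radial (a := min ε R / 2) (b := min ε R) (c := R)
    (d := R + 1) (by positivity) (by linarith [lt_min hε hR]) (min_le_right _ _) (by linarith)
  obtain ⟨G, G1, G2⟩ := exists_extension hf eg eg2
  have hgC : G.symm '' C ⊆ range ψ := by
    rintro _ ⟨x, hx, rfl⟩
    by_cases hxf : G.symm x ∈ f '' Metric.ball 0 (R + 1)
    · exact hfψ (image_mono Metric.ball_subset_closedBall hxf)
    · have := G2 _ hxf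
      rw [G.apply_symm_apply] at this
      rw [← this]; exact hCψ hx
  obtain ⟨M, hM, hCM⟩ : ∃ M, δ ≤ M ∧ G.symm '' C ⊆ ψ '' Metric.closedBall 0 M := by
    have hcomp : IsCompact (ψ ⁻¹' (G.symm '' C)) :=
      hψ.isInducing.isCompact_preimage' (hC.image G.symm.continuous) hgC
    obtain ⟨M, hM⟩ := hcomp.isBounded.subset_closedBall 0
    refine ⟨max δ M, le_max_left _ _, ?_⟩
    rw [← image_preimage_eq_of_subset hgC]
    exact image_mono (hM.trans (Metric.closedBall_subset_closedBall (le_max_right _ _)))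
  obtain ⟨eh, eh1, eh2, eh3⟩ := exists_radial (a := δ / 2) (b := δ) (c := M) (d := M + 1)
    (by positivity) (by linarith) hM (by linarith)
  obtain ⟨H, H1, -⟩ := exists_extension hψ eh eh2
  -- `G.symm` shrinks the part of `f` that has to be kept into the zone fixed by `H`. Then `H`
  -- expands a small disc of `ψ`, contained in `f '' ball 0 (R + 1)`, until it covers `G.symm '' C`.
  -- Finally `G` undoes the shrinking.
  refine ⟨G ∘ H ∘ G.symm ∘ f, G.isOpenEmbedding.comp (H.isOpenEmbedding.comp
    (G.symm.isOpenEmbedding.comp hf)), fun z hz => ?_, ?_⟩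
  · have hGz : G.symm (f z) = f (eg.symm z) := by
      rw [Homeomorph.symm_apply_eq, G1, eg.apply_symm_apply]
    have hn : ‖eg.symm z‖ ≤ ε := by
      have := (eg3 (eg.symm z)).1 (by rwa [eg.apply_symm_apply])
      exact this.trans (min_le_left _ _)
    obtain ⟨w, hw, hwz⟩ := hεψ ⟨eg.symm z, by simpa using hn, rfl⟩
    have hH : H (f (eg.symm z)) = f (eg.symm z) := by
      rw [← hwz, H1, eh1 w (by simpa using hw)]
    simp only [Function.comp]
    rw [hGz, hH, ← hGz, G.apply_symm_apply]
  · intro x hx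
    obtain ⟨w, hw, hwx⟩ := hCM ⟨x, hx, rfl⟩
    have hw' : ‖eh.symm w‖ ≤ δ := (eh3 _).1 (by rw [eh.apply_symm_apply]; simpa using hw)
    obtain ⟨z, hz, hzw⟩ := hδf ⟨eh.symm w, by simpa using hw', rfl⟩
    have hz' : eg z ∈ Metric.ball (0 : ℂ) (R + 1) := by
      by_contra hcon
      have h1 : R + 1 ≤ ‖eg z‖ := by simpa using hcon
      have h2 := eg2 _ h1
      have : eg z = z := eg.injective h2
      rw [this] at hcon
      exact hcon hz
    refine ⟨eg z, hz', ?_⟩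
    simp only [Function.comp]
    have : G.symm (f (eg z)) = f z := by rw [← G1, G.symm_apply_apply]
    rw [this, hzw, H1, eh.apply_symm_apply, hwx, G.apply_symm_apply]

/-- A monotone union of open discs is homeomorphic to the plane. -/
theorem nonempty_homeomorph_of_monotone_discs (ψ : ℕ → ℂ → X) (hψ : ∀ n, IsOpenEmbedding (ψ n))
    (hmono : Monotone fun n => range (ψ n)) (hU : ⋃ n, range (ψ n) = univ) :
    Nonempty (X ≃ₜ ℂ) := by
  have hcov : ∀ x, ∃ n, x ∈ range (ψ n) := fun x => mem_iUnion.1 (hU ▸ mem_univ x)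
  have : T2Space X := by
    refine ⟨fun x y hxy => ?_⟩
    obtain ⟨n, hn⟩ := hcov x
    obtain ⟨m, hm⟩ := hcov y
    obtain ⟨z, rfl⟩ := hmono (le_max_left n m) hn
    obtain ⟨w, rfl⟩ := hmono (le_max_right n m) hm
    obtain ⟨u, v, hu, hv, hz, hw, huv⟩ := t2_separation (fun h : z = w => hxy (by rw [h]))
    exact ⟨_, _, (hψ _).isOpenMap u hu, (hψ _).isOpenMap v hv, ⟨z, hz, rfl⟩, ⟨w, hw, rfl⟩,
      (disjoint_image_iff (hψ _).injective).2 huv⟩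
  have hcompact : ∀ C : Set X, IsCompact C → ∃ n, C ⊆ range (ψ n) := fun C hC =>
    hC.elim_directed_cover _ (fun n => (hψ n).isOpen_range) (by rw [hU]; exact subset_univ C)
      hmono.directed_le
  -- The compact sets `C k` exhaust the space, and the embedding number `k + 1` is made to cover `C
  -- k`.
  let C : ℕ → Set X := fun k => ⋃ m ∈ Finset.range (k + 1), ψ m '' Metric.closedBall 0 k
  have hC : ∀ k, IsCompact (C k) := fun k => Finset.isCompact_biUnion _ fun m _ =>
    (isCompact_closedBall (0 : ℂ) k).image (hψ m).continuous
  have step : ∀ (k : ℕ) (f : {f : ℂ → X // IsOpenEmbedding f}),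
      ∃ f' : {f : ℂ → X // IsOpenEmbedding f}, (∀ z, ‖z‖ ≤ (k : ℝ) + 1 → f'.1 z = f.1 z) ∧
        C k ⊆ f'.1 '' Metric.ball 0 ((k : ℝ) + 1 + 1) := by
    rintro k ⟨f, hf⟩
    obtain ⟨n, hn⟩ := hcompact (f '' Metric.closedBall 0 ((k : ℝ) + 1 + 1) ∪ C k)
      (((isCompact_closedBall _ _).image hf.continuous).union (hC k))
    obtain ⟨f', h1, h2, h3⟩ := exists_engulfing hf (hψ n) (R := (k : ℝ) + 1) (by positivity)
      (subset_union_left.trans hn) (hC k) (subset_union_right.trans hn)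
    exact ⟨⟨f', h1⟩, h2, h3⟩
  choose next hnext1 hnext2 using step
  let F : ℕ → {f : ℂ → X // IsOpenEmbedding f} := fun k => Nat.rec ⟨ψ 0, hψ 0⟩ next k
  have hF : ∀ k, F (k + 1) = next k (F k) := fun k => rfl
  have hstab : ∀ k m : ℕ, k ≤ m → ∀ z, ‖z‖ ≤ (k : ℝ) + 1 → (F m).1 z = (F k).1 z := by
    intro k m hkm
    induction m, hkm using Nat.le_induction with
    | base => exact fun _ _ => rfl
    | succ m hm ih =>
      intro z hz
      have hmk : (k : ℝ) ≤ m := by exact_mod_cast hm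
      rw [hF, hnext1 m (F m) z (by linarith), ih z hz]
  -- The embeddings are eventually constant on every disc around the origin, so their limit is
  -- locally one of them: it is continuous, injective and open. It is onto because every `C k` is
  -- covered inside a radius that later steps leave unchanged.
  let g : ℂ → X := fun z => (F ⌈‖z‖⌉₊).1 z
  have hg : ∀ (k : ℕ) (z : ℂ), ‖z‖ ≤ (k : ℝ) + 1 → g z = (F k).1 z := by
    intro k z hz
    have h1 : ‖z‖ ≤ ((⌈‖z‖⌉₊ : ℕ) : ℝ) + 1 := by linarith [Nat.le_ceil ‖z‖]
    rcases le_total k ⌈‖z‖⌉₊ with h | h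
    · exact hstab _ _ h z hz
    · exact (hstab _ _ h z h1).symm
  have hball : ∀ z : ℂ, ∃ k : ℕ, ‖z‖ < (k : ℝ) + 1 := fun z => by
    obtain ⟨k, hk⟩ := exists_nat_ge ‖z‖
    exact ⟨k, by linarith⟩
  have hcont : Continuous g := by
    rw [continuous_iff_continuousAt]
    intro z
    obtain ⟨k, hk⟩ := hball z
    refine ((F k).2.continuous.continuousAt).congr ?_
    filter_upwards [Metric.isOpen_ball.mem_nhds (show z ∈ Metric.ball (0 : ℂ) ((k : ℝ) + 1) by simpa)]
      with w hw
    exact (hg k w (by simpa using (Metric.mem_ball.1 hw).le)).symm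
  have hinj : Function.Injective g := by
    intro z w h
    obtain ⟨k, hk⟩ := hball z
    obtain ⟨l, hl⟩ := hball w
    have hk' : (k : ℝ) ≤ (max k l : ℕ) := by exact_mod_cast le_max_left k l
    have hl' : (l : ℝ) ≤ (max k l : ℕ) := by exact_mod_cast le_max_right k l
    rw [hg (max k l) z (by linarith), hg (max k l) w (by linarith)] at h
    exact (F _).2.injective h
  have hopen : IsOpenMap g := by
    rw [isOpenMap_iff_nhds_le]
    intro z
    obtain ⟨k, hk⟩ := hball z
    have hev : g =ᶠ[𝓝 z] (F k).1 := by
      filter_upwards [Metric.isOpen_ball.mem_nhds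
        (show z ∈ Metric.ball (0 : ℂ) ((k : ℝ) + 1) by simpa)] with w hw
      exact hg k w (by simpa using (Metric.mem_ball.1 hw).le)
    rw [Filter.map_congr hev, hev.eq_of_nhds, (F k).2.map_nhds_eq]
  have hsurj : Function.Surjective g := by
    intro x
    obtain ⟨n, z, hz⟩ := hcov x
    obtain ⟨k, hk⟩ := exists_nat_ge ‖z‖
    set m := max n k
    have hx : x ∈ C m := by
      simp only [C, mem_iUnion, Finset.mem_range]
      refine ⟨n, by omega, z, ?_, hz⟩
      have : (k : ℝ) ≤ m := by exact_mod_cast le_max_right n k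
      simp; linarith
    obtain ⟨w, hw, hwx⟩ := hnext2 m (F m) hx
    refine ⟨w, ?_⟩
    rw [hg (m + 1) w, hF, hwx]
    push_cast
    simpa using (Metric.mem_ball.1 hw).le
  exact ⟨(Equiv.toHomeomorphOfContinuousOpen (Equiv.ofBijective g ⟨hinj, hsurj⟩) hcont hopen).symm⟩

end Brown

end PentHull
namespace PentHull

/-! ## The subdivided pentagon -/

/-- The coefficients of the corners `i`, `i + 1` and `i - 1` in the point of the pentagon that
corresponds to the point `p` of the subdivided tile at the corner `i`. -/
def subA (p : Pentagon) : ℝ :=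
  wt 0 p + wt 1 p / 2 + wt 2 p / 2 + wt 4 p / 2 + 3 / 4 * ctr p
-- In the small tile at the corner `i`, the vertices 0 to 4 lie at that corner, at the midpoint of
-- the edge to `i + 1`, halfway from the corner `i` to the centre, halfway from the corner `i - 1`
-- to the centre, and at the midpoint of the edge to `i - 1`. Its centre is put at 3/4 of the corner
-- `i` and 1/4 of the large centre. The coefficients follow by linearity.
def subB (p : Pentagon) : ℝ := wt 1 p / 2
def subC (p : Pentagon) : ℝ := (wt 3 p + wt 4 p) / 2

theorem zmod5_cases (k : ZMod 5) : k = 0 ∨ k = 1 ∨ k = 2 ∨ k = 3 ∨ k = 4 := by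
  revert k; decide

theorem sum_wt_five (p : Pentagon) :
    ctr p = 1 - (wt 0 p + wt 1 p + wt 2 p + wt 3 p + wt 4 p) := by
  unfold ctr
  congr 1
  exact Fin.sum_univ_five (fun i : Fin 5 => wt i (p : ℂ))

theorem sub_nonneg' (p : Pentagon) : 0 ≤ subA p ∧ 0 ≤ subB p ∧ 0 ≤ subC p := by
  have h := fun i => wt_nonneg i (p : ℂ)
  have h' := ctr_nonneg p
  unfold subA subB subC
  exact ⟨by linarith [h 0, h 1, h 2, h 4], by linarith [h 1], by linarith [h 3, h 4]⟩

theorem one_sub_subA (p : Pentagon) :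
    1 - subA p - subB p - subC p = wt 2 p / 2 + wt 3 p / 2 + ctr p / 4 := by
  have := sum_wt_five p
  unfold subA subB subC
  linarith

theorem sub_sum_le (p : Pentagon) : subA p + subB p + subC p ≤ 1 := by
  have := one_sub_subA p
  have h := fun i => wt_nonneg i (p : ℂ)
  linarith [h 2, h 3, ctr_nonneg p]

theorem wt_conePt' {j j' : ZMod 5} {x y : ℝ} (hx : 0 ≤ x) (hy : 0 ≤ y) (hxy : x + y ≤ 1)
    (k : ZMod 5) (h : j' = j + 1) : wt k (conePt j j' x y hx hy hxy) =
      (if k = j then x else 0) + (if k = j' then y else 0) := by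
  subst h; exact wt_conePt hx hy hxy k

theorem ctr_conePt' {j j' : ZMod 5} {x y : ℝ} (hx : 0 ≤ x) (hy : 0 ≤ y) (hxy : x + y ≤ 1)
    (h : j' = j + 1) : ctr (conePt j j' x y hx hy hxy) = 1 - x - y := by
  subst h; exact ctr_conePt hx hy hxy

/-- The possible weights of a point of the pentagon. -/
theorem weights_cases (p : Pentagon) : ∃ x y : ℝ, 0 ≤ x ∧ 0 ≤ y ∧ x + y ≤ 1 ∧
    ctr p = 1 - x - y ∧
    ((wt 0 p = x ∧ wt 1 p = y ∧ wt 2 p = 0 ∧ wt 3 p = 0 ∧ wt 4 p = 0) ∨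
      (wt 0 p = 0 ∧ wt 1 p = x ∧ wt 2 p = y ∧ wt 3 p = 0 ∧ wt 4 p = 0) ∨
      (wt 0 p = 0 ∧ wt 1 p = 0 ∧ wt 2 p = x ∧ wt 3 p = y ∧ wt 4 p = 0) ∨
      (wt 0 p = 0 ∧ wt 1 p = 0 ∧ wt 2 p = 0 ∧ wt 3 p = x ∧ wt 4 p = y) ∨
      (wt 0 p = y ∧ wt 1 p = 0 ∧ wt 2 p = 0 ∧ wt 3 p = 0 ∧ wt 4 p = x)) := by
  obtain ⟨k, x, y, hx, hy, hxy, rfl⟩ := exists_conePt p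
  refine ⟨x, y, hx, hy, hxy, ctr_conePt _ _ _, ?_⟩
  rcases zmod5_cases k with rfl | rfl | rfl | rfl | rfl
  · left; simp (decide := true) [wt_conePt']
  · right; left; simp (decide := true) [wt_conePt']
  · right; right; left; simp (decide := true) [wt_conePt']
  · right; right; right; left; simp (decide := true) [wt_conePt']
  · right; right; right; right; simp (decide := true) [wt_conePt']

theorem wt_one_eq_zero_or (p : Pentagon) : wt 1 p = 0 ∨ (wt 3 p = 0 ∧ wt 4 p = 0) := by
  obtain ⟨x, y, hx, hy, hxy, hc, h | h | h | h | h⟩ := weights_cases p <;> simp [h]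

/-- Corner 1 is adjacent neither to 3 nor to 4, so the weights on the two sides are never both
positive. Hence the image lies in a single cone of the large pentagon. -/
theorem subB_or_subC (p : Pentagon) : subB p = 0 ∨ subC p = 0 := by
  rcases wt_one_eq_zero_or p with h | ⟨h, h'⟩
  · left; simp [subB, h]
  · right; simp [subC, h, h']

/-- The position in the pentagon of the point `p` of a tile of the subdivision. -/
def subPt : Option (ZMod 5) → Pentagon → Pentagon
  | none, p => ⟨((1 / 2 : ℝ) : ℂ) * p, by
      rw [mem_pentagon_iff]
      have := ctr_nonneg p
      simp only [wt_smul _ (show (0 : ℝ) ≤ 1 / 2 by norm_num), ← Finset.mul_sum]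
      unfold ctr at this
      linarith⟩
  | some i, p => ⟨(subA p : ℂ) * cornerC i + ((subB p : ℂ) * cornerC (i + 1) +
      (subC p : ℂ) * cornerC (i - 1)), by
      obtain ⟨hA, hB, hC⟩ := sub_nonneg' p
      have := sub_sum_le p
      rcases subB_or_subC p with h | h
      · rw [h, Complex.ofReal_zero, zero_mul, zero_add]
        exact cone_mem_pentagon hA hC (by linarith)
      · rw [h, Complex.ofReal_zero, zero_mul, add_zero]
        exact cone_mem_pentagon hA hB (by linarith)⟩

theorem wt_subPt_none (p : Pentagon) (l : ZMod 5) : wt l (subPt none p) = wt l p / 2 := by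
  change wt l (((1 / 2 : ℝ) : ℂ) * p) = _
  rw [wt_smul _ (by norm_num)]; ring

theorem ctr_subPt_none (p : Pentagon) : ctr (subPt none p) = (1 + ctr p) / 2 := by
  unfold ctr
  simp only [wt_subPt_none, ← Finset.sum_div]; ring

theorem wt_subPt_some (i : ZMod 5) (p : Pentagon) (l : ZMod 5) : wt l (subPt (some i) p) =
    (if l = i then subA p else 0) + (if l = i + 1 then subB p else 0) +
      (if l = i - 1 then subC p else 0) := by
  obtain ⟨hA, hB, hC⟩ := sub_nonneg' p
  change wt l ((subA p : ℂ) * cornerC i + ((subB p : ℂ) * cornerC (i + 1) +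
      (subC p : ℂ) * cornerC (i - 1))) = _
  rcases subB_or_subC p with h | h
  · have := wt_cone_unit hA hC (j := i) (-1) l
    simp only [Units.val_neg, Units.val_one, Int.cast_neg, Int.cast_one, ← sub_eq_add_neg] at this
    rw [h, Complex.ofReal_zero, zero_mul, zero_add, this]
    simp
  · have := wt_cone hA hB (j := i) l
    rw [h, Complex.ofReal_zero, zero_mul, add_zero, this]
    simp

theorem ctr_subPt_some (i : ZMod 5) (p : Pentagon) :
    ctr (subPt (some i) p) = 1 - subA p - subB p - subC p := by
  unfold ctr
  simp only [wt_subPt_some, Finset.sum_add_distrib]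
  simp; ring

theorem continuous_subPt (j : Option (ZMod 5)) : Continuous (subPt j) := by
  have hw : ∀ i, Continuous fun p : Pentagon => wt i p := fun i =>
    (continuous_wt i).comp continuous_subtype_val
  have hc : Continuous fun p : Pentagon => ctr p := continuous_ctr.comp continuous_subtype_val
  cases j with
  | none => exact Continuous.subtype_mk (continuous_const.mul continuous_subtype_val) _
  | some i =>
    refine Continuous.subtype_mk ?_ _
    have h0 := hw 0
    have h1 := hw 1
    have h2 := hw 2
    have h3 := hw 3
    have h4 := hw 4
    refine ((Complex.continuous_ofReal.comp ?_).mul continuous_const).add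
      (((Complex.continuous_ofReal.comp ?_).mul continuous_const).add
        ((Complex.continuous_ofReal.comp ?_).mul continuous_const))
    · unfold subA; fun_prop
    · unfold subB; fun_prop
    · unfold subC; fun_prop

/-- The tiles of the subdivision cover the pentagon. -/
theorem exists_subPt (q : Pentagon) : ∃ j p, subPt j p = q := by
  obtain ⟨j, x, y, hx, hy, hxy, rfl⟩ := exists_conePt q
  have key : ∀ (k : ZMod 5) (a b : ℝ) (ha : 0 ≤ a) (hb : 0 ≤ b) (hab : a + b ≤ 1) (i : ZMod 5),
      (i = j ∧ subC (conePt k (k + 1) a b ha hb hab) = 0 ∧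
        subA (conePt k (k + 1) a b ha hb hab) = x ∧ subB (conePt k (k + 1) a b ha hb hab) = y) ∨
      (i = j + 1 ∧ subB (conePt k (k + 1) a b ha hb hab) = 0 ∧
        subA (conePt k (k + 1) a b ha hb hab) = y ∧ subC (conePt k (k + 1) a b ha hb hab) = x) →
      ∃ j' p, subPt j' p = conePt j (j + 1) x y hx hy hxy := by
    intro k a b ha hb hab i h
    refine ⟨some i, conePt k (k + 1) a b ha hb hab, pentagon_ext fun l => ?_⟩
    rw [wt_subPt_some, wt_conePt]
    rcases h with ⟨rfl, h1, h2, h3⟩ | ⟨rfl, h1, h2, h3⟩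
    · rw [h1, h2, h3]; simp
    · rw [h1, h2, h3]; simp [add_comm]
  -- In the triangle of the centre and the corners `j`, `j + 1`, the line `x + y = 1 / 2` cuts off
  -- the central tile and the segment `x = 1 / 2` separates the tiles at the two corners. The
  -- remaining lines divide these into their own triangles, two for the tile at `j` and three for
  -- the one at `j + 1`; the witnesses are the weights in these triangles.
  rcases le_total (x + y) (1 / 2) with h | h
  · refine ⟨none, conePt j (j + 1) (2 * x) (2 * y) (by linarith) (by linarith) (by linarith),
      pentagon_ext fun l => ?_⟩
    rw [wt_subPt_none, wt_conePt, wt_conePt]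
    split_ifs <;> ring
  rcases le_total (1 / 2) x with h' | h'
  · rcases le_total 3 (4 * x + 2 * y) with h3 | h3
    · refine key 0 (1 - 2 * y - 4 * (1 - x - y)) (2 * y) (by linarith) (by linarith) (by linarith) j
        (Or.inl ⟨rfl, ?_, ?_, ?_⟩) <;>
        (simp (decide := true) [subA, subB, subC, wt_conePt', ctr_conePt']; try ring)
    · refine key 1 (2 * y) (3 - 2 * y - 4 * x) (by linarith) (by linarith) (by linarith) j
        (Or.inl ⟨rfl, ?_, ?_, ?_⟩) <;>
        (simp (decide := true) [subA, subB, subC, wt_conePt', ctr_conePt']; try ring)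
  · rcases le_total 3 (2 * x + 4 * y) with h3 | h3
    · refine key 4 (2 * x) (2 * x + 4 * y - 3) (by linarith) (by linarith) (by linarith) (j + 1)
        (Or.inr ⟨rfl, ?_, ?_, ?_⟩) <;>
        (simp (decide := true) [subA, subB, subC, wt_conePt', ctr_conePt']; try ring)
    rcases le_total 3 (6 * x + 4 * y) with h4 | h4
    · refine key 3 (3 / 2 - x - 2 * y) (3 * x + 2 * y - 3 / 2) (by linarith) (by linarith)
        (by linarith) (j + 1) (Or.inr ⟨rfl, ?_, ?_, ?_⟩) <;>
        (simp (decide := true) [subA, subB, subC, wt_conePt', ctr_conePt']; try ring)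
    · refine key 2 (3 - 6 * x - 4 * y) (2 * x) (by linarith) (by linarith)
        (by linarith) (j + 1) (Or.inr ⟨rfl, ?_, ?_, ?_⟩) <;>
        (simp (decide := true) [subA, subB, subC, wt_conePt', ctr_conePt']; try ring)

/-! ### Recovering the weights in the subdivision -/

/-- The weights in the subdivision of a point with weights `v` and weight `z` of the centre. -/
def rOld (v : ZMod 5 → ℝ) (z : ℝ) (l : ZMod 5) : ℝ := max 0 (2 * v l - 1 - 2 * z)
-- These formulas are the weight functions of the small vertices and centres, expressed by the large
-- weights as positive parts of minima of affine functions. For `rNew` the relation that writes the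
-- large weight of the corner `l` through the small weights is solved for the new vertex. They serve
-- to show that `subMap` is injective.
def rMid (v : ZMod 5 → ℝ) (l : ZMod 5) : ℝ :=
  max 0 (min (min (2 * v l) (2 * v (l + 1))) (2 * v (l + 1) + 3 * v l - 3 / 2))
def rCor (v : ZMod 5 → ℝ) (z : ℝ) (l : ZMod 5) : ℝ :=
  max 0 (min (min (4 * z) (4 * (v l + v (l - 1)) - 2)) (1 - 2 * v (l - 1)))
def rNone (z : ℝ) : ℝ := max 0 (2 * z - 1)
def rNew (v : ZMod 5 → ℝ) (z : ℝ) (l : ZMod 5) : ℝ :=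
  2 * (v l - rOld v z l - rMid v l / 2 - rMid v (l - 1) / 2 - 3 / 4 * rCor v z l)

theorem wt_shift_subPt_some (i : ZMod 5) (p : Pentagon) :
    wt (i + 0) (subPt (some i) p) = subA p ∧ wt (i + 1) (subPt (some i) p) = subB p ∧
    wt (i + 2) (subPt (some i) p) = 0 ∧ wt (i + 3) (subPt (some i) p) = 0 ∧
    wt (i + 4) (subPt (some i) p) = subC p := by
  simp only [wt_subPt_some, add_eq_left, add_right_inj, sub_eq_add_neg]
  simp (decide := true)

theorem rOld_subPt_some (i m : ZMod 5) (p : Pentagon) :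
    rOld (fun l => wt l (subPt (some i) p)) (ctr (subPt (some i) p)) (i + m) =
      if m = 0 then wt 0 p else 0 := by
  obtain ⟨h0, h1, h2, h3, h4⟩ := wt_shift_subPt_some i p
  rw [ctr_subPt_some]
  simp only [rOld]
  obtain ⟨x, y, hx, hy, hxy, hc, h | h | h | h | h⟩ := weights_cases p <;>
  obtain ⟨w0, w1, w2, w3, w4⟩ := h <;>
  rcases zmod5_cases m with rfl | rfl | rfl | rfl | rfl <;>
  simp only [h0, h1, h2, h3, h4, subA, subB, subC, w0, w1, w2, w3, w4, hc] <;>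
  simp (decide := true) only [if_true, if_false] <;>
  first
  | exact max_eq_left (by linarith)
  | (rw [max_eq_right (by linarith)]; linarith)

theorem rMid_values {v : ZMod 5 → ℝ} {i : ZMod 5} {a b c : ℝ} (h0 : v (i + 0) = a)
    (h1 : v (i + 1) = b) (h2 : v (i + 2) = 0) (h3 : v (i + 3) = 0) (h4 : v (i + 4) = c) :
    rMid v (i + 0) = max 0 (min (min (2 * a) (2 * b)) (2 * b + 3 * a - 3 / 2)) ∧
    rMid v (i + 1) = 0 ∧ rMid v (i + 2) = 0 ∧ rMid v (i + 3) = 0 ∧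
    rMid v (i + 4) = max 0 (min (min (2 * c) (2 * a)) (2 * a + 3 * c - 3 / 2)) := by
  have e0 : i + 0 + 1 = i + 1 := by ring
  have e1 : i + 1 + 1 = i + 2 := by ring
  have e2 : i + 2 + 1 = i + 3 := by ring
  have e3 : i + 3 + 1 = i + 4 := by ring
  have e4 : i + 4 + 1 = i + 0 := by rw [add_assoc]; rfl
  simp only [rMid, e0, e1, e2, e3, e4, h0, h1, h2, h3, h4]
  refine ⟨trivial, ?_, ?_, ?_, trivial⟩
  · exact max_eq_left ((min_le_left _ _).trans ((min_le_right _ _).trans (by simp)))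
  · exact max_eq_left ((min_le_left _ _).trans ((min_le_right _ _).trans (by simp)))
  · exact max_eq_left ((min_le_left _ _).trans ((min_le_left _ _).trans (by simp)))

theorem max_min_eq {a b c w : ℝ} (hw : 0 ≤ w) (h : w = 0 ∨ (w ≤ a ∧ w ≤ b ∧ w ≤ c))
    (h' : a ≤ w ∨ b ≤ w ∨ c ≤ w) : max 0 (min (min a b) c) = w := by
  apply le_antisymm
  · refine max_le hw ?_
    rcases h' with h' | h' | h'
    · exact (min_le_left _ _).trans ((min_le_left _ _).trans h')
    · exact (min_le_left _ _).trans ((min_le_right _ _).trans h')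
    · exact (min_le_right _ _).trans h'
  · rcases h with h | ⟨h1, h2, h3⟩
    · rw [h]; exact le_max_left _ _
    · exact le_max_of_le_right (le_min (le_min h1 h2) h3)

theorem rMid_subPt_some (i m : ZMod 5) (p : Pentagon) :
    rMid (fun l => wt l (subPt (some i) p)) (i + m) =
      (if m = 0 then wt 1 p else 0) + (if m = 4 then wt 4 p else 0) := by
  obtain ⟨h0, h1, h2, h3, h4⟩ := wt_shift_subPt_some i p
  obtain ⟨g0, g1, g2, g3, g4⟩ := rMid_values (v := fun l => wt l (subPt (some i) p)) h0 h1 h2 h3 h4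
  rcases zmod5_cases m with rfl | rfl | rfl | rfl | rfl
  · rw [g0]
    simp (decide := true) only [if_true, if_false, add_zero]
    obtain ⟨x, y, hx, hy, hxy, hc, h | h | h | h | h⟩ := weights_cases p <;>
    obtain ⟨w0, w1, w2, w3, w4⟩ := h <;>
    simp only [subA, subB, w0, w1, w2, w4, hc] <;>
    (refine max_min_eq (by linarith) ?_ ?_
     · first
       | exact Or.inl rfl
       | exact Or.inr ⟨by linarith, by linarith, by linarith⟩
     · first
       | exact Or.inl (by linarith)
       | exact Or.inr (Or.inl (by linarith)))
  · rw [g1]; simp (decide := true)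
  · rw [g2]; simp (decide := true)
  · rw [g3]; simp (decide := true)
  · rw [g4]
    simp (decide := true) only [if_true, if_false, zero_add]
    obtain ⟨x, y, hx, hy, hxy, hc, h | h | h | h | h⟩ := weights_cases p <;>
    obtain ⟨w0, w1, w2, w3, w4⟩ := h <;>
    simp only [subA, subC, w0, w1, w2, w3, w4, hc] <;>
    (refine max_min_eq (by linarith) ?_ ?_
     · first
       | exact Or.inl rfl
       | exact Or.inr ⟨by linarith, by linarith, by linarith⟩
     · first
       | exact Or.inl (by linarith)
       | exact Or.inr (Or.inl (by linarith))
       | exact Or.inr (Or.inr (by linarith)))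

theorem rCor_values {v : ZMod 5 → ℝ} {i : ZMod 5} {a b c z : ℝ} (h0 : v (i + 0) = a)
    (h1 : v (i + 1) = b) (h2 : v (i + 2) = 0) (h3 : v (i + 3) = 0) (h4 : v (i + 4) = c) :
    rCor v z (i + 0) = max 0 (min (min (4 * z) (4 * (a + c) - 2)) (1 - 2 * c)) ∧
    rCor v z (i + 1) = max 0 (min (min (4 * z) (4 * (b + a) - 2)) (1 - 2 * a)) ∧
    rCor v z (i + 2) = max 0 (min (min (4 * z) (4 * b - 2)) (1 - 2 * b)) ∧ rCor v z (i + 3) = 0 ∧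
    rCor v z (i + 4) = max 0 (min (min (4 * z) (4 * c - 2)) 1) := by
  have e0 : i + 0 - 1 = i + 4 := by rw [add_sub_assoc]; rfl
  have e1 : i + 1 - 1 = i + 0 := by ring
  have e2 : i + 2 - 1 = i + 1 := by ring
  have e3 : i + 3 - 1 = i + 2 := by ring
  have e4 : i + 4 - 1 = i + 3 := by ring
  simp only [rCor, e0, e1, e2, e3, e4, h0, h1, h2, h3, h4]
  refine ⟨trivial, trivial, by simp, ?_, by simp⟩
  exact max_eq_left ((min_le_left _ _).trans ((min_le_right _ _).trans (by norm_num)))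

theorem rCor_subPt_some (i m : ZMod 5) (p : Pentagon) :
    rCor (fun l => wt l (subPt (some i) p)) (ctr (subPt (some i) p)) (i + m) =
      if m = 0 then ctr p else 0 := by
  obtain ⟨h0, h1, h2, h3, h4⟩ := wt_shift_subPt_some i p
  obtain ⟨g0, g1, g2, g3, g4⟩ := rCor_values (v := fun l => wt l (subPt (some i) p))
    (z := ctr (subPt (some i) p)) h0 h1 h2 h3 h4
  rcases zmod5_cases m with rfl | rfl | rfl | rfl | rfl
  · rw [g0, ctr_subPt_some, if_pos rfl]
    obtain ⟨x, y, hx, hy, hxy, hc, h | h | h | h | h⟩ := weights_cases p <;>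
    obtain ⟨w0, w1, w2, w3, w4⟩ := h <;>
    simp only [subA, subB, subC, w0, w1, w2, w3, w4, hc] <;>
    (refine max_min_eq (by linarith) ?_ ?_
     · first
       | exact Or.inl rfl
       | exact Or.inr ⟨by linarith, by linarith, by linarith⟩
     · first
       | exact Or.inl (by linarith)
       | exact Or.inr (Or.inl (by linarith))
       | exact Or.inr (Or.inr (by linarith)))
  · rw [g1, if_neg (by decide)]
    refine max_min_eq le_rfl (Or.inl rfl) ?_
    obtain ⟨x, y, hx, hy, hxy, hc, h | h | h | h | h⟩ := weights_cases p <;>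
    obtain ⟨w0, w1, w2, w3, w4⟩ := h <;>
    simp only [subA, subB, w0, w1, w2, w4, hc]
    · exact Or.inr (Or.inr (by linarith))
    · exact Or.inr (Or.inr (by linarith))
    all_goals
      by_contra! hcon
      linarith
  · rw [g2, if_neg (by decide)]
    refine max_min_eq le_rfl (Or.inl rfl) ?_
    by_contra! hcon
    linarith
  · rw [g3]; simp (decide := true)
  · rw [g4]
    simp (decide := true) only [if_false]
    obtain ⟨x, y, hx, hy, hxy, hc, h | h | h | h | h⟩ := weights_cases p <;>
    obtain ⟨w0, w1, w2, w3, w4⟩ := h <;>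
    simp only [subC, w3, w4] <;>
    (refine max_min_eq (by linarith) (Or.inl rfl) ?_
     first
     | exact Or.inl (by linarith)
     | exact Or.inr (Or.inl (by linarith)))

theorem rNone_subPt_some (i : ZMod 5) (p : Pentagon) : rNone (ctr (subPt (some i) p)) = 0 := by
  rw [ctr_subPt_some, one_sub_subA]
  refine max_eq_left ?_
  have h := fun i => wt_nonneg i (p : ℂ)
  have := sum_wt_five p
  linarith [h 0, h 1, h 4, ctr_nonneg p]

theorem rNew_subPt_some (i m : ZMod 5) (p : Pentagon) :
    rNew (fun l => wt l (subPt (some i) p)) (ctr (subPt (some i) p)) (i + m) =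
      (if m = 0 then wt 2 p else 0) + (if m = 4 then wt 3 p else 0) := by
  obtain ⟨h0, h1, h2, h3, h4⟩ := wt_shift_subPt_some i p
  unfold rNew
  rw [add_sub_assoc, rOld_subPt_some, rMid_subPt_some, rMid_subPt_some, rCor_subPt_some]
  rcases zmod5_cases m with rfl | rfl | rfl | rfl | rfl <;>
  simp (decide := true) only [h0, h1, h2, h3, h4, if_true, if_false, subA, subB, subC] <;> ring

theorem sub_subPt_none (p : Pentagon) (l : ZMod 5) :
    rOld (fun l => wt l (subPt none p)) (ctr (subPt none p)) l = 0 ∧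
    rMid (fun l => wt l (subPt none p)) l = 0 ∧
    rCor (fun l => wt l (subPt none p)) (ctr (subPt none p)) l = 0 := by
  have hle : ∀ k, wt k p ≤ 1 ∧ wt k p + wt (k + 1) p ≤ 1 := by
    intro k
    have h := fun i => wt_nonneg i (p : ℂ)
    have h1 := sum_wt_five p
    have h2 := ctr_nonneg p
    rcases zmod5_cases k with rfl | rfl | rfl | rfl | rfl
    · exact ⟨by linarith [h 0, h 1, h 2, h 3, h 4], by
        rw [zero_add]; linarith [h 0, h 1, h 2, h 3, h 4]⟩
    · exact ⟨by linarith [h 0, h 1, h 2, h 3, h 4], by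
        rw [show (1 : ZMod 5) + 1 = 2 from rfl]; linarith [h 0, h 1, h 2, h 3, h 4]⟩
    · exact ⟨by linarith [h 0, h 1, h 2, h 3, h 4], by
        rw [show (2 : ZMod 5) + 1 = 3 from rfl]; linarith [h 0, h 1, h 2, h 3, h 4]⟩
    · exact ⟨by linarith [h 0, h 1, h 2, h 3, h 4], by
        rw [show (3 : ZMod 5) + 1 = 4 from rfl]; linarith [h 0, h 1, h 2, h 3, h 4]⟩
    · exact ⟨by linarith [h 0, h 1, h 2, h 3, h 4], by
        rw [show (4 : ZMod 5) + 1 = 0 from rfl]; linarith [h 0, h 1, h 2, h 3, h 4]⟩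
  have hc := ctr_nonneg p
  have hl := hle (l - 1)
  rw [sub_add_cancel] at hl
  simp only [rOld, rMid, rCor, wt_subPt_none, ctr_subPt_none]
  refine ⟨max_eq_left (by linarith [(hle l).1]), max_eq_left ?_, max_eq_left ?_⟩
  · have h1 := (hle l).2
    rcases le_total (wt l p) 0 with h | h
    · exact (min_le_left _ _).trans ((min_le_left _ _).trans (by linarith))
    · exact (min_le_right _ _).trans (by linarith [(hle l).1])
  · exact (min_le_left _ _).trans ((min_le_right _ _).trans (by linarith [hl.2]))

end PentHull
namespace PentHull

/-! ## The space of the subdivision -/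

theorem sum_zmod5 {A : Type*} [AddCommMonoid A] (f : ZMod 5 → A) :
    ∑ i, f i = f 0 + f 1 + f 2 + f 3 + f 4 :=
  Fin.sum_univ_five (fun i : Fin 5 => f i)

namespace PentComplex

variable {M : PentComplex}

/-- The vertex `v`, as a vertex of the subdivision. -/
def oldV (v : M.V) : M.subdiv.V := Sum.inl v
/-- The midpoint of an edge. -/
def midV (e : Sym2 M.V) : M.subdiv.V := Sum.inr (Sum.inl e)
/-- The vertices of the central tiles of the subdivision. -/
def newV (a : M.T × ZMod 5) : M.subdiv.V := Sum.inr (Sum.inr a)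

@[simp] theorem oldV_inj {v w : M.V} : oldV v = oldV w ↔ v = w := Sum.inl_injective.eq_iff
@[simp] theorem midV_inj {e f : Sym2 M.V} : midV e = midV f ↔ e = f :=
  (Sum.inr_injective.comp Sum.inl_injective).eq_iff
@[simp] theorem newV_inj {a b : M.T × ZMod 5} : newV a = newV b ↔ a = b :=
  (Sum.inr_injective.comp Sum.inr_injective).eq_iff
@[simp] theorem oldV_ne_midV {v : M.V} {e : Sym2 M.V} : oldV v ≠ midV e := Sum.inl_ne_inr
@[simp] theorem midV_ne_oldV {v : M.V} {e : Sym2 M.V} : midV e ≠ oldV v := Sum.inr_ne_inl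
@[simp] theorem oldV_ne_newV {v : M.V} {a : M.T × ZMod 5} : oldV v ≠ newV a := Sum.inl_ne_inr
@[simp] theorem newV_ne_oldV {v : M.V} {a : M.T × ZMod 5} : newV a ≠ oldV v := Sum.inr_ne_inl
@[simp] theorem midV_ne_newV {e : Sym2 M.V} {a : M.T × ZMod 5} : midV e ≠ newV a :=
  fun h => Sum.inl_ne_inr (Sum.inr_injective h)
@[simp] theorem newV_ne_midV {e : Sym2 M.V} {a : M.T × ZMod 5} : newV a ≠ midV e :=
  midV_ne_newV.symm

theorem subdiv_vert_none (t : M.T) (j : ZMod 5) : M.subdiv.vert (t, none) j = newV (t, j) := rfl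

theorem subdiv_vert_zero (t : M.T) (i : ZMod 5) :
    M.subdiv.vert (t, some i) 0 = oldV (M.vert t i) := rfl

theorem subdiv_vert_one (t : M.T) (i : ZMod 5) :
    M.subdiv.vert (t, some i) 1 = midV s(M.vert t i, M.vert t (i + 1)) := rfl

theorem subdiv_vert_two (t : M.T) (i : ZMod 5) :
    M.subdiv.vert (t, some i) 2 = newV (t, i) := rfl

theorem subdiv_vert_three (t : M.T) (i : ZMod 5) :
    M.subdiv.vert (t, some i) 3 = newV (t, i - 1) := rfl

theorem subdiv_vert_four (t : M.T) (i : ZMod 5) :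
    M.subdiv.vert (t, some i) 4 = midV s(M.vert t (i - 1), M.vert t i) := rfl

theorem InjVert.subdiv (hM : M.InjVert) : M.subdiv.InjVert := by
  rintro ⟨t, _ | i⟩
  · intro j k h
    simpa [subdiv_vert_none] using h
  · have h1 : i + 1 ≠ i - 1 := by revert i; decide
    have h2 : i - 1 ≠ i := by revert i; decide
    have h3 : i + 1 ≠ i := by revert i; decide
    intro j k h
    rcases zmod5_cases j with rfl | rfl | rfl | rfl | rfl <;>
    rcases zmod5_cases k with rfl | rfl | rfl | rfl | rfl <;>
    simp [subdiv_vert_zero, subdiv_vert_one, subdiv_vert_two, subdiv_vert_three,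
      subdiv_vert_four, (hM t).eq_iff, h1, h1.symm, h2, h2.symm, h3, h3.symm] at h ⊢

/-- The values at the vertices and centres of the subdivision of a piecewise linear function. -/
def subH (H : M.V ⊕ M.T → ℝ) : M.subdiv.V ⊕ M.subdiv.T → ℝ
  | Sum.inl (Sum.inl v) => H (Sum.inl v)
  | Sum.inl (Sum.inr (Sum.inl e)) => Sym2.lift
      ⟨fun a b => (H (Sum.inl a) + H (Sum.inl b)) / 2, fun a b => by simp only [add_comm]⟩ e
  | Sum.inl (Sum.inr (Sum.inr (t, i))) => (H (Sum.inl (M.vert t i)) + H (Sum.inr t)) / 2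
  | Sum.inr (t, none) => H (Sum.inr t)
  | Sum.inr (t, some i) => 3 / 4 * H (Sum.inl (M.vert t i)) + 1 / 4 * H (Sum.inr t)

theorem subH_old (H : M.V ⊕ M.T → ℝ) (v : M.V) : subH H (Sum.inl (oldV v)) = H (Sum.inl v) := rfl

theorem subH_mid (H : M.V ⊕ M.T → ℝ) (a b : M.V) :
    subH H (Sum.inl (midV s(a, b))) = (H (Sum.inl a) + H (Sum.inl b)) / 2 := rfl

theorem subH_new (H : M.V ⊕ M.T → ℝ) (t : M.T) (i : ZMod 5) :
    subH H (Sum.inl (newV (t, i))) = (H (Sum.inl (M.vert t i)) + H (Sum.inr t)) / 2 := rfl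

theorem subH_none (H : M.V ⊕ M.T → ℝ) (t : M.T) :
    subH H (Sum.inr (t, none)) = H (Sum.inr t) := rfl

theorem subH_some (H : M.V ⊕ M.T → ℝ) (t : M.T) (i : ZMod 5) : subH H (Sum.inr (t, some i)) =
    3 / 4 * H (Sum.inl (M.vert t i)) + 1 / 4 * H (Sum.inr t) := rfl

/-- The values `subH` are those of the given function at the small vertices and centres, and `subPt`
carries each small triangle affinely into a single large one. -/
theorem evP_subPt (H : M.V ⊕ M.T → ℝ) (t : M.T) (j : Option (ZMod 5)) (p : Pentagon) :
    M.evP H t (subPt j p) = M.subdiv.evP (subH H) (t, j) p := by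
  unfold evP
  have hc := sum_wt_five p
  cases j with
  | none =>
    simp only [sum_zmod5, wt_subPt_none, ctr_subPt_none, subdiv_vert_none, subH_new, subH_none]
    rw [hc]; ring
  | some i =>
    simp only [wt_subPt_some, ctr_subPt_some, add_mul, Finset.sum_add_distrib, ite_mul, zero_mul,
      Finset.sum_ite_eq', Finset.mem_univ, if_true]
    rw [sum_zmod5 fun k => wt k (p : ℂ) * subH H (Sum.inl (M.subdiv.vert (t, some i) k))]
    simp only [subdiv_vert_zero, subdiv_vert_one, subdiv_vert_two, subdiv_vert_three,
      subdiv_vert_four, subH_old, subH_mid, subH_new, subH_some, subA, subB, subC]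
    rw [hc]; ring

/-- The map from the space of the subdivision to the space. -/
def subMap (hM : M.InjVert) : M.subdiv.Space → M.Space :=
  Quot.lift (fun a => M.pt a.1.1 (subPt a.1.2 a.2)) fun a b h => eq_of_ev hM fun H => by
    rw [ev_pt, ev_pt, evP_subPt, evP_subPt]
    exact M.subdiv.evP_eq_of_glue _ h

theorem subMap_pt (hM : M.InjVert) (t : M.T) (j : Option (ZMod 5)) (p : Pentagon) :
    subMap hM (M.subdiv.pt (t, j) p) = M.pt t (subPt j p) := rfl

theorem ev_subMap (hM : M.InjVert) (H : M.V ⊕ M.T → ℝ) (x : M.subdiv.Space) :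
    M.ev H (subMap hM x) = M.subdiv.ev (subH H) x := by
  obtain ⟨⟨t, j⟩, p, rfl⟩ := M.subdiv.exists_pt x
  exact evP_subPt H t j p

theorem continuous_subMap (hM : M.InjVert) : Continuous (subMap hM) :=
  M.subdiv.continuous_space_iff.2 fun t => (M.continuous_pt t.1).comp (continuous_subPt t.2)

theorem subMap_surjective (hM : M.InjVert) : Function.Surjective (subMap hM) := by
  intro x
  obtain ⟨t, q, rfl⟩ := M.exists_pt x
  obtain ⟨j, p, rfl⟩ := exists_subPt q
  exact ⟨M.subdiv.pt (t, j) p, rfl⟩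

/-- The value at a point of a tile of a function that is piecewise linear on the subdivision. -/
def evR (H : M.subdiv.V ⊕ M.subdiv.T → ℝ) (t : M.T) (q : Pentagon) : ℝ :=
  ∑ l, (rOld (fun k => wt k q) (ctr q) l * H (Sum.inl (oldV (M.vert t l))) +
    rMid (fun k => wt k q) l * H (Sum.inl (midV s(M.vert t l, M.vert t (l + 1)))) +
    rNew (fun k => wt k q) (ctr q) l * H (Sum.inl (newV (t, l))) +
    rCor (fun k => wt k q) (ctr q) l * H (Sum.inr (t, some l))) +
  rNone (ctr q) * H (Sum.inr (t, none))

/-- The converse of `evP_subPt`: a function that is piecewise linear on the subdivision can be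
computed from the position in the large tile alone. -/
theorem evR_subPt (H : M.subdiv.V ⊕ M.subdiv.T → ℝ) (t : M.T) (j : Option (ZMod 5))
    (p : Pentagon) : evR H t (subPt j p) = M.subdiv.evP H (t, j) p := by
  unfold evP evR
  cases j with
  | none =>
    have h := sub_subPt_none p
    simp only [rNew]
    simp only [h, zero_mul, add_zero, zero_add, zero_div, sub_zero, mul_zero, subdiv_vert_none]
    simp only [wt_subPt_none]
    congr 1
    · exact Finset.sum_congr rfl fun l _ => by ring
    · rw [ctr_subPt_none, rNone, max_eq_right (by linarith [ctr_nonneg p])]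
      ring
  | some i =>
    have e4 : i + 4 = i - 1 := by rw [sub_eq_add_neg]; rfl
    rw [rNone_subPt_some, ← Equiv.sum_comp (Equiv.addLeft i)]
    simp only [Equiv.coe_addLeft, rOld_subPt_some, rMid_subPt_some, rNew_subPt_some,
      rCor_subPt_some, sum_zmod5]
    simp (decide := true) only [if_true, if_false, zero_mul, add_zero, zero_add]
    simp only [e4, sub_add_cancel, subdiv_vert_zero, subdiv_vert_one, subdiv_vert_two,
      subdiv_vert_three, subdiv_vert_four]
    ring

theorem edgePt_eq_subPt_left (i : ZMod 5) (s u : unitInterval) (hu : (u : ℝ) = 2 * s) :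
    edgePt i 1 s = subPt (some i) (edgePt 0 1 u) := by
  apply pentagon_ext
  intro k
  have hc : ctr (edgePt 0 1 u) = 0 := ctr_edgePt _ _ _
  rw [wt_subPt_some, wt_edgePt]
  simp (decide := true) [subA, subB, subC, wt_edgePt, ctr_edgePt, hu]
  congr 1
  ring

theorem edgePt_eq_subPt_right (i : ZMod 5) (s u : unitInterval) (hu : (u : ℝ) = 2 * s - 1) :
    edgePt i 1 s = subPt (some (i + 1)) (edgePt 4 1 u) := by
  apply pentagon_ext
  intro k
  rw [wt_subPt_some, wt_edgePt]
  simp (decide := true) [subA, subB, subC, wt_edgePt, ctr_edgePt, hu]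
  rw [add_comm]
  congr 1
  · congr 1; ring
  · congr 1; ring

/-- The value on an edge of a function that is linear on both halves of the edge. -/
def halves (a b m s : ℝ) : ℝ :=
  if s ≤ 1 / 2 then (1 - 2 * s) * a + 2 * s * m else (2 - 2 * s) * m + (2 * s - 1) * b

theorem halves_symm (a b m s : ℝ) : halves b a m (1 - s) = halves a b m s := by
  unfold halves
  split_ifs with h1 h2 h2
  · have : s = 1 / 2 := by linarith
    subst this; ring
  · ring
  · ring
  · linarith

/-- An edge consists of one edge of each of two small corner tiles. The value involves only the ends
and the midpoint, hence agrees for all tiles that contain the edge, in either direction. -/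
theorem evR_edgePt (H : M.subdiv.V ⊕ M.subdiv.T → ℝ) (t : M.T) (i : ZMod 5) (η : ℤˣ)
    (s : unitInterval) : evR H t (edgePt i η s) = halves (H (Sum.inl (oldV (M.vert t i))))
      (H (Sum.inl (oldV (M.vert t (i + ((η : ℤ) : ZMod 5))))))
      (H (Sum.inl (midV s(M.vert t i, M.vert t (i + ((η : ℤ) : ZMod 5)))))) s := by
  have key : ∀ (i : ZMod 5) (s : unitInterval), evR H t (edgePt i 1 s) =
      halves (H (Sum.inl (oldV (M.vert t i)))) (H (Sum.inl (oldV (M.vert t (i + 1)))))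
      (H (Sum.inl (midV s(M.vert t i, M.vert t (i + 1))))) s := by
    intro i s
    unfold halves
    split_ifs with h
    · rw [edgePt_eq_subPt_left i s ⟨2 * s, by linarith [s.2.1], by linarith⟩ rfl, evR_subPt,
        M.subdiv.evP_edgePt H (t, some _)]
      simp only [Units.val_one, Int.cast_one, zero_add, subdiv_vert_zero, subdiv_vert_one]
    · rw [edgePt_eq_subPt_right i s ⟨2 * s - 1, by linarith, by linarith [s.2.2]⟩ rfl, evR_subPt,
        M.subdiv.evP_edgePt H (t, some _)]
      simp only [Units.val_one, Int.cast_one, show (4 : ZMod 5) + 1 = 0 from rfl, subdiv_vert_zero,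
        subdiv_vert_four, add_sub_cancel_right]
      ring
  rcases Int.units_eq_one_or η with rfl | rfl
  · simpa using key i s
  · rw [edgePt_neg, key, ← halves_symm]
    simp only [sub_add_cancel, Units.val_neg, Units.val_one, Int.cast_neg, Int.cast_one,
      ← sub_eq_add_neg, unitInterval.coe_symm_eq, sub_sub_cancel]
    rw [Sym2.eq_swap]

theorem evR_eq_of_glue (H : M.subdiv.V ⊕ M.subdiv.T → ℝ) {a b : Σ _ : M.T, Pentagon}
    (h : M.Glue a b) : evR H a.1 a.2 = evR H b.1 b.2 := by
  cases h with
  | @vertex t t' i j h =>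
    simp only
    rw [← edgePt_zero i 1, ← edgePt_zero j 1, evR_edgePt, evR_edgePt]
    simp [halves, h]
  | edge η h₀ h₁ s => simp only [evR_edgePt, h₀, h₁, Units.val_one, Int.cast_one]

/-- By `evR_eq_of_glue` every piecewise linear function of the subdivision factors through `subMap`,
and these functions separate points. -/
theorem subMap_injective (hM : M.InjVert) : Function.Injective (subMap hM) := by
  intro x y hxy
  refine eq_of_ev hM.subdiv fun H => ?_
  let f : M.Space → ℝ := Quot.lift (fun a => evR H a.1 a.2) fun _ _ h => evR_eq_of_glue H h
  have key : ∀ z, f (subMap hM z) = M.subdiv.ev H z := by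
    intro z
    obtain ⟨⟨t, j⟩, p, rfl⟩ := M.subdiv.exists_pt z
    exact evR_subPt H t j p
  rw [← key, hxy, key]

theorem isClosed_space_iff {C : Set M.Space} : IsClosed C ↔ ∀ t, IsClosed {p | M.pt t p ∈ C} := by
  rw [← isOpen_compl_iff, isOpen_space_iff]
  exact forall_congr' fun t => by rw [← isOpen_compl_iff]; rfl

/-- Inside one large tile the image of a closed set is a union of six compact sets. -/
theorem isClosedMap_subMap (hM : M.InjVert) : IsClosedMap (subMap hM) := by
  intro C hC
  rw [isClosed_space_iff] at hC ⊢
  intro t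
  have : {q | M.pt t q ∈ subMap hM '' C} = ⋃ j, subPt j '' {p | M.subdiv.pt (t, j) p ∈ C} := by
    ext q
    simp only [mem_ofPred_eq, mem_iUnion]
    constructor
    · intro h
      obtain ⟨j, p, rfl⟩ := exists_subPt q
      rw [← subMap_pt hM, (subMap_injective hM).mem_set_image] at h
      exact ⟨j, p, h, rfl⟩
    · rintro ⟨j, p, hp, rfl⟩
      exact ⟨_, hp, rfl⟩
  rw [this]
  exact isClosed_iUnion_of_finite fun j =>
    ((hC (t, j)).isCompact.image (continuous_subPt j)).isClosed

/-- The space of the subdivision is the space of the complex. -/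
def subHomeo (hM : M.InjVert) : M.subdiv.Space ≃ₜ M.Space :=
  (Equiv.ofBijective (subMap hM) ⟨subMap_injective hM, subMap_surjective hM⟩).toHomeomorphOfContinuousClosed
    (continuous_subMap hM) (isClosedMap_subMap hM)

end PentComplex

end PentHull
namespace PentHull

/-! ## Direct limits of sequences of sets -/

section Limit

variable {F : ℕ → Type} {f : ∀ n, F n → F (n + 1)}

theorem limRel_exists_iterate {x y : Σ n, F n} (h : Quot.mk (limRel f) x = Quot.mk (limRel f) y) :
    ∃ i j, (fun a : Σ n, F n => (⟨a.1 + 1, f a.1 a.2⟩ : Σ n, F n))^[i] x =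
      (fun a : Σ n, F n => (⟨a.1 + 1, f a.1 a.2⟩ : Σ n, F n))^[j] y := by
  replace h := Quot.eqvGen_exact h
  induction h with
  | rel x y h => exact ⟨1, 0, h.symm⟩
  | refl x => exact ⟨0, 0, rfl⟩
  | symm x y _ ih =>
    obtain ⟨i, j, h⟩ := ih
    exact ⟨j, i, h.symm⟩
  | trans x y z _ _ ih ih' =>
    obtain ⟨i, j, h⟩ := ih
    obtain ⟨k, l, h'⟩ := ih'
    refine ⟨k + i, j + l, ?_⟩
    rw [Function.iterate_add_apply, h, ← Function.iterate_add_apply, add_comm k j,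
      Function.iterate_add_apply, h', ← Function.iterate_add_apply]

theorem limRel_mk_injective (hf : ∀ n, Function.Injective (f n)) (n : ℕ) :
    Function.Injective fun a : F n => Quot.mk (limRel f) ⟨n, a⟩ := by
  intro a b h
  obtain ⟨i, j, h⟩ := limRel_exists_iterate h
  set g := fun a : Σ n, F n => (⟨a.1 + 1, f a.1 a.2⟩ : Σ n, F n)
  have hg : Function.Injective g := by
    rintro ⟨n, a⟩ ⟨m, b⟩ h
    simp only [g, Sigma.mk.injEq, add_left_inj] at h
    obtain ⟨rfl, h⟩ := h
    rw [hf _ (eq_of_heq h)]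
  have hl : ∀ k (x : Σ n, F n), (g^[k] x).1 = x.1 + k := by
    intro k
    induction k with
    | zero => intro x; rfl
    | succ k ih => intro x; rw [Function.iterate_succ_apply, ih]; simp only [g]; omega
  -- Both iterates start at level `n` and end at the same level.
  have hij : i = j := by
    have := congrArg Sigma.fst h
    rw [hl, hl] at this
    simpa using this
  subst hij
  simpa using hg.iterate i h

theorem limRel_exists_rep (x : Quot (limRel f)) :
    ∃ n₀, ∀ n, n₀ ≤ n → ∃ a : F n, x = Quot.mk _ ⟨n, a⟩ := by
  obtain ⟨⟨n₀, a⟩, rfl⟩ := Quot.exists_rep x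
  refine ⟨n₀, fun n hn => ?_⟩
  induction n, hn using Nat.le_induction with
  | base => exact ⟨a, rfl⟩
  | succ n _ ih =>
    obtain ⟨b, hb⟩ := ih
    exact ⟨f n b, hb.trans (Quot.sound rfl)⟩

theorem limRel_exists_rep_two (x y : Quot (limRel f)) :
    ∃ n, ∃ a b : F (n + 1), x = Quot.mk _ ⟨n + 1, a⟩ ∧ y = Quot.mk _ ⟨n + 1, b⟩ := by
  obtain ⟨n, hn⟩ := limRel_exists_rep x
  obtain ⟨m, hm⟩ := limRel_exists_rep y
  obtain ⟨a, ha⟩ := hn (n + m + 1) (by omega)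
  obtain ⟨b, hb⟩ := hm (n + m + 1) (by omega)
  exact ⟨_, a, b, ha, hb⟩

end Limit

/-! ## The self-similarity of `K` -/

namespace PentComplex

theorem Hom.subdiv_injective {L M : PentComplex} {f : L.Hom M} (hV : Function.Injective f.onV)
    (hT : Function.Injective f.onT) :
    Function.Injective f.subdiv.onV ∧ Function.Injective f.subdiv.onT :=
  ⟨hV.sumMap ((Sym2.map.injective hV).sumMap (hT.prodMap Function.injective_id)),
    hT.prodMap Function.injective_id⟩

end PentComplex

open PentComplex

theorem iota_injective (n : ℕ) :
    Function.Injective (iota n).onV ∧ Function.Injective (iota n).onT := by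
  induction n with
  | zero =>
    refine ⟨fun i j h => ?_, fun a b _ => rfl⟩
    exact congrArg Prod.snd (Sum.inr_injective (Sum.inr_injective h))
  | succ n ih => exact Hom.subdiv_injective ih.1 ih.2

/-- The map from `K_n` to `K`. -/
def incl (n : ℕ) : (Kn n).Hom K where
  onV := fun v => Quot.mk _ ⟨n, v⟩
  onT := fun t => Quot.mk _ ⟨n, t⟩
  compat := fun _ _ => rfl

theorem incl_injective (n : ℕ) :
    Function.Injective (incl n).onV ∧ Function.Injective (incl n).onT :=
  ⟨limRel_mk_injective (fun m => (iota_injective m).1) n,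
    limRel_mk_injective (fun m => (iota_injective m).2) n⟩

theorem incl_iota_onV (n : ℕ) (v : (Kn n).V) :
    (incl (n + 1)).onV ((iota n).onV v) = (incl n).onV v :=
  (Quot.sound (r := limRel fun n => (iota n).onV) (a := ⟨n, v⟩) rfl).symm

theorem incl_iota_onT (n : ℕ) (t : (Kn n).T) :
    (incl (n + 1)).onT ((iota n).onT t) = (incl n).onT t :=
  (Quot.sound (r := limRel fun n => (iota n).onT) (a := ⟨n, t⟩) rfl).symm

/-- The vertices of `K` as vertices of the subdivision of `K`, on representatives. -/
def desubV : (Σ n, (Kn n).V) → K.subdiv.V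
  -- `K_0` sits in `ω(K_0)` as the central tile, so its corners become new vertices. Level `n + 1`
  -- is `ω(K_n)` and is carried by the subdivision of `incl n`.
  | ⟨0, i⟩ => newV ((incl 0).onT (), i)
  | ⟨n + 1, v⟩ => (incl n).subdiv.onV v

/-- The tiles of `K` as tiles of the subdivision of `K`, on representatives. -/
def desubT : (Σ n, (Kn n).T) → K.subdiv.T
  | ⟨0, t⟩ => ((incl 0).onT t, none)
  | ⟨n + 1, t⟩ => (incl n).subdiv.onT t

/-- The complex `K` as its own subdivision. -/
def desub : K.Hom K.subdiv where
  onV := Quot.lift desubV (by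
    rintro ⟨n, v⟩ b rfl
    cases n with
    | zero => rfl
    | succ n =>
      rcases (v : (Kn n).V ⊕ (Sym2 (Kn n).V ⊕ ((Kn n).T × ZMod 5))) with v | e | ⟨t, i⟩
      · exact congrArg oldV (incl_iota_onV n v).symm
      · refine congrArg midV ?_
        change Sym2.map _ e = Sym2.map _ (Sym2.map _ e)
        rw [Sym2.map_map]
        congr 1
        funext v
        exact (incl_iota_onV n v).symm
      · exact congrArg (fun x => newV (x, i)) (incl_iota_onT n t).symm)
  onT := Quot.lift desubT (by
    rintro ⟨n, t⟩ b rfl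
    cases n with
    | zero => rfl
    | succ n => exact congrArg (fun x => (x, t.2)) (incl_iota_onT n t.1).symm)
  compat := by
    rintro ⟨n, t⟩ i
    cases n with
    | zero => rfl
    | succ n => exact (incl n).subdiv.compat t i

theorem desub_injective : Function.Injective desub.onV ∧ Function.Injective desub.onT := by
  constructor
  · intro x y h
    -- Both elements have representatives on one positive level, where `desub` is the subdivision of
    -- the injective map `incl n`.
    obtain ⟨n, a, b, rfl, rfl⟩ := limRel_exists_rep_two x y
    rw [(Hom.subdiv_injective (incl_injective n).1 (incl_injective n).2).1 h]
  · intro x y h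
    obtain ⟨n, a, b, rfl, rfl⟩ := limRel_exists_rep_two x y
    rw [(Hom.subdiv_injective (incl_injective n).1 (incl_injective n).2).2 h]

theorem desub_onT_surjective : Function.Surjective desub.onT := by
  rintro ⟨x, j⟩
  obtain ⟨⟨n, t⟩, rfl⟩ := Quot.exists_rep x
  exact ⟨(incl (n + 1)).onT (t, j), rfl⟩

theorem Kn_injVert (n : ℕ) : (Kn n).InjVert := by
  induction n with
  | zero => exact fun _ => Function.injective_id
  | succ n ih => exact InjVert.subdiv ih

theorem K_injVert : K.InjVert := by
  intro x
  obtain ⟨⟨n, t⟩, rfl⟩ := Quot.exists_rep x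
  exact (incl_injective n).1.comp (Kn_injVert n t)

/-! ## Stars of vertices -/

namespace PentComplex

/-- The tiles at the vertex `v` form a cycle of length `d`. -/
structure Star (M : PentComplex) (v : M.V) (d : ℕ) where
  tl : ZMod d → M.T
  ix : ZMod d → ZMod 5
  nb : ZMod d → M.V
  vert_ix : ∀ k, M.vert (tl k) (ix k) = v
  vert_next : ∀ k, M.vert (tl k) (ix k + 1) = nb k
  vert_prev : ∀ k, M.vert (tl k) (ix k - 1) = nb (k + 1)
  nb_injective : Function.Injective nb
  complete : ∀ t i, M.vert t i = v → ∃ k, t = tl k ∧ i = ix k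

/-- The vertex `v` lies in exactly three or four tiles, in a cycle. -/
def Full (M : PentComplex) (v : M.V) : Prop := Nonempty (M.Star v 3) ∨ Nonempty (M.Star v 4)

variable {M : PentComplex} {v : M.V}

theorem Full.of_three {t₀ t₁ t₂ : M.T} {i₀ i₁ i₂ : ZMod 5} {a₀ a₁ a₂ : M.V}
    (h₀ : M.vert t₀ i₀ = v) (h₁ : M.vert t₁ i₁ = v) (h₂ : M.vert t₂ i₂ = v)
    (n₀ : M.vert t₀ (i₀ + 1) = a₀) (n₁ : M.vert t₁ (i₁ + 1) = a₁) (n₂ : M.vert t₂ (i₂ + 1) = a₂)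
    (p₀ : M.vert t₀ (i₀ - 1) = a₁) (p₁ : M.vert t₁ (i₁ - 1) = a₂) (p₂ : M.vert t₂ (i₂ - 1) = a₀)
    (d₁ : a₀ ≠ a₁) (d₂ : a₀ ≠ a₂) (d₃ : a₁ ≠ a₂)
    (hc : ∀ t i, M.vert t i = v → (t = t₀ ∧ i = i₀) ∨ (t = t₁ ∧ i = i₁) ∨ (t = t₂ ∧ i = i₂)) :
    M.Full v := by
  refine Or.inl ⟨⟨(![t₀, t₁, t₂] : Fin 3 → M.T), (![i₀, i₁, i₂] : Fin 3 → ZMod 5),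
    (![a₀, a₁, a₂] : Fin 3 → M.V), ?_, ?_, ?_, ?_, ?_⟩⟩
  · exact (Fin.forall_fin_succ (n := 2)).2 ⟨h₀, (Fin.forall_fin_two).2 ⟨h₁, h₂⟩⟩
  · exact (Fin.forall_fin_succ (n := 2)).2 ⟨n₀, (Fin.forall_fin_two).2 ⟨n₁, n₂⟩⟩
  · exact (Fin.forall_fin_succ (n := 2)).2 ⟨p₀, (Fin.forall_fin_two).2 ⟨p₁, p₂⟩⟩
  · intro k l h
    change Fin 3 at k l
    fin_cases k <;> fin_cases l <;> first | rfl | simp_all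
  · intro t i h
    rcases hc t i h with h | h | h
    exacts [⟨0, h⟩, ⟨1, h⟩, ⟨2, h⟩]

theorem Full.of_four {t₀ t₁ t₂ t₃ : M.T} {i₀ i₁ i₂ i₃ : ZMod 5} {a₀ a₁ a₂ a₃ : M.V}
    (h₀ : M.vert t₀ i₀ = v) (h₁ : M.vert t₁ i₁ = v) (h₂ : M.vert t₂ i₂ = v)
    (h₃ : M.vert t₃ i₃ = v)
    (n₀ : M.vert t₀ (i₀ + 1) = a₀) (n₁ : M.vert t₁ (i₁ + 1) = a₁) (n₂ : M.vert t₂ (i₂ + 1) = a₂)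
    (n₃ : M.vert t₃ (i₃ + 1) = a₃)
    (p₀ : M.vert t₀ (i₀ - 1) = a₁) (p₁ : M.vert t₁ (i₁ - 1) = a₂) (p₂ : M.vert t₂ (i₂ - 1) = a₃)
    (p₃ : M.vert t₃ (i₃ - 1) = a₀)
    (d₁ : a₀ ≠ a₁) (d₂ : a₀ ≠ a₂) (d₃ : a₀ ≠ a₃) (d₄ : a₁ ≠ a₂) (d₅ : a₁ ≠ a₃) (d₆ : a₂ ≠ a₃)
    (hc : ∀ t i, M.vert t i = v → (t = t₀ ∧ i = i₀) ∨ (t = t₁ ∧ i = i₁) ∨ (t = t₂ ∧ i = i₂) ∨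
      (t = t₃ ∧ i = i₃)) :
    M.Full v := by
  refine Or.inr ⟨⟨(![t₀, t₁, t₂, t₃] : Fin 4 → M.T), (![i₀, i₁, i₂, i₃] : Fin 4 → ZMod 5),
    (![a₀, a₁, a₂, a₃] : Fin 4 → M.V), ?_, ?_, ?_, ?_, ?_⟩⟩
  · exact (Fin.forall_fin_succ (n := 3)).2 ⟨h₀, (Fin.forall_fin_succ (n := 2)).2
      ⟨h₁, (Fin.forall_fin_two).2 ⟨h₂, h₃⟩⟩⟩
  · exact (Fin.forall_fin_succ (n := 3)).2 ⟨n₀, (Fin.forall_fin_succ (n := 2)).2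
      ⟨n₁, (Fin.forall_fin_two).2 ⟨n₂, n₃⟩⟩⟩
  · exact (Fin.forall_fin_succ (n := 3)).2 ⟨p₀, (Fin.forall_fin_succ (n := 2)).2
      ⟨p₁, (Fin.forall_fin_two).2 ⟨p₂, p₃⟩⟩⟩
  · intro k l h
    change Fin 4 at k l
    fin_cases k <;> fin_cases l <;> first | rfl | simp_all
  · intro t i h
    rcases hc t i h with h | h | h | h
    exacts [⟨0, h⟩, ⟨1, h⟩, ⟨2, h⟩, ⟨3, h⟩]

/-- The tile on the other side of an edge at a full vertex. -/
theorem Full.exists_opposite {t : M.T} {i : ZMod 5} (h : M.Full (M.vert t i)) :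
    ∃ t' j, M.vert t' (j + 1) = M.vert t i ∧ M.vert t' j = M.vert t (i + 1) ∧
      ∀ t'' l, s(M.vert t'' l, M.vert t'' (l + 1)) = s(M.vert t i, M.vert t (i + 1)) →
        (t'' = t ∧ l = i) ∨ (t'' = t' ∧ l = j) := by
  have key : ∀ d, M.Star (M.vert t i) d → ∃ t' j, M.vert t' (j + 1) = M.vert t i ∧
      M.vert t' j = M.vert t (i + 1) ∧
      ∀ t'' l, s(M.vert t'' l, M.vert t'' (l + 1)) = s(M.vert t i, M.vert t (i + 1)) →
        (t'' = t ∧ l = i) ∨ (t'' = t' ∧ l = j) := by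
    intro d S
    obtain ⟨k, hk, hk'⟩ := S.complete t i rfl
    have hk1 := S.vert_next k
    rw [← hk, ← hk'] at hk1
    refine ⟨S.tl (k - 1), S.ix (k - 1) - 1, ?_, ?_, ?_⟩
    · rw [sub_add_cancel, S.vert_ix]
    · rw [S.vert_prev, sub_add_cancel, hk1]
    · intro t'' l h
      rw [Sym2.eq_iff] at h
      rcases h with ⟨h1, h2⟩ | ⟨h1, h2⟩
      · obtain ⟨m, rfl, rfl⟩ := S.complete _ _ h1
        rw [S.vert_next, hk1] at h2
        rw [S.nb_injective h2]
        exact Or.inl ⟨hk.symm, hk'.symm⟩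
      · obtain ⟨m, rfl, hm⟩ := S.complete _ _ h2
        have h3 := S.vert_prev m
        rw [← hm, add_sub_cancel_right, h1, hk1] at h3
        have h4 := S.nb_injective h3
        rw [h4, add_sub_cancel_right]
        exact Or.inr ⟨rfl, by rw [← hm, add_sub_cancel_right]⟩
  rcases h with ⟨⟨S⟩⟩ | ⟨⟨S⟩⟩
  exacts [key 3 S, key 4 S]

theorem vert_subdiv_eq_newV {x : M.subdiv.T} {j : ZMod 5} {t : M.T} {i : ZMod 5}
    (h : M.subdiv.vert x j = newV (t, i)) :
    (x = (t, none) ∧ j = i) ∨ (x = (t, some i) ∧ j = 2) ∨ (x = (t, some (i + 1)) ∧ j = 3) := by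
  obtain ⟨u, _ | l⟩ := x
  · rw [subdiv_vert_none, newV_inj] at h
    obtain ⟨rfl, rfl⟩ := Prod.mk.inj h
    exact Or.inl ⟨rfl, rfl⟩
  · rcases zmod5_cases j with rfl | rfl | rfl | rfl | rfl <;>
    simp [subdiv_vert_zero, subdiv_vert_one, subdiv_vert_two, subdiv_vert_three,
      subdiv_vert_four] at h
    · obtain ⟨rfl, rfl⟩ := h
      exact Or.inr (Or.inl ⟨rfl, rfl⟩)
    · obtain ⟨rfl, rfl⟩ := h
      exact Or.inr (Or.inr ⟨by rw [sub_add_cancel], rfl⟩)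

theorem vert_subdiv_eq_midV {x : M.subdiv.T} {j : ZMod 5} {e : Sym2 M.V}
    (h : M.subdiv.vert x j = midV e) : ∃ t i, s(M.vert t i, M.vert t (i + 1)) = e ∧
      ((x = (t, some i) ∧ j = 1) ∨ (x = (t, some (i + 1)) ∧ j = 4)) := by
  obtain ⟨u, _ | l⟩ := x
  · rw [subdiv_vert_none] at h
    exact absurd h newV_ne_midV
  · rcases zmod5_cases j with rfl | rfl | rfl | rfl | rfl <;>
    simp only [subdiv_vert_zero, subdiv_vert_one, subdiv_vert_two, subdiv_vert_three,
      subdiv_vert_four, oldV_ne_midV, newV_ne_midV, midV_inj] at h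
    · exact ⟨u, l, h, Or.inl ⟨rfl, rfl⟩⟩
    · exact ⟨u, l - 1, by rwa [sub_add_cancel], Or.inr ⟨by rw [sub_add_cancel], rfl⟩⟩

theorem vert_subdiv_eq_oldV {x : M.subdiv.T} {j : ZMod 5}
    (h : M.subdiv.vert x j = oldV v) : ∃ t i, M.vert t i = v ∧ x = (t, some i) ∧ j = 0 := by
  obtain ⟨u, _ | l⟩ := x
  · rw [subdiv_vert_none] at h
    exact absurd h newV_ne_oldV
  · rcases zmod5_cases j with rfl | rfl | rfl | rfl | rfl <;>
    simp only [subdiv_vert_zero, subdiv_vert_one, subdiv_vert_two, subdiv_vert_three,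
      subdiv_vert_four, midV_ne_oldV, newV_ne_oldV, oldV_inj] at h
    · exact ⟨u, l, h, rfl, rfl⟩

/-- The three tiles are the central one and those at the corners `i` and `i + 1`. -/
theorem full_newV (t : M.T) (i : ZMod 5) : M.subdiv.Full (newV (t, i)) := by
  have h1 : i + 1 ≠ i - 1 := by revert i; decide
  refine Full.of_three (M := M.subdiv) (t₀ := (t, none)) (i₀ := i) (t₁ := (t, some i)) (i₁ := 2)
    (t₂ := (t, some (i + 1))) (i₂ := 3) rfl rfl ?_ rfl rfl rfl rfl ?_ ?_ ?_ ?_ ?_ ?_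
  · rw [subdiv_vert_three, add_sub_cancel_right]
  · change midV _ = midV _
    rw [add_sub_cancel_right]
  · rfl
  · rw [show (2 : ZMod 5) + 1 = 3 from rfl, subdiv_vert_none, subdiv_vert_three]
    simpa using h1
  · rw [show (3 : ZMod 5) + 1 = 4 from rfl, subdiv_vert_none, subdiv_vert_four]
    simp
  · rw [show (2 : ZMod 5) + 1 = 3 from rfl, show (3 : ZMod 5) + 1 = 4 from rfl, subdiv_vert_three,
      subdiv_vert_four]
    simp
  · exact fun x j h => vert_subdiv_eq_newV h

/-- The four tiles are two corner tiles on each side of the edge. The other side exists because an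
end of the edge is full. -/
theorem full_midV (hM : M.InjVert) {t : M.T} {i : ZMod 5} (h : M.Full (M.vert t i)) :
    M.subdiv.Full (midV s(M.vert t i, M.vert t (i + 1))) := by
  obtain ⟨t', j, h1, h2, h3⟩ := h.exists_opposite
  have hne : t ≠ t' ∨ i ≠ j := by
    by_contra! hcon
    obtain ⟨rfl, rfl⟩ := hcon
    exact add_one_ne_self i (hM t h1)
  have hab : M.vert t (i + 1) ≠ M.vert t i := fun e => add_one_ne_self i (hM t e)
  refine Full.of_four (M := M.subdiv) (t₀ := (t, some i)) (i₀ := 1)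
    (t₁ := (t', some (j + 1))) (i₁ := 4) (t₂ := (t', some j)) (i₂ := 1) (t₃ := (t, some (i + 1)))
    (i₃ := 4) rfl ?_ ?_ ?_ rfl rfl rfl rfl ?_ ?_ ?_ ?_ ?_ ?_ ?_ ?_ ?_ ?_ ?_
  · rw [subdiv_vert_four, add_sub_cancel_right, h1, h2, Sym2.eq_swap]
  · rw [subdiv_vert_one, h1, h2, Sym2.eq_swap]
  · rw [subdiv_vert_four, add_sub_cancel_right]
  · change oldV _ = oldV _
    rw [h1]
  · change newV _ = newV _
    rw [add_sub_cancel_right]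
  · change oldV _ = oldV _
    rw [h2]
  · change newV _ = newV _
    rw [add_sub_cancel_right]
  · exact newV_ne_oldV
  · change newV _ ≠ newV _
    simp only [ne_eq, newV_inj, Prod.mk.injEq]
    tauto
  · exact newV_ne_oldV
  · exact oldV_ne_newV
  · change oldV _ ≠ oldV _
    rw [ne_eq, oldV_inj, h1]
    exact hab.symm
  · exact newV_ne_oldV
  · intro x l h
    obtain ⟨t'', m, he, hx⟩ := vert_subdiv_eq_midV h
    rcases h3 _ _ he with ⟨rfl, rfl⟩ | ⟨rfl, rfl⟩ <;> rcases hx with hx | hx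
    exacts [Or.inl hx, Or.inr (Or.inr (Or.inr hx)), Or.inr (Or.inr (Or.inl hx)), Or.inr (Or.inl hx)]

/-- The star of an old vertex in the subdivision. -/
def Star.subdiv {d : ℕ} (S : M.Star v d) : M.subdiv.Star (oldV v) d where
  tl := fun k => (S.tl k, some (S.ix k))
  ix := fun _ => 0
  nb := fun k => midV s(v, S.nb k)
  vert_ix := fun k => by rw [subdiv_vert_zero, S.vert_ix]
  vert_next := fun k => by rw [zero_add, subdiv_vert_one, S.vert_ix, S.vert_next]
  vert_prev := fun k => by
    rw [show (0 : ZMod 5) - 1 = 4 from rfl, subdiv_vert_four, S.vert_ix, S.vert_prev, Sym2.eq_swap]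
  nb_injective := fun k l h => S.nb_injective (Sym2.congr_right.1 (midV_inj.1 h))
  complete := fun x j h => by
    obtain ⟨t, i, h1, rfl, rfl⟩ := vert_subdiv_eq_oldV h
    obtain ⟨k, rfl, rfl⟩ := S.complete t i h1
    exact ⟨k, rfl, rfl⟩

/-- The star of a vertex, from the star of its image. -/
theorem Star.comap {L : PentComplex} {f : L.Hom M} (hV : Function.Injective f.onV)
    (hT : Function.Bijective f.onT) {v : L.V} {d : ℕ} (S : M.Star (f.onV v) d) :
    Nonempty (L.Star v d) := by
  choose tl htl using fun k => hT.2 (S.tl k)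
  refine ⟨⟨tl, S.ix, fun k => L.vert (tl k) (S.ix k + 1), fun k => ?_, fun k => rfl, fun k => ?_,
    fun k l h => ?_, fun t i h => ?_⟩⟩
  · apply hV
    rw [f.compat, htl, S.vert_ix]
  · apply hV
    rw [f.compat, f.compat, htl, htl, S.vert_prev, S.vert_next]
  · apply S.nb_injective
    have := congrArg f.onV h
    rwa [f.compat, f.compat, htl, htl, S.vert_next, S.vert_next] at this
  · obtain ⟨k, h1, h2⟩ := S.complete (f.onT t) i (by rw [← f.compat, h])
    exact ⟨k, hT.1 (by rw [h1, htl]), h2⟩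

theorem Full.comap {L : PentComplex} {f : L.Hom M} (hV : Function.Injective f.onV)
    (hT : Function.Bijective f.onT) {v : L.V} (h : M.Full (f.onV v)) : L.Full v := by
  rcases h with ⟨⟨S⟩⟩ | ⟨⟨S⟩⟩
  exacts [Or.inl (S.comap hV hT), Or.inr (S.comap hV hT)]

theorem Full.subdiv_oldV (h : M.Full v) : M.subdiv.Full (oldV v) := by
  rcases h with ⟨⟨S⟩⟩ | ⟨⟨S⟩⟩
  exacts [Or.inl ⟨S.subdiv⟩, Or.inr ⟨S.subdiv⟩]

theorem full_subdiv (hM : M.InjVert) {t : M.T} (h : ∀ i, M.Full (M.vert t i))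
    (j : Option (ZMod 5)) (k : ZMod 5) : M.subdiv.Full (M.subdiv.vert (t, j) k) := by
  cases j with
  | none => exact full_newV t k
  | some i =>
    rcases zmod5_cases k with rfl | rfl | rfl | rfl | rfl
    · exact (h i).subdiv_oldV
    · exact full_midV hM (h i)
    · exact full_newV t i
    · exact full_newV t (i - 1)
    · have := full_midV hM (h (i - 1))
      rwa [sub_add_cancel] at this

end PentComplex

theorem desub_onT_bijective : Function.Bijective desub.onT :=
  ⟨desub_injective.2, desub_onT_surjective⟩

/-- Every vertex of `K` lies in exactly three or four tiles, in a cycle. -/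
theorem K_full (t : K.T) (i : ZMod 5) : K.Full (K.vert t i) := by
  obtain ⟨⟨n, t⟩, rfl⟩ := Quot.exists_rep t
  change K.Full (K.vert ((incl n).onT t) i)
  -- Seen in the subdivision of `K`, the corners of the tile of level zero are new vertices, which
  -- are always full. A tile of level `n + 1` is a small tile of a tile of level `n`, whose corners
  -- are full by induction.
  induction n generalizing i with
  | zero =>
    apply Full.comap desub_injective.1 desub_onT_bijective
    rw [desub.compat]
    exact full_newV _ _
  | succ n ih =>
    obtain ⟨t, j⟩ := t
    apply Full.comap desub_injective.1 desub_onT_bijective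
    rw [desub.compat]
    exact full_subdiv K_injVert (fun i => ih i t) j i

end PentHull
namespace PentHull

open PentComplex Topology

/-! ## Open stars are discs -/

theorem isOpenEmbedding_of_leftInverse {X Y : Type*} [TopologicalSpace X] [TopologicalSpace Y]
    {ψ : X → Y} {g : Y → X} {U : Set Y} (hψ : Continuous ψ) (hU : IsOpen U)
    (hg : ContinuousOn g U) (hm : ∀ x, ψ x ∈ U) (h1 : ∀ x, g (ψ x) = x)
    (h2 : ∀ y ∈ U, ψ (g y) = y) : IsOpenEmbedding ψ ∧ range ψ = U := by
  refine ⟨IsOpenEmbedding.of_continuous_injective_isOpenMap hψ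
    (Function.LeftInverse.injective h1) fun O hO => ?_, ?_⟩
  · have : ψ '' O = U ∩ g ⁻¹' O := by
      ext y
      constructor
      · rintro ⟨x, hx, rfl⟩
        exact ⟨hm x, by rwa [mem_preimage, h1]⟩
      · rintro ⟨hy, hy'⟩
        exact ⟨g y, hy', h2 y hy⟩
    rw [this]
    exact hg.isOpen_inter_preimage hU hO
  · ext y
    exact ⟨by rintro ⟨x, rfl⟩; exact hm x, fun hy => ⟨g y, h2 y hy⟩⟩

theorem sum_wt_nonneg (z : ℂ) : 0 ≤ ∑ i, wt i z := Finset.sum_nonneg fun i _ => wt_nonneg i z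

/-- The point of the open pentagon that corresponds to a point of the plane. -/
def radial (z : ℂ) : Pentagon := ⟨(((1 + ∑ i, wt i z)⁻¹ : ℝ) : ℂ) * z, by
  have h := sum_wt_nonneg z
  rw [mem_pentagon_iff]
  simp only [wt_smul _ (inv_nonneg.2 (show 0 ≤ 1 + ∑ i, wt i z by linarith)), ← Finset.mul_sum]
  rw [inv_mul_le_iff₀ (by linarith)]
  linarith⟩

theorem wt_radial (z : ℂ) (i : ZMod 5) : wt i (radial z) = (1 + ∑ i, wt i z)⁻¹ * wt i z :=
  wt_smul _ (inv_nonneg.2 (by linarith [sum_wt_nonneg z])) _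

theorem ctr_radial (z : ℂ) : ctr (radial z) = (1 + ∑ i, wt i z)⁻¹ := by
  have h := sum_wt_nonneg z
  unfold ctr
  simp only [wt_radial, ← Finset.mul_sum]
  field_simp
  ring

theorem continuous_radial : Continuous radial := by
  refine Continuous.subtype_mk ((Complex.continuous_ofReal.comp ?_).mul continuous_id) _
  refine (continuous_const.add (continuous_finsetSum _ fun i _ => continuous_wt i)).inv₀ fun z => ?_
  have h := sum_wt_nonneg z
  change 1 + ∑ i, wt i z ≠ 0
  linarith

namespace PentComplex

variable {M : PentComplex}

open scoped Classical in
/-- The weight function of a vertex or a centre. -/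
def weight (M : PentComplex) (z : M.V ⊕ M.T) : M.Space → ℝ := M.ev (Pi.single z 1)

theorem continuous_weight (z : M.V ⊕ M.T) : Continuous (M.weight z) := M.continuous_ev _

theorem weight_vert (hM : M.InjVert) (t : M.T) (i : ZMod 5) (p : Pentagon) :
    M.weight (Sum.inl (M.vert t i)) (M.pt t p) = wt i p := evP_single_inl hM t p i

theorem weight_centre (t : M.T) (p : Pentagon) : M.weight (Sum.inr t) (M.pt t p) = ctr p := by
  classical
  unfold weight
  rw [ev_pt, evP_single_inr, if_pos rfl]

theorem weight_centre_ne {t t' : M.T} (h : t' ≠ t) (p : Pentagon) :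
    M.weight (Sum.inr t) (M.pt t' p) = 0 := by
  classical
  unfold weight
  rw [ev_pt, evP_single_inr, if_neg h]

theorem exists_of_weight_pos (hM : M.InjVert) {t : M.T} {p : Pentagon} {v : M.V}
    (h : 0 < M.weight (Sum.inl v) (M.pt t p)) : ∃ i, M.vert t i = v ∧ 0 < wt i p := by
  classical
  by_cases hv : ∃ i, M.vert t i = v
  · obtain ⟨i, rfl⟩ := hv
    rw [weight_vert hM] at h
    exact ⟨i, rfl, h⟩
  · push Not at hv
    unfold weight at h
    rw [ev_pt, evP_single_inl_of_notMem hv] at h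
    exact absurd h (lt_irrefl 0)

/-- Dividing the weights of the corners by that of the centre inverts `radial`. The weights are
continuous on the glued space, so the continuity of the inverse is immediate. -/
theorem isOpenEmbedding_tile (hM : M.InjVert) (t : M.T) :
    IsOpenEmbedding (fun z => M.pt t (radial z)) ∧
      range (fun z => M.pt t (radial z)) = {x | 0 < M.weight (Sum.inr t) x} := by
  have hpos : ∀ z, 0 < 1 + ∑ i, wt i z := fun z => by linarith [sum_wt_nonneg z]
  refine isOpenEmbedding_of_leftInverse (g := fun x => ∑ i,
    ((M.weight (Sum.inl (M.vert t i)) x / M.weight (Sum.inr t) x : ℝ) : ℂ) * cornerC i)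
    ((M.continuous_pt t).comp continuous_radial) ?_ ?_ ?_ ?_ ?_
  · exact isOpen_lt continuous_const (continuous_weight _)
  · refine continuousOn_finsetSum _ fun i _ => ContinuousOn.mul
      (Complex.continuous_ofReal.comp_continuousOn ?_) continuousOn_const
    exact (continuous_weight _).continuousOn.div (continuous_weight _).continuousOn
      fun x (hx : 0 < M.weight (Sum.inr t) x) => hx.ne'
  · intro z
    change 0 < M.weight _ _
    rw [weight_centre, ctr_radial]
    exact inv_pos.2 (hpos z)
  · intro z
    simp only [weight_centre, weight_vert hM, ctr_radial, wt_radial]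
    have : ∀ i, (1 + ∑ i, wt i z)⁻¹ * wt i z / (1 + ∑ i, wt i z)⁻¹ = wt i z := fun i =>
      mul_div_cancel_left₀ _ (inv_pos.2 (hpos z)).ne'
    simp only [this]
    exact sum_wt_mul z
  · intro y hy
    obtain ⟨t', p, rfl⟩ := M.exists_pt y
    by_cases ht : t' = t
    swap
    · rw [mem_ofPred_eq, weight_centre_ne ht] at hy
      exact absurd hy (lt_irrefl 0)
    subst ht
    simp only [mem_ofPred_eq, weight_centre, weight_vert hM] at hy ⊢
    congr 1
    have e : ∑ i, ((wt i p / ctr p : ℝ) : ℂ) * cornerC i = (((ctr p)⁻¹ : ℝ) : ℂ) * p := by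
      rw [← sum_wt_mul p, Finset.mul_sum]
      refine Finset.sum_congr rfl fun i _ => ?_
      rw [sum_wt_mul, div_eq_inv_mul, Complex.ofReal_mul, mul_assoc]
    apply pentagon_ext
    intro k
    rw [wt_radial, e]
    simp only [wt_smul _ (inv_nonneg.2 hy.le), ← Finset.mul_sum]
    have h1 : ∑ i, wt i (p : ℂ) = 1 - ctr p := by unfold ctr; ring
    rw [h1]
    field_simp
    ring

end PentComplex

/-! ### The open star of a vertex -/

/-- The point of the pentagon near the corner `i` with coordinates `x` and `y`. -/
def starPt (i : ZMod 5) (x y : ℝ) (hx : 0 ≤ x) (hy : 0 ≤ y) : Pentagon :=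
  -- With `m = min x y`, the weights of the corners `i`, `i + 1`, `i - 1` and of the centre are in
  -- the ratio `1 : x - m : y - m : m`. The axes become the two edges at `i` and the diagonal
  -- becomes the segment to the centre.
  ⟨(((1 + x + y - min x y)⁻¹ : ℝ) : ℂ) * (cornerC i + (((x - min x y : ℝ) : ℂ) * cornerC (i + 1) +
    ((y - min x y : ℝ) : ℂ) * cornerC (i - 1))), by
    rcases le_total x y with h | h
    · rw [min_eq_left h]
      have := cone_mem_pentagon (i := i) (j := i - 1) (x := (1 + x + y - x)⁻¹)
        (y := (1 + x + y - x)⁻¹ * (y - x)) (inv_nonneg.2 (by linarith))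
        (mul_nonneg (inv_nonneg.2 (by linarith)) (by linarith))
        (by rw [← mul_one_add, inv_mul_le_iff₀ (by linarith)]; linarith)
      convert this using 1
      push_cast; ring
    · rw [min_eq_right h]
      have := cone_mem_pentagon (i := i) (j := i + 1) (x := (1 + x + y - y)⁻¹)
        (y := (1 + x + y - y)⁻¹ * (x - y)) (inv_nonneg.2 (by linarith))
        (mul_nonneg (inv_nonneg.2 (by linarith)) (by linarith))
        (by rw [← mul_one_add, inv_mul_le_iff₀ (by linarith)]; linarith)
      convert this using 1
      push_cast; ring⟩

theorem starPt_den_pos {x y : ℝ} (_hx : 0 ≤ x) (hy : 0 ≤ y) : 0 < 1 + x + y - min x y := by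
  have := min_le_left x y
  linarith

theorem wt_starPt (i : ZMod 5) (x y : ℝ) (hx : 0 ≤ x) (hy : 0 ≤ y) (k : ZMod 5) :
    wt k (starPt i x y hx hy) = (1 + x + y - min x y)⁻¹ * ((if k = i then 1 else 0) +
      (if k = i + 1 then x - min x y else 0) + (if k = i - 1 then y - min x y else 0)) := by
  change wt k ((((1 + x + y - min x y)⁻¹ : ℝ) : ℂ) * _) = _
  rw [wt_smul _ (inv_nonneg.2 (starPt_den_pos hx hy).le)]
  congr 1
  rcases le_total x y with h | h
  · rw [min_eq_left h]
    have := wt_cone_unit (j := i) zero_le_one (sub_nonneg.2 h) (-1) k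
    simp only [Units.val_neg, Units.val_one, Int.cast_neg, Int.cast_one, ← sub_eq_add_neg,
      Complex.ofReal_one, one_mul] at this
    rw [sub_self, Complex.ofReal_zero, zero_mul, zero_add, this]
    simp
  · rw [min_eq_right h]
    have := wt_cone_unit (j := i) zero_le_one (sub_nonneg.2 h) 1 k
    simp only [Units.val_one, Int.cast_one, Complex.ofReal_one, one_mul] at this
    rw [sub_self, Complex.ofReal_zero, zero_mul, add_zero, this]
    simp

theorem ctr_starPt (i : ZMod 5) (x y : ℝ) (hx : 0 ≤ x) (hy : 0 ≤ y) :
    ctr (starPt i x y hx hy) = (1 + x + y - min x y)⁻¹ * min x y := by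
  have h := starPt_den_pos hx hy
  unfold ctr
  simp only [wt_starPt, ← Finset.mul_sum, Finset.sum_add_distrib, Finset.sum_ite_eq',
    Finset.mem_univ, if_true]
  field_simp
  ring

theorem continuous_starPt {X : Type*} [TopologicalSpace X] (i : ZMod 5) {a b : X → ℝ}
    (ha : Continuous a) (hb : Continuous b) (ha' : ∀ x, 0 ≤ a x) (hb' : ∀ x, 0 ≤ b x) :
    Continuous fun x => starPt i (a x) (b x) (ha' x) (hb' x) := by
  refine Continuous.subtype_mk ((Complex.continuous_ofReal.comp ?_).mul ?_) _
  · refine Continuous.inv₀ (((continuous_const.add ha).add hb).sub (ha.min hb)) fun x => ?_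
    exact (starPt_den_pos (ha' x) (hb' x)).ne'
  · exact continuous_const.add (((Complex.continuous_ofReal.comp (ha.sub (ha.min hb))).mul
      continuous_const).add ((Complex.continuous_ofReal.comp (hb.sub (ha.min hb))).mul
      continuous_const))

namespace Fan

variable {d : ℕ} (F : Fan d)

theorem coord_nonneg (k : ZMod d) (z : ℂ) : 0 ≤ F.coord k z := by
  obtain ⟨j, x, y, hx, hy, rfl⟩ := F.exists_cone z
  rw [F.coord_cone j x y hx hy]
  split_ifs <;> linarith

theorem exists_eq_coord (hd : (1 : ZMod d) ≠ 0) (z : ℂ) : ∃ j,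
    z = (F.coord j z : ℂ) * F.ray j + (F.coord (j + 1) z : ℂ) * F.ray (j + 1) ∧
    ∀ k, k ≠ j → k ≠ j + 1 → F.coord k z = 0 := by
  obtain ⟨j, x, y, hx, hy, rfl⟩ := F.exists_cone z
  refine ⟨j, ?_, fun k h1 h2 => ?_⟩
  · rw [F.coord_cone j x y hx hy, F.coord_cone j x y hx hy]
    simp [hd]
  · rw [F.coord_cone j x y hx hy, if_neg h1, if_neg h2, add_zero]

end Fan

namespace PentComplex

variable {M : PentComplex} {v : M.V} {d : ℕ}

namespace Star

variable (S : M.Star v d)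

theorem tl_injective (hM : M.InjVert) : Function.Injective S.tl := by
  intro k l h
  apply S.nb_injective
  have : S.ix k = S.ix l := hM (S.tl k) (by rw [S.vert_ix, h, S.vert_ix])
  rw [← S.vert_next, ← S.vert_next, h, this]

/-- The point of the tile `k` of the star with coordinates `x` and `y`. -/
def pt (k : ZMod d) (x y : ℝ) (hx : 0 ≤ x) (hy : 0 ≤ y) : M.Space :=
  M.pt (S.tl k) (starPt (S.ix k) x y hx hy)

theorem ev_pt (H : M.V ⊕ M.T → ℝ) (k : ZMod d) (x y : ℝ) (hx : 0 ≤ x) (hy : 0 ≤ y) :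
    M.ev H (S.pt k x y hx hy) = (1 + x + y - min x y)⁻¹ * (H (Sum.inl v) +
      (x - min x y) * H (Sum.inl (S.nb k)) + (y - min x y) * H (Sum.inl (S.nb (k + 1))) +
      min x y * H (Sum.inr (S.tl k))) := by
  unfold Star.pt
  rw [PentComplex.ev_pt]
  unfold evP
  simp only [wt_starPt, ctr_starPt, mul_add, add_mul, mul_ite, ite_mul, mul_zero, zero_mul,
    Finset.sum_add_distrib, Finset.sum_ite_eq', Finset.mem_univ, if_true, S.vert_ix, S.vert_next,
    S.vert_prev]
  ring

variable [Fact (2 < d)]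

theorem one_ne : (1 : ZMod d) ≠ 0 := by
  have : Fact (1 < d) := ⟨by have := Fact.out (p := 2 < d); omega⟩
  exact one_ne_zero

theorem two_ne : (1 + 1 : ZMod d) ≠ 0 := by
  have h := Fact.out (p := 2 < d)
  intro e
  have : ((2 : ℕ) : ZMod d) = 0 := by push_cast; rw [← e]; norm_num
  rw [ZMod.natCast_eq_zero_iff] at this
  have := Nat.le_of_dvd (by norm_num) this
  omega

instance : NeZero d := ⟨by have := Fact.out (p := 2 < d); omega⟩

/-- The value at a point of the star, in terms of the coordinates of the fan. -/
theorem ev_pt_eq_sum (H : M.V ⊕ M.T → ℝ) (k : ZMod d) (X : ZMod d → ℝ) (hX : ∀ j, 0 ≤ X j)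
    (h0 : ∀ j, j ≠ k → j ≠ k + 1 → X j = 0) :
    M.ev H (S.pt k (X k) (X (k + 1)) (hX _) (hX _)) =
      (1 + ∑ j, X j - ∑ j, min (X j) (X (j + 1)))⁻¹ * (H (Sum.inl v) +
      ∑ j, (X j - min (X j) (X (j + 1)) - min (X (j - 1)) (X j)) * H (Sum.inl (S.nb j)) +
      ∑ j, min (X j) (X (j + 1)) * H (Sum.inr (S.tl j))) := by
  -- At most `X k` and `X (k + 1)` are non-zero, and `k + 2 ≠ k` because `d > 2`; so only the
  -- minimum at `k` survives. The formula to be proved is written as sums over the whole cycle so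
  -- that it does not depend on `k`.
  have hm : ∀ j, min (X j) (X (j + 1)) = if j = k then min (X k) (X (k + 1)) else 0 := by
    intro j
    split_ifs with h
    · rw [h]
    by_cases h1 : j = k + 1
    · subst h1
      rw [h0 (k + 1 + 1) (by rw [add_assoc]; simpa using two_ne) (by simpa using one_ne)]
      exact min_eq_right (hX _)
    · rw [h0 j h h1]
      exact min_eq_left (hX _)
  have hm' : ∀ j, min (X (j - 1)) (X j) = if j = k + 1 then min (X k) (X (k + 1)) else 0 := by
    intro j
    have := hm (j - 1)
    rw [sub_add_cancel] at this
    rw [this]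
    simp only [sub_eq_iff_eq_add]
  have hx : ∀ j, X j = (if j = k then X k else 0) + (if j = k + 1 then X (k + 1) else 0) := by
    intro j
    by_cases h1 : j = k
    · subst h1
      simp [one_ne]
    · by_cases h2 : j = k + 1
      · subst h2
        simp [one_ne]
      · rw [h0 j h1 h2]
        simp [h1, h2]
  have e1 : ∑ j, X j = X k + X (k + 1) := by
    rw [Finset.sum_congr rfl fun j _ => hx j]
    simp [Finset.sum_add_distrib]
  have e2 : ∑ j, (X j - min (X j) (X (j + 1)) - min (X (j - 1)) (X j)) * H (Sum.inl (S.nb j)) =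
      (X k - min (X k) (X (k + 1))) * H (Sum.inl (S.nb k)) +
        (X (k + 1) - min (X k) (X (k + 1))) * H (Sum.inl (S.nb (k + 1))) := by
    have : ∀ j, (X j - min (X j) (X (j + 1)) - min (X (j - 1)) (X j)) * H (Sum.inl (S.nb j)) =
        (if j = k then (X k - min (X k) (X (k + 1))) * H (Sum.inl (S.nb j)) else 0) +
        (if j = k + 1 then (X (k + 1) - min (X k) (X (k + 1))) * H (Sum.inl (S.nb j)) else 0) := by
      intro j
      rw [hm, hm', hx j]
      split_ifs <;> ring
    rw [Finset.sum_congr rfl fun j _ => this j]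
    simp only [Finset.sum_add_distrib, Finset.sum_ite_eq', Finset.mem_univ, if_true]
  have e3 : ∑ j, min (X j) (X (j + 1)) = min (X k) (X (k + 1)) := by
    rw [Finset.sum_congr rfl fun j _ => hm j, Finset.sum_ite_eq', if_pos (Finset.mem_univ _)]
  have e4 : ∑ j, min (X j) (X (j + 1)) * H (Sum.inr (S.tl j)) =
      min (X k) (X (k + 1)) * H (Sum.inr (S.tl k)) := by
    rw [Finset.sum_eq_single k (fun j _ h => by rw [hm, if_neg h, zero_mul])
      (fun h => absurd (Finset.mem_univ _) h)]
  rw [S.ev_pt, e1, e2, e3, e4]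
  ring

variable (F : Fan d)

/-- The open star of a vertex as an image of the plane. -/
def disc (z : ℂ) : M.Space :=
  S.pt (F.exists_eq_coord one_ne z).choose _ _
    (F.coord_nonneg (F.exists_eq_coord one_ne z).choose z)
    (F.coord_nonneg ((F.exists_eq_coord one_ne z).choose + 1) z)

/-- The cone chosen in `disc` is immaterial: the value in `ev_pt_eq_sum` is independent of it, and
the functions `ev` separate points. -/
theorem disc_eq (hM : M.InjVert) (z : ℂ) (k : ZMod d)
    (hk : ∀ j, j ≠ k → j ≠ k + 1 → F.coord j z = 0) :
    S.disc F z = S.pt k _ _ (F.coord_nonneg k z) (F.coord_nonneg (k + 1) z) := by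
  refine eq_of_ev hM fun H => ?_
  unfold disc
  rw [S.ev_pt_eq_sum H _ (fun j => F.coord j z) (fun j => F.coord_nonneg j z)
    (F.exists_eq_coord one_ne z).choose_spec.2,
    S.ev_pt_eq_sum H _ (fun j => F.coord j z) (fun j => F.coord_nonneg j z) hk]

/-- The sets on which one cone may be used form a finite closed cover of the plane. -/
theorem continuous_disc (hM : M.InjVert) : Continuous (S.disc F) := by
  refine LocallyFinite.continuous (f := fun k => {z | ∀ j, j ≠ k → j ≠ k + 1 → F.coord j z = 0})
    (locallyFinite_of_finite _) ?_ ?_ ?_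
  · rw [eq_univ_iff_forall]
    intro z
    obtain ⟨j, -, hj⟩ := F.exists_eq_coord one_ne z
    exact mem_iUnion.2 ⟨j, hj⟩
  · intro k
    simp only [ofPred_forall]
    exact isClosed_iInter fun j => isClosed_iInter fun _ => isClosed_iInter fun _ =>
      isClosed_eq (F.cont j) continuous_const
  · intro k
    refine ContinuousOn.congr (f := fun z => S.pt k _ _ (F.coord_nonneg k z)
      (F.coord_nonneg (k + 1) z)) ?_ fun z hz => S.disc_eq F hM z k hz
    exact ((M.continuous_pt _).comp (continuous_starPt _ (F.cont k) (F.cont (k + 1)) _ _)).continuousOn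

theorem weight_centre_pt (hM : M.InjVert) (k : ZMod d) (x y : ℝ) (hx : 0 ≤ x) (hy : 0 ≤ y)
    (j : ZMod d) : M.weight (Sum.inr (S.tl j)) (S.pt k x y hx hy) =
      if j = k then (1 + x + y - min x y)⁻¹ * min x y else 0 := by
  classical
  unfold weight
  rw [S.ev_pt]
  simp [Pi.single_apply, (S.tl_injective hM).eq_iff, eq_comm]

theorem nb_ne (hM : M.InjVert) (k : ZMod d) : S.nb k ≠ v :=
  fun h => add_one_ne_self _ (hM (S.tl k) ((S.vert_next k).trans (h.trans (S.vert_ix k).symm)))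

theorem weight_pt (hM : M.InjVert) (k : ZMod d) (x y : ℝ) (hx : 0 ≤ x) (hy : 0 ≤ y) :
    M.weight (Sum.inl v) (S.pt k x y hx hy) = (1 + x + y - min x y)⁻¹ := by
  classical
  unfold weight
  rw [S.ev_pt]
  simp [S.nb_ne hM]

theorem weight_nb_pt (hM : M.InjVert) (k : ZMod d) (x y : ℝ) (hx : 0 ≤ x) (hy : 0 ≤ y)
    (j : ZMod d) : M.weight (Sum.inl (S.nb j)) (S.pt k x y hx hy) = (1 + x + y - min x y)⁻¹ *
      ((if j = k then x - min x y else 0) + (if j = k + 1 then y - min x y else 0)) := by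
  classical
  unfold weight
  rw [S.ev_pt]
  simp [Pi.single_apply, S.nb_injective.eq_iff, (S.nb_ne hM _).symm, eq_comm]

/-- The coordinates of a point of the open star. -/
def coordOf (x : M.Space) (j : ZMod d) : ℝ :=
  (M.weight (Sum.inl (S.nb j)) x + M.weight (Sum.inr (S.tl j)) x +
    M.weight (Sum.inr (S.tl (j - 1))) x) / M.weight (Sum.inl v) x

theorem coordOf_pt (hM : M.InjVert) (k : ZMod d) (x y : ℝ) (hx : 0 ≤ x) (hy : 0 ≤ y)
    (j : ZMod d) : S.coordOf (S.pt k x y hx hy) j =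
      (if j = k then x else 0) + (if j = k + 1 then y else 0) := by
  unfold coordOf
  rw [S.weight_nb_pt hM, S.weight_centre_pt hM, S.weight_centre_pt hM, S.weight_pt hM]
  have := starPt_den_pos hx hy
  simp only [sub_eq_iff_eq_add]
  split_ifs <;> field_simp <;> ring

theorem exists_pt_of_weight_pos (hM : M.InjVert) {x : M.Space}
    (h : 0 < M.weight (Sum.inl v) x) : ∃ k a b ha hb, x = S.pt k a b ha hb := by
  obtain ⟨t, p, rfl⟩ := M.exists_pt x
  obtain ⟨i, hv, hi⟩ := exists_of_weight_pos hM h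
  obtain ⟨k, rfl, rfl⟩ := S.complete t i hv
  -- A point with positive weight at a corner lies in one of the two cones at that corner, so one of
  -- the adjacent weights `b`, `c` vanishes.
  obtain ⟨a, b, c, ha, hb, hc, hbc, hw⟩ : ∃ a b c : ℝ, 0 < a ∧ 0 ≤ b ∧ 0 ≤ c ∧ (b = 0 ∨ c = 0) ∧
      ∀ l, wt l p = (if l = S.ix k then a else 0) + (if l = S.ix k + 1 then b else 0) +
        (if l = S.ix k - 1 then c else 0) := by
    obtain ⟨j, x, y, hx, hy, hxy, rfl⟩ := exists_conePt p
    rw [wt_conePt] at hi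
    by_cases h1 : S.ix k = j
    · subst h1
      simp (decide := true) at hi
      exact ⟨x, y, 0, hi, hy, le_rfl, Or.inr rfl, fun l => by rw [wt_conePt]; simp⟩
    · rw [if_neg h1, zero_add] at hi
      by_cases h2 : S.ix k = j + 1
      · rw [if_pos h2] at hi
        refine ⟨y, 0, x, hi, le_rfl, hx, Or.inl rfl, fun l => ?_⟩
        rw [wt_conePt, h2]
        simp [add_comm]
      · rw [if_neg h2] at hi
        exact absurd hi (lt_irrefl 0)
  have he : ctr p = 1 - a - b - c := by
    unfold ctr
    simp only [hw, Finset.sum_add_distrib, Finset.sum_ite_eq', Finset.mem_univ, if_true]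
    ring
  have he' := ctr_nonneg p
  rw [he] at he'
  have hm : min ((1 - a - c) / a) ((1 - a - b) / a) = (1 - a - b - c) / a := by
    rw [min_div_div_right ha.le]
    congr 1
    rcases hbc with rfl | rfl
    · rw [min_eq_left] <;> linarith
    · rw [min_eq_right] <;> linarith
  -- The weights add up to one, so `1 - a - c` is `b` plus the weight of the centre, and `1 - a - b`
  -- is `c` plus that weight. Dividing by `a` gives the ratios of `starPt`.
  refine ⟨k, (1 - a - c) / a, (1 - a - b) / a, div_nonneg (by linarith) ha.le,
    div_nonneg (by linarith) ha.le, ?_⟩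
  unfold Star.pt
  congr 1
  apply pentagon_ext
  intro l
  rw [wt_starPt, hw, hm]
  have e1 : 1 + (1 - a - c) / a + (1 - a - b) / a - (1 - a - b - c) / a = a⁻¹ := by
    field_simp; ring
  have e2 : (1 - a - c) / a - (1 - a - b - c) / a = b / a := by ring
  have e3 : (1 - a - b) / a - (1 - a - b - c) / a = c / a := by ring
  rw [e1, e2, e3, inv_inv]
  simp only [mul_add, mul_ite, mul_one, mul_zero, mul_div_cancel₀ _ ha.ne']

theorem isOpenEmbedding_disc (hM : M.InjVert) : IsOpenEmbedding (S.disc F) ∧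
    range (S.disc F) = {x | 0 < M.weight (Sum.inl v) x} := by
  have hray : ∀ (k : ZMod d) (a b : ℝ), ∑ j, (((if j = k then a else 0) +
      (if j = k + 1 then b else 0) : ℝ) : ℂ) * F.ray j =
      (a : ℂ) * F.ray k + (b : ℂ) * F.ray (k + 1) := by
    intro k a b
    simp [add_mul, Finset.sum_add_distrib, apply_ite (fun r : ℝ => (r : ℂ))]
  refine isOpenEmbedding_of_leftInverse (g := fun x => ∑ j, (S.coordOf x j : ℂ) * F.ray j)
    (S.continuous_disc F hM) (isOpen_lt continuous_const (continuous_weight _)) ?_ ?_ ?_ ?_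
  · refine continuousOn_finsetSum _ fun j _ => ContinuousOn.mul
      (Complex.continuous_ofReal.comp_continuousOn ?_) continuousOn_const
    exact ((((continuous_weight _).add (continuous_weight _)).add
      (continuous_weight _)).continuousOn).div (continuous_weight _).continuousOn
      fun x (hx : 0 < M.weight (Sum.inl v) x) => hx.ne'
  · intro z
    change 0 < M.weight _ _
    unfold disc
    rw [S.weight_pt hM]
    exact inv_pos.2 (starPt_den_pos (F.coord_nonneg _ _) (F.coord_nonneg _ _))
  · intro z
    obtain ⟨k, hz, hk⟩ := F.exists_eq_coord one_ne z
    rw [S.disc_eq F hM z k hk]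
    simp only [S.coordOf_pt hM]
    rw [hray, ← hz]
  · intro x hx
    obtain ⟨k, a, b, ha, hb, rfl⟩ := S.exists_pt_of_weight_pos hM hx
    simp only [S.coordOf_pt hM]
    rw [hray]
    have h1 := F.coord_cone k a b ha hb
    rw [S.disc_eq F hM _ k fun j h h' => by rw [h1, if_neg h, if_neg h', add_zero]]
    congr 1
    · rw [h1]; simp [one_ne]
    · rw [h1]; simp [one_ne]

end Star

/-- The open star of a vertex or of a tile is an open disc. -/
theorem exists_disc (hM : M.InjVert) (hF : ∀ t i, M.Full (M.vert t i)) (z : M.V ⊕ M.T)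
    (hz : ∀ v, z = Sum.inl v → ∃ t i, M.vert t i = v) :
    ∃ ψ : ℂ → M.Space, IsOpenEmbedding ψ ∧ range ψ = {x | 0 < M.weight z x} := by
  rcases z with v | t
  · obtain ⟨t, i, rfl⟩ := hz v rfl
    rcases hF t i with ⟨⟨S⟩⟩ | ⟨⟨S⟩⟩
    · have : Fact (2 < 3) := ⟨by norm_num⟩
      exact ⟨_, S.isOpenEmbedding_disc tripodFan hM⟩
    · have : Fact (2 < 4) := ⟨by norm_num⟩
      exact ⟨_, S.isOpenEmbedding_disc quadrantFan hM⟩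
  · exact ⟨_, isOpenEmbedding_tile hM t⟩

end PentComplex

end PentHull
namespace PentHull

open PentComplex Topology

namespace PentComplex

variable {M : PentComplex}

/-! ## Oscillation of piecewise linear functions -/

/-- The function `H` oscillates by at most `κ` on the triangles of every tile. -/
def Osc (M : PentComplex) (H : M.V ⊕ M.T → ℝ) (κ : ℝ) : Prop :=
  ∀ t i, |H (Sum.inl (M.vert t i)) - H (Sum.inr t)| ≤ κ ∧
    |H (Sum.inl (M.vert t i)) - H (Sum.inl (M.vert t (i + 1)))| ≤ κ

/-- The extreme case is the centre of a corner tile against the new vertex `(t, i - 1)`: with values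
`a`, `b` at the corners `i`, `i - 1` and `c` at the large centre the difference is `(a - b) / 2 + (a
- c) / 4`. -/
theorem Osc.subdiv {H : M.V ⊕ M.T → ℝ} {κ : ℝ} (h : M.Osc H κ) :
    M.subdiv.Osc (subH H) (3 / 4 * κ) := by
  have e : ∀ i : ZMod 5, i - 1 + 1 = i := fun i => sub_add_cancel i 1
  rintro ⟨t, _ | i⟩ k
  · obtain ⟨h1, h2⟩ := h t k
    simp only [subdiv_vert_none, subH_new, subH_none]
    rw [abs_le] at h1 h2 ⊢
    rw [abs_le]
    exact ⟨⟨by linarith, by linarith⟩, ⟨by linarith, by linarith⟩⟩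
  · obtain ⟨h1, h2⟩ := h t i
    obtain ⟨h3, h4⟩ := h t (i - 1)
    obtain ⟨h5, h6⟩ := h t (i + 1)
    rw [e] at h4
    rw [abs_le] at h1 h2 h3 h4 h5
    rcases zmod5_cases k with rfl | rfl | rfl | rfl | rfl
    · rw [zero_add]
      simp only [subdiv_vert_zero, subdiv_vert_one, subH_old, subH_mid, subH_some]
      rw [abs_le, abs_le]
      exact ⟨⟨by linarith, by linarith⟩, ⟨by linarith, by linarith⟩⟩
    · rw [show (1 : ZMod 5) + 1 = 2 from rfl]
      simp only [subdiv_vert_one, subdiv_vert_two, subH_new, subH_mid, subH_some]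
      rw [abs_le, abs_le]
      exact ⟨⟨by linarith, by linarith⟩, ⟨by linarith, by linarith⟩⟩
    · rw [show (2 : ZMod 5) + 1 = 3 from rfl]
      simp only [subdiv_vert_two, subdiv_vert_three, subH_new, subH_some]
      rw [abs_le, abs_le]
      exact ⟨⟨by linarith, by linarith⟩, ⟨by linarith, by linarith⟩⟩
    · rw [show (3 : ZMod 5) + 1 = 4 from rfl]
      simp only [subdiv_vert_three, subdiv_vert_four, subH_new, subH_mid, subH_some]
      rw [abs_le, abs_le]
      exact ⟨⟨by linarith, by linarith⟩, ⟨by linarith, by linarith⟩⟩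
    · rw [show (4 : ZMod 5) + 1 = 0 from rfl]
      simp only [subdiv_vert_zero, subdiv_vert_four, subH_old, subH_mid, subH_some]
      rw [abs_le, abs_le]
      exact ⟨⟨by linarith, by linarith⟩, ⟨by linarith, by linarith⟩⟩

theorem Osc.comap {L : PentComplex} (f : L.Hom M) {H : M.V ⊕ M.T → ℝ} {κ : ℝ} (h : M.Osc H κ) :
    L.Osc (H ∘ Sum.map f.onV f.onT) κ := by
  intro t i
  simp only [Function.comp, Sum.map_inl, Sum.map_inr, f.compat]
  exact h _ _

theorem Osc.abs_evP_sub_le {H : M.V ⊕ M.T → ℝ} {κ : ℝ} (h : M.Osc H κ) (t : M.T) (p : Pentagon) :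
    |M.evP H t p - H (Sum.inr t)| ≤ κ := by
  obtain ⟨j, x, y, hx, hy, hxy, rfl⟩ := exists_conePt p
  rw [evP_conePt]
  have h1 := abs_le.1 (h t j).1
  have h2 := abs_le.1 (h t (j + 1)).1
  have hκ : 0 ≤ κ := (abs_nonneg _).trans (h t j).1
  rw [abs_le]
  constructor <;> nlinarith

/-- A step to an adjacent tile passes from a centre to a common vertex and on to the other centre, a
change of at most `κ` each. -/
theorem Osc.abs_sub_le_of_inBall {H : M.V ⊕ M.T → ℝ} {κ : ℝ} (h : M.Osc H κ) {t₀ t : M.T} {n : ℕ}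
    (ht : M.InBall t₀ n t) : |H (Sum.inr t) - H (Sum.inr t₀)| ≤ 2 * n * κ := by
  induction ht with
  | base => simp
  | @step n t t' _ h2 ih =>
    obtain ⟨i, j, e⟩ := h2
    have h3 := (h t i).1
    have h4 := (h t' j).1
    rw [e] at h3
    push_cast
    rw [abs_le] at *
    constructor <;> linarith

theorem osc_single [DecidableEq (M.V ⊕ M.T)] (z : M.V ⊕ M.T) : M.Osc (Pi.single z 1) 1 := by
  have : ∀ a, 0 ≤ (Pi.single z 1 : M.V ⊕ M.T → ℝ) a ∧ (Pi.single z 1 : M.V ⊕ M.T → ℝ) a ≤ 1 := by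
    intro a
    rw [Pi.single_apply]
    split_ifs <;> norm_num
  intro t i
  have h1 := this (Sum.inl (M.vert t i))
  have h2 := this (Sum.inr t)
  have h3 := this (Sum.inl (M.vert t (i + 1)))
  rw [abs_le, abs_le]
  exact ⟨⟨by linarith, by linarith⟩, ⟨by linarith, by linarith⟩⟩

/-- The three weights of a point in its triangle add up to one. -/
theorem exists_weight_ge (hM : M.InjVert) (x : M.Space) :
    ∃ z : M.V ⊕ M.T, (∀ v, z = Sum.inl v → ∃ t i, M.vert t i = v) ∧ 1 / 3 ≤ M.weight z x := by
  obtain ⟨t, p, rfl⟩ := M.exists_pt x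
  obtain ⟨j, x, y, hx, hy, hxy, rfl⟩ := exists_conePt p
  by_cases h1 : 1 / 3 ≤ x
  · refine ⟨Sum.inl (M.vert t j), by rintro v ⟨⟩; exact ⟨_, _, rfl⟩, ?_⟩
    rw [weight_vert hM, wt_conePt, if_pos rfl]
    split_ifs <;> linarith
  by_cases h2 : 1 / 3 ≤ y
  · refine ⟨Sum.inl (M.vert t (j + 1)), by rintro v ⟨⟩; exact ⟨_, _, rfl⟩, ?_⟩
    rw [weight_vert hM, wt_conePt, if_pos (rfl : j + 1 = j + 1)]
    split_ifs <;> linarith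
  · refine ⟨Sum.inr t, by rintro v ⟨⟩, ?_⟩
    rw [weight_centre, ctr_conePt]
    linarith

theorem inBall_one_of_weight_pos (hM : M.InjVert) {z : M.V ⊕ M.T} {t t' : M.T} {p p' : Pentagon}
    (h : 0 < M.weight z (M.pt t p)) (h' : 0 < M.weight z (M.pt t' p')) : M.InBall t 1 t' := by
  refine InBall.base.step ?_
  rcases z with v | u
  · obtain ⟨i, hi, -⟩ := exists_of_weight_pos hM h
    obtain ⟨j, hj, -⟩ := exists_of_weight_pos hM h'
    exact ⟨i, j, hi.trans hj.symm⟩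
  · have e1 : t = u := by
      by_contra hne
      rw [weight_centre_ne hne] at h
      exact lt_irrefl 0 h
    have e2 : t' = u := by
      by_contra hne
      rw [weight_centre_ne hne] at h'
      exact lt_irrefl 0 h'
    rw [e1, e2]
    exact Adj.refl u

theorem adj_subdiv_none (t : M.T) (j : Option (ZMod 5)) : M.subdiv.Adj (t, none) (t, j) := by
  cases j with
  | none => exact Adj.refl _
  | some i => exact ⟨i, 2, rfl⟩

/-- The chain runs from the central tile to the corner tile at the common vertex, to the corner tile
on the other side, and to the other central tile. -/
theorem Adj.inBall_subdiv {t t' : M.T} (h : M.Adj t t') :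
    M.subdiv.InBall (t, none) 3 (t', none) := by
  obtain ⟨i, j, h⟩ := h
  refine ((InBall.base.step (adj_subdiv_none t (some i))).step ?_).step
    (adj_subdiv_none t' (some j)).symm
  exact ⟨0, 0, congrArg oldV h⟩

theorem InBall.subdiv {t t' : M.T} {n : ℕ} (h : M.InBall t n t') (j j' : Option (ZMod 5)) :
    M.subdiv.InBall (t, j) (3 * n + 2) (t', j') := by
  have : M.subdiv.InBall (t, none) (3 * n) (t', none) := by
    induction h with
    | base => exact InBall.base
    | step _ h2 ih => exact ih.trans h2.inBall_subdiv
  have := ((InBall.base.step (adj_subdiv_none t j).symm).trans this).step (adj_subdiv_none t' j')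
  exact this.mono (by omega)

theorem InBall.comap {L : PentComplex} {f : L.Hom M} (hV : Function.Injective f.onV)
    (hT : Function.Bijective f.onT) {n : ℕ} {t t' : L.T} (h : M.InBall (f.onT t) n (f.onT t')) :
    L.InBall t n t' := by
  generalize hu : f.onT t' = u at h
  induction h generalizing t' with
  | base =>
    rw [hT.1 hu]
    exact InBall.base
  | @step n s u _ h2 ih =>
    obtain ⟨s', rfl⟩ := hT.2 s
    obtain ⟨i, j, h2⟩ := h2
    refine (ih rfl).step ⟨i, j, hV ?_⟩
    rw [f.compat, f.compat, h2, hu]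

end PentComplex

/-! ## The inflation homeomorphism of `K` -/

theorem desub_inj : desub.toTMap.Inj :=
  ⟨desub_injective.2, fun _ _ _ _ h => desub_injective.1 h⟩

/-- The map of the space of `K` that carries the tiles into the tiles of the preceding level. -/
def deflate (x : K.Space) : K.Space := subMap K_injVert (desub.toTMap.map x)

/-- The tile of the preceding level. -/
def par (t : K.T) : K.T := (desub.onT t).1

theorem deflate_pt (t : K.T) (p : Pentagon) : ∃ q, deflate (K.pt t p) = K.pt (par t) q :=
  ⟨_, subMap_pt K_injVert _ _ _⟩

/-- The values of a deflated piecewise linear function. -/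
def deflateH (H : K.V ⊕ K.T → ℝ) : K.V ⊕ K.T → ℝ := subH H ∘ Sum.map desub.onV desub.onT

theorem ev_deflate (H : K.V ⊕ K.T → ℝ) (x : K.Space) :
    K.ev H (deflate x) = K.ev (deflateH H) x := by
  unfold deflate
  rw [ev_subMap, TMap.ev_map]
  rfl

theorem osc_deflateH {H : K.V ⊕ K.T → ℝ} {κ : ℝ} (h : K.Osc H κ) :
    K.Osc (deflateH H) (3 / 4 * κ) := h.subdiv.comap desub

/-- As `desub` is a bijection on tiles and injective on vertices, it induces an open bijection of
the spaces; `subHomeo` does the rest. -/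
theorem isHomeomorph_deflate : IsHomeomorph deflate := by
  have hd : IsOpenMap desub.toTMap.map := fun O hO =>
    desub_inj.isOpen_image K_injVert.subdiv hO fun t _ _ => desub_onT_surjective t
  have hs : Function.Surjective desub.toTMap.map := by
    intro y
    obtain ⟨t, p, rfl⟩ := K.subdiv.exists_pt y
    obtain ⟨u, rfl⟩ := desub_onT_surjective t
    refine ⟨K.pt u ((desub.toTMap.rot u).inv.pent p), ?_⟩
    rw [TMap.map_pt, PentSym.pent_inv]
    rfl
  exact (subHomeo K_injVert).isHomeomorph.comp
    ⟨desub.toTMap.continuous_map, hd, desub_inj.map_injective K_injVert.subdiv, hs⟩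

theorem inBall_of_par {t t' : K.T} {n : ℕ} (h : K.InBall (par t) n (par t')) :
    K.InBall t (3 * n + 2) t' :=
  InBall.comap desub_injective.1 desub_onT_bijective (h.subdiv (desub.onT t).2 (desub.onT t').2)

/-- The bound is propagated by `3 * 5 ^ m + 2 ≤ 5 ^ (m + 1)`. -/
theorem inBall_of_par_iterate (m : ℕ) {t t' : K.T} (h : K.InBall (par^[m] t) 1 (par^[m] t')) :
    K.InBall t (5 ^ m) t' := by
  induction m generalizing t t' with
  | zero => exact h
  | succ m ih =>
    rw [Function.iterate_succ_apply, Function.iterate_succ_apply] at h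
    refine (inBall_of_par (ih h)).mono ?_
    have := Nat.one_le_pow m 5 (by norm_num)
    rw [pow_succ]
    omega

theorem deflate_iterate_pt (m : ℕ) (t : K.T) (p : Pentagon) :
    ∃ q, deflate^[m] (K.pt t p) = K.pt (par^[m] t) q := by
  induction m generalizing t p with
  | zero => exact ⟨p, rfl⟩
  | succ m ih =>
    obtain ⟨q, hq⟩ := deflate_pt t p
    rw [Function.iterate_succ_apply, Function.iterate_succ_apply, hq]
    exact ih _ q

theorem ev_deflate_iterate (m : ℕ) (H : K.V ⊕ K.T → ℝ) (x : K.Space) :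
    K.ev H (deflate^[m] x) = K.ev (deflateH^[m] H) x := by
  induction m generalizing H with
  | zero => rfl
  | succ m ih => rw [Function.iterate_succ_apply', ev_deflate, ih, ← Function.iterate_succ_apply]

theorem osc_deflateH_iterate (m : ℕ) {H : K.V ⊕ K.T → ℝ} (h : K.Osc H 1) :
    K.Osc (deflateH^[m] H) ((3 / 4) ^ m) := by
  induction m with
  | zero => simpa using h
  | succ m ih =>
    rw [Function.iterate_succ_apply', pow_succ']
    exact osc_deflateH ih

/-- The balls of `K` are contained in open discs of bounded size. -/
theorem exists_disc_inBall (n : ℕ) : ∃ R, ∀ t₀ : K.T, ∃ ψ : ℂ → K.Space, IsOpenEmbedding ψ ∧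
    (∀ t p, K.InBall t₀ n t → K.pt t p ∈ range ψ) ∧
    ∀ t p, K.pt t p ∈ range ψ → K.InBall t₀ R t := by
  classical
  -- After `m` deflations the weight function of `z`, at least 1/3 at the centre of `t₀`, varies
  -- over the `n`-ball by at most `(2 * n + 2) * (3 / 4) ^ m`: `2 * n` for the centres and 2 for the
  -- two points inside their tiles. This is less than 1/3, so the whole ball lies in the open star
  -- of `z`, and the disc is the preimage of that star.
  obtain ⟨m, hm⟩ := exists_pow_lt_of_lt_one (show (0 : ℝ) < 1 / (3 * (2 * n + 2)) by positivity)
    (show (3 / 4 : ℝ) < 1 by norm_num)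
  refine ⟨5 ^ m, fun t₀ => ?_⟩
  obtain ⟨z, hz, hz'⟩ := exists_weight_ge K_injVert (deflate^[m] (K.pt t₀ centre))
  obtain ⟨ψ, hψ, hr⟩ := exists_disc K_injVert K_full z hz
  have hh : IsHomeomorph deflate^[m] := by
    clear hz' hr hm
    induction m with
    | zero => exact IsHomeomorph.id
    | succ m ih => rw [Function.iterate_succ]; exact ih.comp isHomeomorph_deflate
  let e := hh.homeomorph
  have he : ∀ x, e x = deflate^[m] x := fun _ => rfl
  have hmem : ∀ x, x ∈ range (e.symm ∘ ψ) ↔ 0 < K.weight z (deflate^[m] x) := by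
    intro x
    have : deflate^[m] x ∈ range ψ ↔ 0 < K.weight z (deflate^[m] x) := by rw [hr]; rfl
    rw [← this, ← he]
    constructor
    · rintro ⟨y, rfl⟩
      exact ⟨y, by simp⟩
    · rintro ⟨y, hy⟩
      exact ⟨y, by simp [hy]⟩
  have hO : K.Osc (deflateH^[m] (Pi.single z 1)) ((3 / 4) ^ m) :=
    osc_deflateH_iterate m (osc_single z)
  have hin : ∀ t p, K.InBall t₀ n t → 0 < K.weight z (deflate^[m] (K.pt t p)) := by
    intro t p ht
    unfold weight at hz' ⊢
    rw [ev_deflate_iterate, ev_pt] at hz' ⊢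
    have h1 := abs_le.1 (hO.abs_evP_sub_le t p)
    have h2 := abs_le.1 (hO.abs_evP_sub_le t₀ centre)
    have h3 := abs_le.1 (hO.abs_sub_le_of_inBall ht)
    rw [lt_div_iff₀ (by positivity)] at hm
    nlinarith
  refine ⟨e.symm ∘ ψ, e.symm.isOpenEmbedding.comp hψ, fun t p ht => (hmem _).2 (hin t p ht),
    fun t p ht => ?_⟩
  rw [hmem] at ht
  -- Two tiles whose `m`-th parents both meet the open star of `z` have adjacent parents. This
  -- bounds the size of the disc independently of `t₀`.
  have h0 := hin t₀ centre (InBall.base.mono (Nat.zero_le n))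
  obtain ⟨q, hq⟩ := deflate_iterate_pt m t p
  obtain ⟨q₀, hq₀⟩ := deflate_iterate_pt m t₀ centre
  rw [hq] at ht
  rw [hq₀] at h0
  exact inBall_of_par_iterate m (inBall_one_of_weight_pos K_injVert h0 ht)

end PentHull
namespace PentHull

open PentComplex Topology

/-! ## Tilings of the plane have no boundary -/

/-- A circle around the origin cannot be contracted in the punctured plane. -/
theorem not_contraction_circle {H : unitInterval × ℝ → ℂ} (hH : Continuous H) (h0 : ∀ a, H a ≠ 0)
    {c : ℂ} (hc : ∀ θ, H (0, θ) = c) {r : ℝ}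
    (h1 : ∀ θ : ℝ, H (1, θ) = r * Complex.exp (θ * Complex.I))
    (hp : ∀ s θ, H (s, θ + 2 * Real.pi) = H (s, θ)) : False := by
  have cov := Complex.isCoveringMap_exp
  let H' : C(unitInterval × ℝ, {z : ℂ // z ≠ 0}) := ⟨fun a => ⟨H a, h0 a⟩, by fun_prop⟩
  let f : C(ℝ, ℂ) := .const ℝ (Complex.log c)
  have hc0 : c ≠ 0 := by rw [← hc 0]; exact h0 _
  have hf : ∀ a, H' (0, a) = ⟨Complex.exp (f a), Complex.exp_ne_zero _⟩ := fun a =>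
    Subtype.ext (by simp [H', f, hc, Complex.exp_log hc0])
  set F := cov.liftHomotopy H' f hf with hF
  have hlift : ∀ a, Complex.exp (F a) = H a := fun a =>
    congrArg Subtype.val (congrFun (cov.liftHomotopy_lifts H' f hf) a)
  have hper : ∀ s θ, F (s, θ + 2 * Real.pi) = F (s, θ) := by
    -- The lift translated by one period lifts the same homotopy with the same initial values, so it
    -- equals `F` by uniqueness.
    let G : C(unitInterval × ℝ, ℂ) := ⟨fun a => F (a.1, a.2 + 2 * Real.pi), by fun_prop⟩
    have : G = F := by
      rw [hF, cov.eq_liftHomotopy_iff']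
      refine ⟨funext fun a => Subtype.ext ?_, fun a => ?_⟩
      · simp only [Function.comp, G, ContinuousMap.coe_mk, hlift, hp]
        rfl
      · exact cov.liftHomotopy_zero H' f hf _
    exact fun s θ => congrArg (fun g : C(unitInterval × ℝ, ℂ) => g (s, θ)) this
  -- On the circle the logarithm is `θ * I` up to a constant, which contradicts periodicity.
  have hconst : (fun θ : ℝ => F (1, θ) - θ * Complex.I) = fun _ => F (1, 0) := by
    refine cov.eq_of_comp_eq (by fun_prop) continuous_const (funext fun θ => Subtype.ext ?_) 0
      (by simp)
    simp only [Function.comp, Complex.exp_sub, hlift, h1]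
    rw [mul_div_cancel_right₀ _ (Complex.exp_ne_zero _)]
    simp
  have h2 := congrFun hconst (2 * Real.pi)
  have h3 := hper 1 0
  rw [zero_add] at h3
  simp only [h3, sub_eq_self] at h2
  simp [Real.pi_ne_zero] at h2

/-- The image of a point of the pentagon under a contraction towards the centre. -/
def shrink (s : unitInterval) (p : Pentagon) : Pentagon := ⟨((s : ℝ) : ℂ) * p, by
  rw [mem_pentagon_iff]
  have h := ctr_nonneg p
  have h' := sum_wt_nonneg p
  unfold ctr at h
  simp only [wt_smul _ s.2.1, ← Finset.mul_sum]
  exact mul_le_one₀ s.2.2 h' (by linarith)⟩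

theorem continuous_shrink : Continuous fun a : unitInterval × Pentagon => shrink a.1 a.2 :=
  Continuous.subtype_mk (by fun_prop) _

theorem shrink_one (p : Pentagon) : shrink 1 p = p := Subtype.ext (by simp [shrink])

theorem shrink_zero (p q : Pentagon) : shrink 0 p = shrink 0 q := Subtype.ext (by simp [shrink])

theorem ctr_shrink (s : unitInterval) (p : Pentagon) : ctr (shrink s p) = 1 - s + s * ctr p := by
  unfold ctr shrink
  simp only [wt_smul _ s.2.1, ← Finset.mul_sum]
  ring

theorem shrink_eq_self_of_ctr {s : unitInterval} {p : Pentagon} (h : ctr (shrink s p) = 0) :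
    shrink s p = p := by
  rw [ctr_shrink] at h
  have h1 := s.2.2
  have h2 := mul_nonneg s.2.1 (ctr_nonneg p)
  have : s = 1 := Subtype.ext (show (s : ℝ) = 1 by linarith)
  rw [this, shrink_one]

namespace PentComplex

variable {L : PentComplex}

theorem edge_of_wt_pos {p : Pentagon} {a b : ZMod 5} (hab : a ≠ b) (ha : 0 < wt a p)
    (hb : 0 < wt b p) : b = a + 1 ∨ a = b + 1 := by
  obtain ⟨j, x, y, hx, hy, hxy, rfl⟩ := exists_conePt p
  rw [wt_conePt] at ha hb
  have ha' : a = j ∨ a = j + 1 := by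
    by_contra! h
    simp [h] at ha
  have hb' : b = j ∨ b = j + 1 := by
    by_contra! h
    simp [h] at hb
  rcases ha' with rfl | rfl <;> rcases hb' with rfl | rfl <;> simp at hab ⊢

/-- In a tiling of the plane every edge lies in two tiles. -/
theorem exists_opposite_of_plane (hL : L.InjVert) (h : L.Space ≃ₜ ℂ) (t : L.T) (i : ZMod 5) :
    ∃ t' j, t' ≠ t ∧ s(L.vert t' j, L.vert t' (j + 1)) = s(L.vert t i, L.vert t (i + 1)) := by
  by_contra! hcon
  have hT2 : T2Space L.Space := h.isEmbedding.t2Space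
  have hemb : IsClosedEmbedding (L.pt t) :=
    (L.continuous_pt t).isClosedEmbedding (pt_injective hL t)
  -- The open set `O` contains the points of the open edge. If no other tile had this edge, `O`
  -- would lie entirely in the tile `t`, so that a small circle around the midpoint of the edge
  -- could be viewed in the pentagon.
  let O : Set L.Space := {x | 0 < L.weight (Sum.inr t) x +
    min (L.weight (Sum.inl (L.vert t i)) x) (L.weight (Sum.inl (L.vert t (i + 1))) x)}
  have hO : IsOpen O := isOpen_lt continuous_const
    ((continuous_weight _).add ((continuous_weight _).min (continuous_weight _)))
  have hOt : ∀ x ∈ O, ∃ p, L.pt t p = x := by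
    intro x hx
    obtain ⟨t', p, rfl⟩ := L.exists_pt x
    by_cases ht : t' = t
    · exact ⟨p, by rw [ht]⟩
    exfalso
    simp only [O, mem_ofPred_eq, weight_centre_ne ht, zero_add, lt_min_iff] at hx
    obtain ⟨a, ha, ha'⟩ := exists_of_weight_pos hL hx.1
    obtain ⟨b, hb, hb'⟩ := exists_of_weight_pos hL hx.2
    have hab : a ≠ b := by
      rintro rfl
      exact add_one_ne_self i (hL t (hb.symm.trans ha))
    rcases edge_of_wt_pos hab ha' hb' with rfl | rfl
    · exact hcon t' a ht (by rw [ha, hb])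
    · exact hcon t' b ht (by rw [ha, hb, Sym2.eq_swap])
  let e : Pentagon := edgePt i 1 ⟨1 / 2, by norm_num, by norm_num⟩
  have hm : L.pt t e ∈ O := by
    have h1 : i + 1 ≠ i := add_one_ne_self i
    simp only [O, mem_ofPred_eq, weight_centre, weight_vert hL, e, ctr_edgePt, wt_edgePt_one]
    norm_num [h1, h1.symm]
  have hO' : IsOpen (h.symm ⁻¹' O) := hO.preimage h.symm.continuous
  obtain ⟨r, hr, hball⟩ := Metric.isOpen_iff.1 hO' (h (L.pt t e)) (by simpa using hm)
  let z : ℝ → ℂ := fun θ => h (L.pt t e) + (r / 2 : ℝ) * Complex.exp (θ * Complex.I)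
  have hz : ∀ θ, h.symm (z θ) ∈ O := by
    intro θ
    refine hball ?_
    simp only [z, Metric.mem_ball, dist_eq_norm, add_sub_cancel_left, norm_mul,
      Complex.norm_exp_ofReal_mul_I, mul_one, Complex.norm_real, Real.norm_eq_abs]
    rw [abs_of_pos (by linarith)]
    linarith
  choose q hq using fun θ => hOt _ (hz θ)
  have hqc : Continuous q := by
    rw [hemb.isEmbedding.continuous_iff]
    have : L.pt t ∘ q = fun θ => h.symm (z θ) := funext hq
    rw [this]
    exact h.symm.continuous.comp (by fun_prop)
  have hqp : ∀ θ, q (θ + 2 * Real.pi) = q θ := by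
    intro θ
    apply pt_injective hL t
    rw [hq, hq]
    congr 1
    simp only [z]
    congr 2
    rw [Complex.ofReal_add, add_mul, Complex.exp_add]
    push_cast
    rw [Complex.exp_two_pi_mul_I, mul_one]
  -- The circle is contracted towards the centre of the pentagon. A proper shrinking has no point on
  -- the boundary, so the midpoint of the edge is never met.
  refine not_contraction_circle (r := r / 2)
    (H := fun a => h (L.pt t (shrink a.1 (q a.2))) - h (L.pt t e))
    (c := h (L.pt t (shrink 0 (q 0))) - h (L.pt t e)) ?_ ?_ ?_ ?_ ?_
  · have hs : Continuous fun a : unitInterval × ℝ => shrink a.1 (q a.2) :=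
      continuous_shrink.comp (continuous_fst.prodMk (hqc.comp continuous_snd))
    exact (h.continuous.comp ((L.continuous_pt t).comp hs)).sub continuous_const
  · rintro ⟨s, θ⟩ h0
    have h1 := pt_injective hL t (h.injective (sub_eq_zero.1 h0))
    have h2 : ctr e = 0 := ctr_edgePt _ _ _
    have h3 : q θ = e := by rw [← shrink_eq_self_of_ctr (s := s) (p := q θ) (by rw [h1, h2]), h1]
    have h4 := hq θ
    rw [h3, Homeomorph.eq_symm_apply] at h4
    simp only [z, left_eq_add, mul_eq_zero, Complex.exp_ne_zero, or_false,
      Complex.ofReal_eq_zero] at h4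
    linarith
  · exact fun θ => by rw [shrink_zero (q θ) (q 0)]
  · intro θ
    simp only [shrink_one, hq]
    simp [z]
  · intro s θ
    simp only [hqp]

/-- The tiles of a connected complex are joined by chains of adjacent tiles. -/
theorem exists_inBall_of_preconnected [PreconnectedSpace L.Space] (hL : L.InjVert) (t₀ t : L.T) :
    ∃ n, L.InBall t₀ n t := by
  let C : Set L.Space := {x | ∃ t p n, x = L.pt t p ∧ L.InBall t₀ n t}
  have hC : ∀ t p, L.pt t p ∈ C ↔ ∃ n, L.InBall t₀ n t := by
    intro t p
    constructor
    · rintro ⟨t', p', n, h, h'⟩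
      exact ⟨n + 1, h'.step (adj_of_pt_eq hL h.symm)⟩
    · rintro ⟨n, h⟩
      exact ⟨t, p, n, rfl, h⟩
  have hclopen : IsClopen C := by
    constructor
    · rw [isClosed_space_iff]
      intro t
      simp only [hC]
      exact isClosed_const
    · rw [isOpen_space_iff]
      intro t
      simp only [hC]
      exact isOpen_const
  have := hclopen.eq_univ ⟨L.pt t₀ centre, (hC _ _).2 ⟨0, InBall.base⟩⟩
  exact (hC t centre).1 (this ▸ mem_univ _)

end PentComplex

end PentHull
namespace PentHull

open PentComplex Topology

namespace PentComplex

variable {L M : PentComplex}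

/-! ## Complexes whose finite patches embed in `K` -/

/-- Every edge lies in two tiles. -/
def NoBoundary (L : PentComplex) : Prop := ∀ t i (η : ℤˣ), ∃ t' j, ∃ ζ : ℤˣ, t' ≠ t ∧
  L.vert t' j = L.vert t i ∧
  L.vert t' (j + ((ζ : ℤ) : ZMod 5)) = L.vert t (i + ((η : ℤ) : ZMod 5))

theorem noBoundary_of_plane (hL : L.InjVert) (h : L.Space ≃ₜ ℂ) : L.NoBoundary := by
  have key : ∀ t i, ∃ t' j, ∃ ζ : ℤˣ, t' ≠ t ∧ L.vert t' j = L.vert t i ∧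
      L.vert t' (j + ((ζ : ℤ) : ZMod 5)) = L.vert t (i + 1) := by
    intro t i
    obtain ⟨t', j, hne, he⟩ := exists_opposite_of_plane hL h t i
    rcases Sym2.eq_iff.1 he with ⟨h1, h2⟩ | ⟨h1, h2⟩
    · exact ⟨t', j, 1, hne, h1, by simpa using h2⟩
    · exact ⟨t', j + 1, -1, hne, h2, by simpa using h1⟩
  intro t i η
  rcases Int.units_eq_one_or η with rfl | rfl
  · simpa using key t i
  · obtain ⟨t', j, ζ, hne, h1, h2⟩ := key t (i - 1)
    rw [sub_add_cancel] at h2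
    refine ⟨t', j + ((ζ : ℤ) : ZMod 5), -ζ, hne, h2, ?_⟩
    simpa [← sub_eq_add_neg] using h1

/-- The maps `τ` and `g` embed the tiles of `P` in `M`. -/
structure IsPatchEmb (L M : PentComplex) (P : Set L.T) (τ : L.T → M.T) (g : L.V → M.V)
    (σ : L.T → PentSym) : Prop where
  injT : InjOn τ P
  injV : InjOn g (L.vertsOf P)
  compat : ∀ t ∈ P, ∀ i, g (L.vert t i) = M.vert (τ t) ((σ t).act i)

/-- Every finite patch of `L` embeds in `M`. -/
def LocEmb (L M : PentComplex) : Prop := ∀ P : Set L.T, P.Finite → ∃ τ g σ, IsPatchEmb L M P τ g σ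

theorem LocallyIsomorphic.locEmb {D : Type*} {dL : Decoration L D} {dM : Decoration M D}
    (h : L.LocallyIsomorphic M dL dM) : L.LocEmb M := by
  have : Nonempty PentSym := ⟨⟨0, 1⟩⟩
  intro P hP
  obtain ⟨Q, -, τ, g, hτ, hg, hc⟩ := h P hP
  choose! σ hσ using hc
  exact ⟨τ, g, σ, hτ.injOn, hg.injOn, fun t ht => (hσ t ht).1⟩

theorem mem_vertsOf {P : Set L.T} {t : L.T} (h : t ∈ P) (i : ZMod 5) : L.vert t i ∈ L.vertsOf P :=
  ⟨t, h, i, rfl⟩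

theorem LocEmb.injVert (h : L.LocEmb M) (hM : M.InjVert) : L.InjVert := by
  intro t i j hij
  obtain ⟨τ, g, σ, he⟩ := h {t} (finite_singleton t)
  have := he.compat t rfl i
  rw [hij, he.compat t rfl j] at this
  exact ((σ t).act_injective (hM _ this)).symm

namespace IsPatchEmb

variable {P : Set L.T} {τ : L.T → M.T} {g : L.V → M.V} {σ : L.T → PentSym}

theorem adj (h : IsPatchEmb L M P τ g σ) {t t' : L.T} (ht : t ∈ P) (ht' : t' ∈ P)
    (ha : L.Adj t t') : M.Adj (τ t) (τ t') := by
  obtain ⟨i, j, e⟩ := ha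
  exact ⟨(σ t).act i, (σ t').act j, by rw [← h.compat t ht, ← h.compat t' ht', e]⟩

/-- If all the tiles around a tile are in the patch, their images are all the tiles around the
image. -/
theorem exists_adj (h : IsPatchEmb L M P τ g σ) (hM : M.InjVert)
    (hF : ∀ t i, M.Full (M.vert t i)) (hN : L.NoBoundary) {t : L.T}
    (hP : ∀ t', L.Adj t t' → t' ∈ P) {u : M.T} (hu : M.Adj (τ t) u) :
    ∃ t', L.Adj t t' ∧ τ t' = u := by
  obtain ⟨a, b, hab⟩ := hu
  obtain ⟨i, rfl⟩ : ∃ i, a = (σ t).act i := ⟨_, ((σ t).act_inv a).symm⟩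
  have htP := hP t (Adj.refl t)
  have key : ∀ d, d ≠ 0 → M.Star (M.vert (τ t) ((σ t).act i)) d → ∃ t', L.Adj t t' ∧ τ t' = u := by
    intro d hd S
    have : NeZero d := ⟨hd⟩
    have inP : ∀ t' i', L.vert t' i' = L.vert t i → t' ∈ P := fun t' i' e => hP t' ⟨i, i', e.symm⟩
    have gv : ∀ t' i', L.vert t' i' = L.vert t i →
        M.vert (τ t') ((σ t').act i') = M.vert (τ t) ((σ t).act i) := fun t' i' e => by
      rw [← h.compat t' (inP t' i' e), e, h.compat t htP]
    have step : ∀ k, (∃ t' i', L.vert t' i' = L.vert t i ∧ τ t' = S.tl k) →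
        ∃ t' i', L.vert t' i' = L.vert t i ∧ τ t' = S.tl (k + 1) := by
      rintro k ⟨t', i', e, hk⟩
      have hix : (σ t').act i' = S.ix k := by
        apply hM (S.tl k)
        rw [S.vert_ix, ← hk, gv t' i' e]
      -- The star is traversed tile by tile. The sign is chosen so that the image of the edge
      -- crossed is the one shared by the tiles `k` and `k + 1` of the star. The image of the new
      -- tile contains this edge, hence is one of these two, and it is not tile `k` because the
      -- patch is embedded injectively.
      obtain ⟨t'', j, ζ, hne, e1, e2⟩ := hN t' i' ((σ t').sign * (-1))
      have hnb : M.vert (τ t'') ((σ t'').act (j + ((ζ : ℤ) : ZMod 5))) = S.nb (k + 1) := by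
        rw [← h.compat t'' (inP t'' j (e1.trans e)), e2, h.compat t' (inP t' i' e),
          PentSym.act_add, ← mul_assoc, Int.units_mul_self, hix, hk, ← S.vert_prev]
        simp [sub_eq_add_neg]
      obtain ⟨m, hm, hm'⟩ := S.complete _ _ (gv t'' j (e1.trans e))
      rw [PentSym.act_add, hm, hm'] at hnb
      refine ⟨t'', j, e1.trans e, ?_⟩
      rcases Int.units_eq_one_or ((σ t'').sign * ζ) with h1 | h1
      · rw [h1, Units.val_one, Int.cast_one, S.vert_next] at hnb
        rw [hm, S.nb_injective hnb]
      · rw [h1, Units.val_neg, Units.val_one, Int.cast_neg, Int.cast_one, ← sub_eq_add_neg,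
          S.vert_prev] at hnb
        have hmk := add_right_cancel (S.nb_injective hnb)
        refine absurd (h.injT (inP t'' j (e1.trans e)) (inP t' i' e) ?_) hne
        rw [hm, hk, hmk]
    obtain ⟨k₀, hk₀, -⟩ := S.complete (τ t) _ rfl
    obtain ⟨k, rfl, -⟩ := S.complete u b hab.symm
    have all : ∀ n : ℕ, ∃ t' i', L.vert t' i' = L.vert t i ∧ τ t' = S.tl (k₀ + n) := by
      intro n
      induction n with
      | zero => exact ⟨t, i, rfl, by simpa using hk₀⟩
      | succ n ih =>
        have := step _ ih
        rwa [add_assoc, ← Nat.cast_succ] at this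
    obtain ⟨t', i', e, ht'⟩ := all (k - k₀).val
    rw [ZMod.natCast_zmod_val, add_sub_cancel] at ht'
    exact ⟨t', ⟨i, i', e.symm⟩, ht'⟩
  rcases hF (τ t) ((σ t).act i) with ⟨⟨S⟩⟩ | ⟨⟨S⟩⟩
  exacts [key 3 (by norm_num) S, key 4 (by norm_num) S]

end IsPatchEmb

/-! ### Local finiteness -/

theorem Full.encard_le {v : M.V} (h : M.Full v) : {u | ∃ j, M.vert u j = v}.encard ≤ 4 := by
  have key : ∀ d, d ≠ 0 → d ≤ 4 → M.Star v d → {u | ∃ j, M.vert u j = v}.encard ≤ 4 := by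
    intro d hd hd4 S
    have : NeZero d := ⟨hd⟩
    have hsub : {u | ∃ j, M.vert u j = v} ⊆ range S.tl := by
      rintro u ⟨j, hj⟩
      obtain ⟨k, rfl, -⟩ := S.complete u j hj
      exact ⟨k, rfl⟩
    refine (encard_le_encard hsub).trans ?_
    rw [← image_univ]
    refine (encard_image_le _ _).trans ?_
    rw [encard_univ, ENat.card_eq_coe_fintype_card, ZMod.card]
    exact_mod_cast hd4
  rcases h with ⟨⟨S⟩⟩ | ⟨⟨S⟩⟩
  exacts [key 3 (by norm_num) (by norm_num) S, key 4 (by norm_num) (by norm_num) S]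

theorem encard_adj_le (hF : ∀ t i, M.Full (M.vert t i)) (t : M.T) :
    {u | M.Adj t u}.encard ≤ 20 := by
  have : {u | M.Adj t u} = {u | ∃ j, M.vert u j = M.vert t 0} ∪ ({u | ∃ j, M.vert u j = M.vert t 1} ∪
      ({u | ∃ j, M.vert u j = M.vert t 2} ∪ ({u | ∃ j, M.vert u j = M.vert t 3} ∪
        {u | ∃ j, M.vert u j = M.vert t 4}))) := by
    ext u
    constructor
    · rintro ⟨i, j, h⟩
      rcases zmod5_cases i with rfl | rfl | rfl | rfl | rfl
      exacts [Or.inl ⟨j, h.symm⟩, Or.inr (Or.inl ⟨j, h.symm⟩), Or.inr (Or.inr (Or.inl ⟨j, h.symm⟩)),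
        Or.inr (Or.inr (Or.inr (Or.inl ⟨j, h.symm⟩))), Or.inr (Or.inr (Or.inr (Or.inr ⟨j, h.symm⟩)))]
    · rintro (⟨j, h⟩ | ⟨j, h⟩ | ⟨j, h⟩ | ⟨j, h⟩ | ⟨j, h⟩) <;> exact ⟨_, j, h.symm⟩
  rw [this]
  refine (encard_union_le _ _).trans ((add_le_add (hF t 0).encard_le ((encard_union_le _ _).trans
    (add_le_add (hF t 1).encard_le ((encard_union_le _ _).trans (add_le_add (hF t 2).encard_le
    ((encard_union_le _ _).trans (add_le_add (hF t 3).encard_le (hF t 4).encard_le))))))).trans ?_)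
  norm_num

/-- Otherwise `t` and 21 of its adjacent tiles form a finite patch, whose embedding produces 21
tiles adjacent to one tile of `M`. -/
theorem LocEmb.encard_adj_le (h : L.LocEmb M) (hF : ∀ t i, M.Full (M.vert t i)) (t : L.T) :
    {u | L.Adj t u}.encard ≤ 20 := by
  by_contra! hcon
  obtain ⟨S, hS, hS'⟩ := exists_subset_encard_eq (Order.add_one_le_of_lt hcon)
  have hfin : S.Finite := finite_of_encard_eq_coe (k := 21) (by rw [hS']; norm_num)
  obtain ⟨τ, g, σ, he⟩ := h (insert t S) (hfin.insert t)
  have h1 : τ '' S ⊆ {u | M.Adj (τ t) u} := by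
    rintro _ ⟨s, hs, rfl⟩
    exact he.adj (mem_insert _ _) (mem_insert_of_mem _ hs) (hS hs)
  have h2 := (encard_le_encard h1).trans (PentComplex.encard_adj_le hF (τ t))
  rw [(he.injT.mono (subset_insert _ _)).encard_image, hS'] at h2
  exact absurd h2 (by norm_num)

theorem finite_inBall (h : ∀ t, {u | L.Adj t u}.Finite) (t₀ : L.T) (n : ℕ) :
    {t | L.InBall t₀ n t}.Finite := by
  induction n with
  | zero =>
    refine (finite_singleton t₀).subset ?_
    intro t ht
    cases ht
    rfl
  | succ n ih =>
    refine (ih.biUnion fun t _ => h t).subset ?_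
    intro t ht
    cases ht with
    | step h1 h2 => exact mem_biUnion h1 h2

theorem LocEmb.finite_inBall (h : L.LocEmb M) (hF : ∀ t i, M.Full (M.vert t i)) (t₀ : L.T)
    (n : ℕ) : {t | L.InBall t₀ n t}.Finite :=
  PentComplex.finite_inBall (fun t => finite_of_encard_le_coe (k := 20) (h.encard_adj_le hF t)) t₀ n

namespace IsPatchEmb

variable {τ : L.T → M.T} {g : L.V → M.V} {σ : L.T → PentSym} {t₀ : L.T} {n : ℕ}

theorem inBall (h : IsPatchEmb L M {t | L.InBall t₀ n t} τ g σ) {m : ℕ} (hm : m ≤ n) {t : L.T}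
    (ht : L.InBall t₀ m t) : M.InBall (τ t₀) m (τ t) := by
  induction ht with
  | base => exact InBall.base
  | @step m s t hs ha ih =>
    exact (ih (by omega)).step (h.adj (hs.mono (by omega)) ((hs.step ha).mono hm) ha)

theorem exists_inBall (h : IsPatchEmb L M {t | L.InBall t₀ n t} τ g σ) (hM : M.InjVert)
    (hF : ∀ t i, M.Full (M.vert t i)) (hN : L.NoBoundary) {m : ℕ} (hm : m ≤ n) {u : M.T}
    (hu : M.InBall (τ t₀) m u) : ∃ t, L.InBall t₀ m t ∧ τ t = u := by
  induction hu with
  | base => exact ⟨t₀, InBall.base, rfl⟩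
  | @step m v u hs ha ih =>
    obtain ⟨s, hs', rfl⟩ := ih (by omega)
    obtain ⟨t, ht, rfl⟩ := h.exists_adj hM hF hN (fun t' ht' => (hs'.step ht').mono hm) ha
    exact ⟨t, hs'.step ht, rfl⟩

end IsPatchEmb

/-! ### Transfer of discs -/

end PentComplex

theorem exists_lift_isOpenEmbedding {X Y Z : Type*} [TopologicalSpace X] [TopologicalSpace Y]
    [TopologicalSpace Z] {h : X → Y} (hc : Continuous h) (hi : Function.Injective h) {ψ : Z → Y}
    (hψ : IsOpenEmbedding ψ) (hr : range ψ ⊆ range h)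
    (ho : ∀ O, IsOpen O → O ⊆ h ⁻¹' range ψ → IsOpen (h '' O)) :
    ∃ ψ' : Z → X, IsOpenEmbedding ψ' ∧ h ∘ ψ' = ψ := by
  choose ψ' hψ' using fun z => hr (mem_range_self z)
  refine ⟨ψ', IsOpenEmbedding.of_continuous_injective_isOpenMap ?_ ?_ ?_, funext hψ'⟩
  · refine continuous_def.2 fun O hO => ?_
    have : ψ' ⁻¹' O = ψ ⁻¹' (h '' (O ∩ h ⁻¹' range ψ)) := by
      ext z
      constructor
      · intro hz
        exact ⟨ψ' z, ⟨hz, by rw [mem_preimage, hψ']; exact mem_range_self z⟩, hψ' z⟩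
      · rintro ⟨x, ⟨hx, -⟩, hxz⟩
        rw [mem_preimage, hi ((hψ' z).trans hxz.symm)]
        exact hx
    rw [this]
    exact (ho _ (hO.inter (hψ.isOpen_range.preimage hc)) inter_subset_right).preimage hψ.continuous
  · intro z z' e
    apply hψ.injective
    rw [← hψ', ← hψ', e]
  · intro O hO
    have : ψ' '' O = h ⁻¹' (ψ '' O) := by
      ext x
      constructor
      · rintro ⟨z, hz, rfl⟩
        exact ⟨z, hz, (hψ' z).symm⟩
      · rintro ⟨z, hz, e⟩
        exact ⟨z, hz, hi ((hψ' z).trans e)⟩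
    rw [this]
    exact (hψ.isOpenMap O hO).preimage hc

namespace PentComplex

variable {L M : PentComplex}

/-- The subcomplex formed by the tiles of `P`. -/
abbrev restrict (L : PentComplex) (P : Set L.T) : PentComplex where
  V := L.V
  T := P
  vert := fun t => L.vert t

/-- The inclusion of a subcomplex. -/
def restrictIncl (L : PentComplex) (P : Set L.T) : TMap (L.restrict P) L where
  onV := id
  onT := Subtype.val
  rot := fun _ => ⟨0, 1⟩
  compat := by
    intro t i
    simp [PentSym.act, restrict]

theorem PentSym_pent_one (p : Pentagon) : PentSym.pent ⟨0, 1⟩ p = p := by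
  apply pentagon_ext
  intro i
  have := PentSym.wt_pent_act ⟨0, 1⟩ p i
  simpa [PentSym.act] using this

theorem restrictIncl_pt (P : Set L.T) (t : P) (p : Pentagon) :
    (L.restrictIncl P).map ((L.restrict P).pt t p) = L.pt t p := by
  rw [TMap.map_pt]
  exact congrArg (L.pt (t : L.T)) (PentSym_pent_one p)

theorem restrictIncl_inj (P : Set L.T) : (L.restrictIncl P).Inj :=
  ⟨Subtype.val_injective, fun _ _ _ _ h => h⟩

/-- The map of a subcomplex given by an embedding of a patch. -/
def IsPatchEmb.toTMap {P : Set L.T} {τ : L.T → M.T} {g : L.V → M.V} {σ : L.T → PentSym}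
    (h : IsPatchEmb L M P τ g σ) : TMap (L.restrict P) M where
  onV := g
  onT := fun t => τ t.1
  rot := fun t => σ t.1
  compat := fun t i => h.compat t.1 t.2 i

theorem IsPatchEmb.toTMap_inj {P : Set L.T} {τ : L.T → M.T} {g : L.V → M.V} {σ : L.T → PentSym}
    (h : IsPatchEmb L M P τ g σ) : h.toTMap.Inj :=
  ⟨fun t t' e => Subtype.ext (h.injT t.2 t'.2 e),
    fun t i t' j e => h.injV (mem_vertsOf t.2 i) (mem_vertsOf t'.2 j) e⟩

/-- An embedding of a large ball of `L` carries the adjacencies of `K` back to `L`, since without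
boundary the image of a ball is a full ball. The disc of `K` is lifted to the patch and then
included in `L`. The patch is one step larger than the disc requires: a tile of `L` that merely
touches the disc must also belong to it, or else the image in `L` would not be open. -/
theorem LocEmb.exists_disc (h : L.LocEmb K) (hN : L.NoBoundary) (t₀ : L.T) (n : ℕ) :
    ∃ (R : ℕ) (ψ : ℂ → L.Space), IsOpenEmbedding ψ ∧
      (∀ t p, L.InBall t₀ n t → L.pt t p ∈ range ψ) ∧
      ∀ t p, L.pt t p ∈ range ψ → L.InBall t₀ R t := by
  have hL := h.injVert K_injVert
  obtain ⟨R', hR'⟩ := exists_disc_inBall n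
  obtain ⟨R, hRn, hRR'⟩ : ∃ R, n ≤ R ∧ R' ≤ R := ⟨max n R', le_max_left _ _, le_max_right _ _⟩
  obtain ⟨τ, g, σ, he⟩ := h _ (h.finite_inBall K_full t₀ (R + 1))
  obtain ⟨ψ, hψ, h1, h2⟩ := hR' (τ t₀)
  have hR : ∀ t, L.InBall t₀ (R + 1) t → ∀ p, K.pt (τ t) p ∈ range ψ → L.InBall t₀ R t := by
    intro t ht p hp
    obtain ⟨s, hs, e⟩ := he.exists_inBall K_injVert K_full hN (Nat.le_succ R)
      ((h2 _ _ hp).mono hRR')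
    rwa [he.injT (hs.mono (Nat.le_succ R)) ht e] at hs
  set P := {t | L.InBall t₀ (R + 1) t}
  set f := he.toTMap
  have hf : ∀ (t : P) p, f.map ((L.restrict P).pt t p) = K.pt (τ t) ((σ t).pent p) := fun t p => rfl
  have hrange : ∀ u p, K.pt u p ∈ range ψ → u ∈ range f.onT := by
    intro u p hu
    obtain ⟨t, ht, rfl⟩ := he.exists_inBall K_injVert K_full hN (Nat.le_succ R)
      ((h2 _ _ hu).mono hRR')
    exact ⟨⟨t, ht.mono (Nat.le_succ R)⟩, rfl⟩
  obtain ⟨ψ', hψ', e'⟩ := exists_lift_isOpenEmbedding f.continuous_map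
    (he.toTMap_inj.map_injective K_injVert) hψ (by
      intro y hy
      obtain ⟨u, p, rfl⟩ := K.exists_pt y
      obtain ⟨t, rfl⟩ := hrange u p hy
      exact ⟨(L.restrict P).pt t ((σ t.1).inv.pent p), by
        rw [hf, PentSym.pent_inv]; rfl⟩) (by
      intro O hO hO'
      refine he.toTMap_inj.isOpen_image K_injVert hO fun u p hu => hrange u p ?_
      obtain ⟨x, hx, e⟩ := hu
      rw [← e]
      exact hO' hx)
  have hball : ∀ x ∈ range ψ', ∀ (t : P) p, x = (L.restrict P).pt t p → L.InBall t₀ R t := by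
    rintro x ⟨z, rfl⟩ t p e
    refine hR t t.2 ((σ t).pent p) ?_
    rw [← hf, ← e]
    exact ⟨z, (congrFun e' z).symm⟩
  have htouch : ∀ t p, ∀ x ∈ range ψ', L.pt t p = (L.restrictIncl P).map x →
      L.InBall t₀ (R + 1) t := by
    intro t p x hx e
    obtain ⟨s, q, rfl⟩ := (L.restrict P).exists_pt x
    have hs := hball _ hx s q rfl
    rw [restrictIncl_pt] at e
    exact hs.step (adj_of_pt_eq hL e.symm)
  refine ⟨R + 1, (L.restrictIncl P).map ∘ ψ',
    IsOpenEmbedding.of_continuous_injective_isOpenMap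
      ((L.restrictIncl P).continuous_map.comp hψ'.continuous)
      (((restrictIncl_inj P).map_injective hL).comp hψ'.injective) ?_, ?_, ?_⟩
  · intro O hO
    rw [image_comp]
    refine (restrictIncl_inj P).isOpen_image hL (hψ'.isOpenMap O hO) ?_
    rintro t p ⟨x, ⟨z, -, rfl⟩, e⟩
    exact ⟨⟨t, htouch t p _ ⟨z, rfl⟩ e.symm⟩, rfl⟩
  · intro t p ht
    have htP : t ∈ P := ht.mono (by omega)
    obtain ⟨z, hz⟩ := h1 (τ t) ((σ t).pent p) (he.inBall (by omega) ht)
    refine ⟨z, ?_⟩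
    have : ψ' z = (L.restrict P).pt ⟨t, htP⟩ p := by
      apply he.toTMap_inj.map_injective K_injVert
      exact (congrFun e' z).trans hz
    simp only [Function.comp, this]
    exact restrictIncl_pt P ⟨t, htP⟩ p
  · rintro t p ⟨z, e⟩
    exact htouch t p _ ⟨z, rfl⟩ e.symm

/-- A connected complex without boundary whose finite patches embed in `K` is a plane. -/
theorem LocEmb.nonempty_homeomorph (h : L.LocEmb K) (hN : L.NoBoundary) (t₀ : L.T)
    (hc : ∀ t, ∃ n, L.InBall t₀ n t) : Nonempty (L.Space ≃ₜ ℂ) := by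
  choose R ψ hψ h1 h2 using h.exists_disc hN t₀
  -- Each radius exceeds the size of the preceding disc, which makes the discs nested.
  let r : ℕ → ℕ := fun k => Nat.rec 0 (fun _ a => R a + (a + 1)) k
  have hr : ∀ k, k ≤ r k := by
    intro k
    induction k with
    | zero => exact le_rfl
    | succ k ih => change k + 1 ≤ R (r k) + (r k + 1); omega
  refine nonempty_homeomorph_of_monotone_discs (fun k => ψ (r k)) (fun k => hψ _)
    (monotone_nat_of_le_succ fun k => ?_) (eq_univ_of_forall fun x => ?_)
  · intro x hx
    obtain ⟨t, p, rfl⟩ := L.exists_pt x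
    refine h1 _ t p ((h2 _ t p hx).mono ?_)
    change _ ≤ R (r k) + (r k + 1)
    omega
  · obtain ⟨t, p, rfl⟩ := L.exists_pt x
    obtain ⟨n, hn⟩ := hc t
    exact mem_iUnion.2 ⟨n, h1 _ t p (hn.mono (hr n))⟩

end PentComplex

end PentHull
namespace PentHull

open PentComplex Topology

/-! ## Correspondences between balls -/

namespace PentComplex

variable {D : Type*}

/-- The relation `r` matches the tiles of the `n`-balls around `t₀` and `u₀` and preserves indices
and decorations. -/
structure BallRel (L M : PentComplex) (dL : Decoration L D) (dM : Decoration M D) (t₀ : L.T)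
    (u₀ : M.T) (n : ℕ) (r : L.T → M.T → Prop) : Prop where
  base : r t₀ u₀
  left : ∀ t, L.InBall t₀ n t → ∃ u, r t u
  right : ∀ u, M.InBall u₀ n u → ∃ t, r t u
  eq_iff : ∀ {t u t' u'}, r t u → r t' u' → (t = t' ↔ u = u')
  vert_iff : ∀ {t u t' u'}, r t u → r t' u' → ∀ i j,
    L.vert t i = L.vert t' j ↔ M.vert u i = M.vert u' j
  dec : ∀ {t u}, r t u → dL t = dM u

variable {L M N : PentComplex} {dL : Decoration L D} {dM : Decoration M D} {dN : Decoration N D}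
  {t₀ : L.T} {u₀ : M.T} {n : ℕ} {r : L.T → M.T → Prop}

theorem BallRel.symm (h : BallRel L M dL dM t₀ u₀ n r) :
    BallRel M L dM dL u₀ t₀ n (fun u t => r t u) where
  base := h.base
  left := h.right
  right := h.left
  eq_iff := fun h1 h2 => (h.eq_iff h1 h2).symm
  vert_iff := fun h1 h2 i j => (h.vert_iff h1 h2 i j).symm
  dec := fun h1 => (h.dec h1).symm

theorem BallRel.inBall (h : BallRel L M dL dM t₀ u₀ n r) {m : ℕ} (hm : m ≤ n) {t : L.T}
    (ht : L.InBall t₀ m t) : ∀ {u}, r t u → M.InBall u₀ m u := by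
  induction ht with
  | base =>
    intro u hu
    rw [← (h.eq_iff h.base hu).1 rfl]
    exact InBall.base
  | @step m s t hs ha ih =>
    intro u hu
    obtain ⟨v, hv⟩ := h.left s (hs.mono (by omega))
    obtain ⟨i, j, e⟩ := ha
    exact (ih (by omega) hv).step ⟨i, j, (h.vert_iff hv hu i j).1 e⟩

/-- The function on vertices given by functions on tiles. -/
theorem exists_onV {P : Set L.T} {τ : L.T → M.T} [Nonempty M.T]
    (h : ∀ t ∈ P, ∀ t' ∈ P, ∀ i j, L.vert t i = L.vert t' j → M.vert (τ t) i = M.vert (τ t') j) :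
    ∃ g : L.V → M.V, ∀ t ∈ P, ∀ i, g (L.vert t i) = M.vert (τ t) i := by
  classical
  obtain ⟨u⟩ := ‹Nonempty M.T›
  refine ⟨fun v => if hv : ∃ t ∈ P, ∃ i, L.vert t i = v then
    M.vert (τ hv.choose) hv.choose_spec.2.choose else M.vert u 0, fun t ht i => ?_⟩
  have hv : ∃ t' ∈ P, ∃ j, L.vert t' j = L.vert t i := ⟨t, ht, i, rfl⟩
  beta_reduce
  rw [dif_pos hv]
  exact h _ hv.choose_spec.1 _ ht _ _ hv.choose_spec.2.choose_spec

theorem BallRel.patchIso (h : BallRel L M dL dM t₀ u₀ n r) {P : Set L.T}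
    (hP : ∀ t ∈ P, L.InBall t₀ n t) : PatchIso L M dL dM P {u | ∃ t ∈ P, r t u} := by
  have : Nonempty M.T := ⟨u₀⟩
  have hτ : ∀ t, ∃ u, t ∈ P → r t u := by
    intro t
    by_cases ht : t ∈ P
    · obtain ⟨u, hu⟩ := h.left t (hP t ht)
      exact ⟨u, fun _ => hu⟩
    · exact ⟨u₀, fun h => absurd h ht⟩
  choose τ hτ using hτ
  obtain ⟨g, hg⟩ := exists_onV (M := M) (P := P) (τ := τ) fun t ht t' ht' i j e =>
    (h.vert_iff (hτ t ht) (hτ t' ht') i j).1 e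
  refine ⟨τ, g, ⟨fun t ht => ⟨t, ht, hτ t ht⟩, ?_, ?_⟩, ⟨?_, ?_, ?_⟩, fun t ht => ⟨⟨0, 1⟩, ?_, ?_⟩⟩
  · exact fun t ht t' ht' e => (h.eq_iff (hτ t ht) (hτ t' ht')).2 e
  · rintro u ⟨t, ht, hu⟩
    exact ⟨t, ht, (h.eq_iff (hτ t ht) hu).1 rfl⟩
  · rintro _ ⟨t, ht, i, rfl⟩
    exact ⟨τ t, ⟨t, ht, hτ t ht⟩, i, (hg t ht i).symm⟩
  · rintro _ ⟨t, ht, i, rfl⟩ _ ⟨t', ht', j, rfl⟩ e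
    rw [hg t ht, hg t' ht'] at e
    exact (h.vert_iff (hτ t ht) (hτ t' ht') i j).2 e
  · rintro _ ⟨u, ⟨t, ht, hu⟩, i, rfl⟩
    refine ⟨L.vert t i, ⟨t, ht, i, rfl⟩, ?_⟩
    rw [hg t ht, (h.eq_iff (hτ t ht) hu).1 rfl]
  · intro i
    rw [hg t ht]
    simp [PentSym.act]
  · intro f
    rw [h.dec (hτ t ht)]
    simp [PentSym.act, PentSym.actFlag]

theorem PatchIso.trans {P : Set L.T} {Q : Set M.T} {R : Set N.T}
    (h : PatchIso L M dL dM P Q) (h' : PatchIso M N dM dN Q R) : PatchIso L N dL dN P R := by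
  obtain ⟨τ, g, hτ, hg, hc⟩ := h
  obtain ⟨τ', g', hτ', hg', hc'⟩ := h'
  refine ⟨τ' ∘ τ, g' ∘ g, hτ'.comp hτ, hg'.comp hg, fun t ht => ?_⟩
  obtain ⟨σ, h1, h2⟩ := hc t ht
  obtain ⟨σ', h1', h2'⟩ := hc' (τ t) (hτ.mapsTo ht)
  refine ⟨⟨σ'.act σ.shift, σ'.sign * σ.sign⟩, fun i => ?_, fun f => ?_⟩
  · simp only [Function.comp, h1, h1']
    congr 1
    simp [PentSym.act]
    ring
  · rw [← h2, ← h2']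
    simp only [Function.comp]
    congr 1
    simp [PentSym.actFlag, PentSym.act, mul_assoc]
    ring

end PentComplex

/-! ## The limit of a family of complexes along an ultrafilter -/

/-- A family of decorated complexes with a distinguished tile and an enumeration of the tiles
around every tile. -/
structure PointedFamily (B D : Type*) where
  L : B → PentComplex
  dec : ∀ b, Decoration (L b) D
  base : ∀ b, (L b).T
  N : ℕ
  nbr : ∀ b, (L b).T → Fin N → (L b).T
  adj_iff : ∀ b s u, (L b).Adj s u ↔ ∃ k, nbr b s k = u

namespace PointedFamily

variable {B D : Type*} (S : PointedFamily B D) (F : Ultrafilter B)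

/-- The tile at the end of a chain of adjacent tiles. -/
def tile (b : B) (w : List (Fin S.N)) : (S.L b).T := w.foldl (S.nbr b) (S.base b)

theorem tile_append (b : B) (w : List (Fin S.N)) (k : Fin S.N) :
    S.tile b (w ++ [k]) = S.nbr b (S.tile b w) k := by
  simp [tile]

/-- Words that lead to the same tile for almost all indices. -/
def wordSetoid : Setoid (List (Fin S.N)) where
  r := fun w w' => ∀ᶠ b in F, S.tile b w = S.tile b w'
  iseqv := ⟨fun _ => Filter.Eventually.of_forall fun _ => rfl, fun h => h.mono fun _ => Eq.symm,
    fun h h' => (h.and h').mono fun _ e => e.1.trans e.2⟩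

/-- Words and indices that lead to the same vertex for almost all indices. -/
def vertSetoid : Setoid (List (Fin S.N) × ZMod 5) where
  r := fun a a' => ∀ᶠ b in F,
    (S.L b).vert (S.tile b a.1) a.2 = (S.L b).vert (S.tile b a'.1) a'.2
  iseqv := ⟨fun _ => Filter.Eventually.of_forall fun _ => rfl, fun h => h.mono fun _ => Eq.symm,
    fun h h' => (h.and h').mono fun _ e => e.1.trans e.2⟩

/-- The limit complex. -/
def lim : PentComplex where
  V := Quotient (S.vertSetoid F)
  T := Quotient (S.wordSetoid F)
  vert := fun x i => Quotient.lift (s := S.wordSetoid F) (fun w => Quotient.mk (S.vertSetoid F) (w, i))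
    (fun w w' (h : ∀ᶠ b in F, S.tile b w = S.tile b w') => Quotient.sound (h.mono fun b e => by
      change (S.L b).vert (S.tile b w) i = (S.L b).vert (S.tile b w') i
      rw [e])) x

/-- The tile of the limit complex given by a word. -/
def limTile (w : List (Fin S.N)) : (S.lim F).T := Quotient.mk (S.wordSetoid F) w

theorem exists_limTile (x : (S.lim F).T) : ∃ w, x = S.limTile F w := by
  obtain ⟨w, rfl⟩ := Quotient.exists_rep x
  exact ⟨w, rfl⟩

theorem limTile_eq {w w' : List (Fin S.N)} :
    S.limTile F w = S.limTile F w' ↔ ∀ᶠ b in F, S.tile b w = S.tile b w' :=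
  Quotient.eq (r := S.wordSetoid F)

theorem lim_vert_eq {w w' : List (Fin S.N)} {i j : ZMod 5} :
    (S.lim F).vert (S.limTile F w) i = (S.lim F).vert (S.limTile F w') j ↔
      ∀ᶠ b in F, (S.L b).vert (S.tile b w) i = (S.L b).vert (S.tile b w') j :=
  Quotient.eq (r := S.vertSetoid F)

/-- There are finitely many pairs of indices, so one of them works for almost all members of the
family. -/
theorem lim_adj_iff {w w' : List (Fin S.N)} :
    (S.lim F).Adj (S.limTile F w) (S.limTile F w') ↔
      ∀ᶠ b in F, (S.L b).Adj (S.tile b w) (S.tile b w') := by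
  unfold Adj
  simp only [lim_vert_eq, Ultrafilter.eventually_exists_iff]

/-- The number of the neighbour takes values in the finite set `Fin S.N`, hence is almost everywhere
constant. The limit therefore has no neighbours other than those reached by appending one letter. -/
theorem exists_of_lim_adj {w : List (Fin S.N)} {x : (S.lim F).T}
    (h : (S.lim F).Adj (S.limTile F w) x) : ∃ k, x = S.limTile F (w ++ [k]) := by
  obtain ⟨w', rfl⟩ := S.exists_limTile F x
  rw [lim_adj_iff] at h
  simp only [S.adj_iff, Ultrafilter.eventually_exists_iff] at h
  obtain ⟨k, hk⟩ := h
  exact ⟨k, (S.limTile_eq F).2 (hk.mono fun b e => by rw [tile_append, e])⟩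

theorem lim_adj_append (w : List (Fin S.N)) (k : Fin S.N) :
    (S.lim F).Adj (S.limTile F w) (S.limTile F (w ++ [k])) :=
  (S.lim_adj_iff F).2 (Filter.Eventually.of_forall fun b => (S.adj_iff b _ _).2
    ⟨k, (S.tile_append b w k).symm⟩)

theorem lim_inBall (w : List (Fin S.N)) :
    (S.lim F).InBall (S.limTile F []) w.length (S.limTile F w) := by
  induction w using List.reverseRecOn with
  | nil => exact InBall.base
  | append_singleton w k ih =>
    rw [List.length_append]
    exact ih.step (S.lim_adj_append F w k)

theorem exists_word_of_inBall {n : ℕ} {x : (S.lim F).T}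
    (h : (S.lim F).InBall (S.limTile F []) n x) : ∃ w, w.length ≤ n ∧ x = S.limTile F w := by
  induction h with
  | base => exact ⟨[], le_rfl, rfl⟩
  | step _ h2 ih =>
    obtain ⟨w, hw, rfl⟩ := ih
    obtain ⟨k, rfl⟩ := S.exists_of_lim_adj F h2
    exact ⟨_, by simpa using hw, rfl⟩

theorem exists_word_of_inBall_tile (b : B) {n : ℕ} {u : (S.L b).T}
    (h : (S.L b).InBall (S.base b) n u) : ∃ w, w.length ≤ n ∧ u = S.tile b w := by
  induction h with
  | base => exact ⟨[], le_rfl, rfl⟩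
  | step _ h2 ih =>
    obtain ⟨w, hw, rfl⟩ := ih
    obtain ⟨k, rfl⟩ := (S.adj_iff b _ _).1 h2
    exact ⟨w ++ [k], by simpa using hw, (S.tile_append b w k).symm⟩

section Decoration

variable [Finite D]

/-- The finiteness of `D` is needed here. -/
theorem exists_lim_dec (x : (S.lim F).T) (f : Flag) :
    ∃ c, ∀ᶠ b in F, S.dec b (S.tile b (Quotient.out x)) f = c :=
  Ultrafilter.eventually_exists_iff.1 (Filter.Eventually.of_forall fun _ => ⟨_, rfl⟩)

/-- The decoration of the limit complex. -/
def limDec : Decoration (S.lim F) D := fun x f => (S.exists_lim_dec F x f).choose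

theorem limDec_eq (w : List (Fin S.N)) (f : Flag) :
    ∀ᶠ b in F, S.limDec F (S.limTile F w) f = S.dec b (S.tile b w) f := by
  have h1 := (S.exists_lim_dec F (S.limTile F w) f).choose_spec
  have h2 : S.limTile F (Quotient.out (S.limTile F w)) = S.limTile F w := Quotient.out_eq _
  rw [limTile_eq] at h2
  filter_upwards [h1, h2] with b e1 e2
  rw [← e2, e1]
  rfl

/-- Every relation between words holds in the limit exactly when it holds almost everywhere, so
truth in the limit agrees with truth in almost every member. Finitely many relations between short
words are involved. -/
theorem eventually_ballRel (n : ℕ) : ∀ᶠ b in F, BallRel (S.lim F) (S.L b) (S.limDec F) (S.dec b)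
    (S.limTile F []) (S.base b) n
    (fun x u => ∃ w, w.length ≤ n ∧ x = S.limTile F w ∧ u = S.tile b w) := by
  have fin : {w : List (Fin S.N) | w.length ≤ n}.Finite := List.finite_length_le _ n
  have key : ∀ {p : Prop} {q : B → Prop}, (p ↔ ∀ᶠ b in F, q b) → ∀ᶠ b in F, (p ↔ q b) := by
    intro p q h
    by_cases hp : p
    · exact (h.1 hp).mono fun b hb => by simp [hp, hb]
    · have := mt h.2 hp
      rw [← Ultrafilter.eventually_not] at this
      exact this.mono fun b hb => by simp [hp, hb]
  have h1 := (Filter.eventually_all_finite fin).2 fun w (_ : w.length ≤ n) =>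
    (Filter.eventually_all_finite fin).2 fun w' (_ : w'.length ≤ n) => key (S.limTile_eq F (w := w) (w' := w'))
  have h2 := (Filter.eventually_all_finite fin).2 fun w (_ : w.length ≤ n) =>
    (Filter.eventually_all_finite fin).2 fun w' (_ : w'.length ≤ n) => Filter.eventually_all.2 fun i =>
      Filter.eventually_all.2 fun j => key (S.lim_vert_eq F (w := w) (w' := w') (i := i) (j := j))
  have h3 := (Filter.eventually_all_finite fin).2 fun w (_ : w.length ≤ n) =>
    Filter.eventually_all.2 fun f => S.limDec_eq F w f
  filter_upwards [h1, h2, h3] with b h1 h2 h3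
  refine ⟨⟨[], Nat.zero_le n, rfl, rfl⟩, fun x hx => ?_, fun u hu => ?_, ?_, ?_, ?_⟩
  · obtain ⟨w, hw, rfl⟩ := S.exists_word_of_inBall F hx
    exact ⟨_, w, hw, rfl, rfl⟩
  · obtain ⟨w, hw, rfl⟩ := S.exists_word_of_inBall_tile b hu
    exact ⟨_, w, hw, rfl, rfl⟩
  · rintro _ _ _ _ ⟨w, hw, rfl, rfl⟩ ⟨w', hw', rfl, rfl⟩
    exact h1 w hw w' hw'
  · rintro _ _ _ _ ⟨w, hw, rfl, rfl⟩ ⟨w', hw', rfl, rfl⟩ i j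
    exact h2 w hw w' hw' i j
  · rintro _ _ ⟨w, hw, rfl, rfl⟩
    exact funext (h3 w hw)

/-- A finite patch of the limit lies in a ball, which is matched with a ball of a single member of
the family. -/
theorem lim_locallyIsomorphic {δ : Decoration K D}
    (h : ∀ b, (S.L b).LocallyIsomorphic K (S.dec b) δ) :
    (S.lim F).LocallyIsomorphic K (S.limDec F) δ := by
  intro P hP
  choose w hw using S.exists_limTile F
  obtain ⟨n, hn⟩ : ∃ n, ∀ x ∈ P, (w x).length ≤ n := by
    obtain ⟨n, hn⟩ := (hP.image fun x => (w x).length).bddAbove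
    exact ⟨n, fun x hx => hn ⟨x, hx, rfl⟩⟩
  obtain ⟨b, hb⟩ := (S.eventually_ballRel F n).exists
  have hiso := hb.patchIso (P := P) fun x hx => by
    have := S.lim_inBall F (w x)
    rw [← hw] at this
    exact this.mono (hn x hx)
  have hfin := hiso
  obtain ⟨τ, -, hτ, -⟩ := hfin
  obtain ⟨R, hR, hR'⟩ := h b _ (hτ.image_eq ▸ hP.image τ)
  exact ⟨R, hR, hiso.trans hR'⟩

end Decoration

theorem lim_noBoundary (h : ∀ b, (S.L b).NoBoundary) : (S.lim F).NoBoundary := by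
  intro x i η
  obtain ⟨w, rfl⟩ := S.exists_limTile F x
  have : ∀ᶠ b in F, ∃ (k : Fin S.N) (j : ZMod 5) (ζ : ℤˣ), S.tile b (w ++ [k]) ≠ S.tile b w ∧
      (S.L b).vert (S.tile b (w ++ [k])) j = (S.L b).vert (S.tile b w) i ∧
      (S.L b).vert (S.tile b (w ++ [k])) (j + ((ζ : ℤ) : ZMod 5)) =
        (S.L b).vert (S.tile b w) (i + ((η : ℤ) : ZMod 5)) := by
    refine Filter.Eventually.of_forall fun b => ?_
    obtain ⟨t', j, ζ, h1, h2, h3⟩ := h b (S.tile b w) i η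
    obtain ⟨k, rfl⟩ := (S.adj_iff b (S.tile b w) t').1 ⟨i, j, h2.symm⟩
    exact ⟨k, j, ζ, by rwa [tile_append], by rwa [tile_append], by rwa [tile_append]⟩
  simp only [Ultrafilter.eventually_exists_iff] at this
  obtain ⟨k, j, ζ, hk⟩ := this
  refine ⟨S.limTile F (w ++ [k]), j, ζ, ?_, ?_, ?_⟩
  · rw [ne_eq, limTile_eq, ← Ultrafilter.eventually_not]
    exact hk.mono fun b h => h.1
  · exact (S.lim_vert_eq F).2 (hk.mono fun b h => h.2.1)
  · exact (S.lim_vert_eq F).2 (hk.mono fun b h => h.2.2)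

end PointedFamily

end PentHull
namespace PentHull

open PentComplex Topology

namespace PentComplex

variable {L M : PentComplex}

/-! ## The path metric -/

theorem PathLen.nonneg {x y : L.Space} {l : ℝ} (h : L.PathLen x y l) : 0 ≤ l := by
  induction h with
  | nil => exact le_rfl
  | cons t p q _ ih => exact add_nonneg dist_nonneg ih

theorem PathLen.single (t : L.T) (p q : Pentagon) : L.PathLen (L.pt t p) (L.pt t q) (dist p q) := by
  simpa using PathLen.cons t p q (PathLen.nil (L.pt t q))

theorem PathLen.trans {x y z : L.Space} {l l' : ℝ} (h : L.PathLen x y l) (h' : L.PathLen y z l') :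
    L.PathLen x z (l + l') := by
  induction h with
  | nil => simpa using h'
  | cons t p q _ ih =>
    rw [add_assoc]
    exact PathLen.cons t p q (ih h')

theorem PathLen.symm {x y : L.Space} {l : ℝ} (h : L.PathLen x y l) : L.PathLen y x l := by
  induction h with
  | nil x => exact PathLen.nil x
  | cons t p q _ ih =>
    rw [add_comm, dist_comm]
    exact ih.trans (PathLen.single t q p)

theorem exists_pathLen_of_inBall {t₀ t : L.T} {n : ℕ} (h : L.InBall t₀ n t) (p q : Pentagon) :
    ∃ l, L.PathLen (L.pt t₀ p) (L.pt t q) l := by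
  induction h generalizing q with
  | base => exact ⟨_, PathLen.single _ _ _⟩
  | step _ h2 ih =>
    obtain ⟨i, j, e⟩ := h2
    obtain ⟨l, hl⟩ := ih (corner i)
    have : L.pt _ (corner i) = L.pt _ (corner j) := Quot.sound (Glue.vertex e)
    rw [this] at hl
    exact ⟨_, hl.trans (PathLen.single _ _ q)⟩

/-- The tiles are joined by chains of adjacent tiles. -/
def TileConnected (L : PentComplex) : Prop := ∀ t t', ∃ n, L.InBall t n t'

theorem TileConnected.exists_pathLen (h : L.TileConnected) (x y : L.Space) :
    ∃ l, L.PathLen x y l := by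
  obtain ⟨t, p, rfl⟩ := L.exists_pt x
  obtain ⟨t', p', rfl⟩ := L.exists_pt y
  obtain ⟨n, hn⟩ := h t t'
  exact exists_pathLen_of_inBall hn p p'

theorem PathLen.affDist_le {x y : L.Space} {l : ℝ} (h : L.PathLen x y l) : L.affDist x y ≤ l :=
  csInf_le ⟨0, fun _ h => PathLen.nonneg h⟩ h

/-- Connectedness matters because `sInf ∅ = 0`: without a path the distance would be zero. -/
theorem TileConnected.le_affDist (h : L.TileConnected) {x y : L.Space} {c : ℝ}
    (hc : ∀ l, L.PathLen x y l → c ≤ l) : c ≤ L.affDist x y :=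
  le_csInf (h.exists_pathLen x y) hc

theorem TileConnected.exists_pathLen_lt (h : L.TileConnected) {x y : L.Space} {c : ℝ}
    (hc : L.affDist x y < c) : ∃ l, L.PathLen x y l ∧ l < c :=
  exists_lt_of_csInf_lt (h.exists_pathLen x y) hc

theorem affDist_nonneg (x y : L.Space) : 0 ≤ L.affDist x y :=
  Real.sInf_nonneg fun _ h => PathLen.nonneg h

theorem affDist_self (x : L.Space) : L.affDist x x = 0 :=
  le_antisymm (PathLen.nil x).affDist_le (affDist_nonneg x x)

theorem affDist_comm (x y : L.Space) : L.affDist x y = L.affDist y x := by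
  unfold affDist
  congr 1
  ext l
  exact ⟨PathLen.symm, PathLen.symm⟩

theorem TileConnected.affDist_triangle (h : L.TileConnected) (x y z : L.Space) :
    L.affDist x z ≤ L.affDist x y + L.affDist y z := by
  refine le_of_forall_pos_le_add fun δ hδ => ?_
  obtain ⟨l, hl, h1⟩ := h.exists_pathLen_lt (lt_add_of_pos_right (L.affDist x y) (half_pos hδ))
  obtain ⟨l', hl', h2⟩ := h.exists_pathLen_lt (lt_add_of_pos_right (L.affDist y z) (half_pos hδ))
  have := (hl.trans hl').affDist_le
  linarith

/-- The function is Lipschitz on every tile. -/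
def TileLip (L : PentComplex) (C : ℝ) (G : L.Space → ℝ) : Prop :=
  ∀ t p q, G (L.pt t p) ≤ G (L.pt t q) + C * dist p q

theorem TileLip.le_of_pathLen {C : ℝ} {G : L.Space → ℝ} (hG : L.TileLip C G) {x y : L.Space}
    {l : ℝ} (h : L.PathLen x y l) : G x ≤ G y + C * l := by
  induction h with
  | nil => simp
  | cons t p q _ ih =>
    have := hG t p q
    rw [mul_add]
    linarith

theorem TileLip.le_affDist {C : ℝ} (hC : 0 < C) {G : L.Space → ℝ} (hG : L.TileLip C G)
    (h : L.TileConnected) (x y : L.Space) : G x ≤ G y + C * L.affDist x y := by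
  have := h.le_affDist (x := x) (y := y) (c := (G x - G y) / C) fun l hl => by
    rw [div_le_iff₀ hC]
    linarith [hG.le_of_pathLen hl]
  rw [div_le_iff₀ hC] at this
  linarith

/-! ### Lower envelopes of cones at the vertices -/

/-- The lower envelope, on a tile, of cones at the vertices. -/
def coneP (a : L.V → ℝ) (C : ℝ) (t : L.T) (p : Pentagon) : ℝ :=
  Finset.univ.inf' ⟨0, Finset.mem_univ _⟩ fun i => a (L.vert t i) + C * dist p (corner i)

theorem coneP_le (a : L.V → ℝ) (C : ℝ) (t : L.T) (p : Pentagon) (i : ZMod 5) :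
    coneP a C t p ≤ a (L.vert t i) + C * dist p (corner i) :=
  Finset.inf'_le _ (Finset.mem_univ i)

theorem exists_coneP_eq (a : L.V → ℝ) (C : ℝ) (t : L.T) (p : Pentagon) :
    ∃ i, coneP a C t p = a (L.vert t i) + C * dist p (corner i) := by
  obtain ⟨i, -, h⟩ := Finset.exists_mem_eq_inf' (s := Finset.univ) ⟨(0 : ZMod 5), Finset.mem_univ _⟩
    fun i => a (L.vert t i) + C * dist p (corner i)
  exact ⟨i, h⟩

/-- A third corner is at distance at least one from the edge, so its cone is there at least `C / 2`
above the values at both ends, whereas the nearer end contributes at most `C / 2`. Only the two ends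
matter, and the envelope respects the gluing. -/
theorem coneP_edgePt {a : L.V → ℝ} {C : ℝ} (hC : 0 ≤ C)
    (ha : ∀ t i k, a (L.vert t i) ≤ a (L.vert t k) + C / 2) (t : L.T) (i : ZMod 5) (η : ℤˣ)
    (s : unitInterval) : coneP a C t (edgePt i η s) = min (a (L.vert t i) + C * s)
      (a (L.vert t (i + ((η : ℤ) : ZMod 5))) + C * (1 - s)) := by
  apply le_antisymm
  · refine le_min ?_ ?_
    · have := coneP_le a C t (edgePt i η s) i
      rwa [dist_edgePt_left] at this
    · have := coneP_le a C t (edgePt i η s) (i + ((η : ℤ) : ZMod 5))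
      rwa [dist_edgePt_right] at this
  · obtain ⟨k, hk⟩ := exists_coneP_eq a C t (edgePt i η s)
    rw [hk]
    by_cases h1 : k = i
    · rw [h1, dist_edgePt_left]
      exact min_le_left _ _
    by_cases h2 : k = i + ((η : ℤ) : ZMod 5)
    · rw [h2, dist_edgePt_right]
      exact min_le_right _ _
    have h3 := mul_le_mul_of_nonneg_left (one_le_dist_edgePt η s h1 h2) hC
    have h4 := ha t i k
    have h5 := ha t (i + ((η : ℤ) : ZMod 5)) k
    by_contra! hcon
    rw [lt_min_iff] at hcon
    linarith [hcon.1, hcon.2]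

theorem exists_cone_function {a : L.V → ℝ} {C : ℝ} (hC : 0 ≤ C)
    (ha : ∀ t i k, a (L.vert t i) ≤ a (L.vert t k) + C / 2) :
    ∃ G : L.Space → ℝ, (∀ t p, G (L.pt t p) = coneP a C t p) ∧ L.TileLip C G := by
  refine ⟨Quot.lift (fun x => coneP a C x.1 x.2) fun x y h => ?_, fun _ _ => rfl, fun t p q => ?_⟩
  · cases h with
    | @vertex t t' i j h =>
      simp only
      rw [← edgePt_zero i 1, ← edgePt_zero j 1, coneP_edgePt hC ha, coneP_edgePt hC ha, h]
      have h1 := ha t' j (j + 1)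
      have h2 := ha t i (i + 1)
      rw [h] at h2
      simp only [Set.Icc.coe_zero, mul_zero, add_zero, sub_zero, mul_one, Units.val_one,
        Int.cast_one]
      rw [min_eq_left (by linarith), min_eq_left (by linarith)]
    | edge η h₀ h₁ s =>
      simp only [coneP_edgePt hC ha, h₀, h₁, Units.val_one, Int.cast_one]
  · change coneP a C t p ≤ coneP a C t q + C * dist p q
    obtain ⟨i, hi⟩ := exists_coneP_eq a C t q
    have h1 := coneP_le a C t p i
    have h2 := mul_le_mul_of_nonneg_left (dist_triangle p q (corner i)) hC
    rw [hi]
    linarith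

/-- A Lipschitz function that controls the number of tiles between a vertex and a point. -/
theorem TileConnected.exists_level (h : L.TileConnected) (t₀ : L.T) : ∃ G : L.Space → ℝ,
    L.TileLip 2 G ∧ (∀ i, G (L.pt t₀ (corner i)) ≤ 0) ∧
      ∀ t p (m : ℕ), G (L.pt t p) < m → L.InBall t₀ (m + 1) t := by
  let lev : L.V → ℕ := fun v => sInf {n | ∃ t i, L.InBall t₀ n t ∧ L.vert t i = v}
  have hmem : ∀ t i, lev (L.vert t i) ∈ {n | ∃ t' j, L.InBall t₀ n t' ∧ L.vert t' j = L.vert t i} := by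
    intro t i
    obtain ⟨n, hn⟩ := h t₀ t
    exact Nat.sInf_mem ⟨n, t, i, hn, rfl⟩
  have hball : ∀ t i, L.InBall t₀ (lev (L.vert t i) + 1) t := by
    intro t i
    obtain ⟨t', j, h1, h2⟩ := hmem t i
    exact h1.step ⟨j, i, h2⟩
  -- The slope 2 is chosen because levels within one tile differ by at most one, and cones are
  -- compatible with the gluing for differences up to half the slope.
  have ha : ∀ t i k, ((lev (L.vert t i) : ℕ) : ℝ) ≤ (lev (L.vert t k) : ℕ) + 2 / 2 := by
    intro t i k
    have : lev (L.vert t i) ≤ lev (L.vert t k) + 1 := Nat.sInf_le ⟨t, i, hball t k, rfl⟩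
    rw [div_self (by norm_num)]
    exact_mod_cast this
  obtain ⟨G, hG, hG'⟩ := exists_cone_function (a := fun v => ((lev v : ℕ) : ℝ)) (C := 2)
    (by norm_num) ha
  refine ⟨G, hG', fun i => ?_, fun t p m hm => ?_⟩
  · rw [hG]
    refine (coneP_le _ _ _ _ i).trans ?_
    have : lev (L.vert t₀ i) ≤ 0 := Nat.sInf_le ⟨t₀, i, InBall.base, rfl⟩
    simp [Nat.le_zero.1 this]
  · rw [hG] at hm
    obtain ⟨i, hi⟩ := exists_coneP_eq (fun v => ((lev v : ℕ) : ℝ)) 2 t p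
    rw [hi] at hm
    have h1 : ((lev (L.vert t i) : ℕ) : ℝ) < m := by
      have := dist_nonneg (x := p) (y := corner i)
      linarith
    have h2 : lev (L.vert t i) < m := by exact_mod_cast h1
    exact (hball t i).mono (by omega)

/-! ### Degrees -/

theorem degree_eq_ncard (v : L.V) : L.degree v = {w | ∃ t i, ∃ η : ℤˣ, L.vert t i = v ∧
    L.vert t (i + ((η : ℤ) : ZMod 5)) = w}.ncard := by
  have : {e | e ∈ L.edges ∧ v ∈ e} = (fun w => s(v, w)) '' {w | ∃ t i, ∃ η : ℤˣ, L.vert t i = v ∧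
      L.vert t (i + ((η : ℤ) : ZMod 5)) = w} := by
    ext e
    constructor
    · rintro ⟨⟨t, i, rfl⟩, hv⟩
      rcases Sym2.mem_iff.1 hv with rfl | rfl
      · exact ⟨_, ⟨t, i, 1, rfl, rfl⟩, by simp⟩
      · exact ⟨_, ⟨t, i + 1, -1, rfl, rfl⟩, by simp [Sym2.eq_swap]⟩
    · rintro ⟨w, ⟨t, i, η, rfl, rfl⟩, rfl⟩
      refine ⟨?_, Sym2.mem_mk_left _ _⟩
      rcases Int.units_eq_one_or η with rfl | rfl
      · exact ⟨t, i, by simp⟩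
      · exact ⟨t, i - 1, by simp [Sym2.eq_swap, ← sub_eq_add_neg]⟩
  unfold degree
  rw [this, ncard_image_of_injective _ fun w w' h => Sym2.congr_right.1 h]

variable {D : Type*} {dL : Decoration L D} {dM : Decoration M D} {t₀ : L.T} {u₀ : M.T} {n : ℕ}
  {r : L.T → M.T → Prop}

/-- One more ring of tiles than `t` requires ensures that all tiles at the vertex are matched. -/
theorem BallRel.degree_eq (h : BallRel L M dL dM t₀ u₀ n r) {m : ℕ} (hm : m + 1 ≤ n) {t : L.T}
    (ht : L.InBall t₀ m t) {u : M.T} (hu : r t u) (i : ZMod 5) :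
    L.degree (L.vert t i) = M.degree (M.vert u i) := by
  have hne : Nonempty M.T := ⟨u₀⟩
  have hτ : ∀ t, ∃ u, L.InBall t₀ n t → r t u := by
    intro t
    by_cases ht : L.InBall t₀ n t
    · obtain ⟨u, hu⟩ := h.left t ht
      exact ⟨u, fun _ => hu⟩
    · exact ⟨u₀, fun h => absurd h ht⟩
  choose τ hτ using hτ
  obtain ⟨g, hg⟩ := exists_onV (M := M) (P := {t | L.InBall t₀ n t}) (τ := τ)
    fun t ht t' ht' i j e => (h.vert_iff (hτ t ht) (hτ t' ht') i j).1 e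
  have hru : ∀ {t u}, L.InBall t₀ n t → r t u → τ t = u := fun ht hu =>
    (h.eq_iff (hτ _ ht) hu).1 rfl
  have hnb : ∀ t' j, L.vert t' j = L.vert t i → L.InBall t₀ n t' := fun t' j e =>
    (ht.step ⟨i, j, e.symm⟩).mono hm
  have key : {w | ∃ t' j, ∃ η : ℤˣ, M.vert t' j = M.vert u i ∧
      M.vert t' (j + ((η : ℤ) : ZMod 5)) = w} = g '' {w | ∃ t' j, ∃ η : ℤˣ,
        L.vert t' j = L.vert t i ∧ L.vert t' (j + ((η : ℤ) : ZMod 5)) = w} := by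
    ext w
    constructor
    · rintro ⟨u', j, η, e, rfl⟩
      have hu' : M.InBall u₀ (m + 1) u' := (h.inBall (by omega) ht hu).step ⟨i, j, e.symm⟩
      obtain ⟨t', ht'⟩ := h.right u' (hu'.mono hm)
      have e' := (h.vert_iff ht' hu j i).2 e
      refine ⟨_, ⟨t', j, η, e', rfl⟩, ?_⟩
      rw [hg t' (hnb t' j e'), hru (hnb t' j e') ht']
    · rintro ⟨_, ⟨t', j, η, e, rfl⟩, rfl⟩
      have ht' := hτ t' (hnb t' j e)
      exact ⟨τ t', j, η, (h.vert_iff ht' hu j i).1 e, (hg t' (hnb t' j e) _).symm⟩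
  rw [degree_eq_ncard, degree_eq_ncard, key, InjOn.ncard_image]
  rintro _ ⟨t', j, η, e, rfl⟩ _ ⟨t'', j', η', e', rfl⟩ he
  rw [hg t' (hnb t' j e), hg t'' (hnb t'' j' e')] at he
  exact (h.vert_iff (hτ t' (hnb t' j e)) (hτ t'' (hnb t'' j' e')) _ _).2 he

/-! ### Transfer of paths -/

theorem BallRel.exists_map (h : BallRel L M dL dM t₀ u₀ n r) (hL : L.InjVert) :
    ∃ φ : L.Space → M.Space, ∀ t u p, r t u → φ (L.pt t p) = M.pt u p := by
  classical
  refine ⟨fun x => if hx : ∃ t u p, x = L.pt t p ∧ r t u then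
    M.pt hx.choose_spec.choose hx.choose_spec.choose_spec.choose else M.pt u₀ centre,
    fun t u p hu => ?_⟩
  have hx : ∃ t' u' p', L.pt t p = L.pt t' p' ∧ r t' u' := ⟨t, u, p, rfl, hu⟩
  beta_reduce
  rw [dif_pos hx]
  obtain ⟨e, hr⟩ := hx.choose_spec.choose_spec.choose_spec
  generalize hx.choose_spec.choose_spec.choose = p' at *
  generalize hx.choose_spec.choose = u' at *
  generalize hx.choose = t' at *
  rcases (pt_eq_iff hL).1 e with ⟨rfl, rfl⟩ | hglue
  · rw [(h.eq_iff hu hr).1 rfl]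
  · refine (Quot.sound ?_).symm
    cases hglue with
    | vertex h₀ => exact Glue.vertex ((h.vert_iff hu hr _ _).1 h₀)
    | edge η h₀ h₁ s =>
      exact Glue.edge η ((h.vert_iff hu hr _ _).1 h₀) ((h.vert_iff hu hr _ _).1 h₁) s

/-- A path that ends at a low value of `G` and is short stays where `G ≤ m`, hence inside the
matched tiles, and each of its segments can be copied. -/
theorem BallRel.pathLen (h : BallRel L M dL dM t₀ u₀ n r) {φ : L.Space → M.Space}
    (hφ : ∀ t u p, r t u → φ (L.pt t p) = M.pt u p) {G : L.Space → ℝ} (hG : L.TileLip 2 G) {m : ℝ}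
    (hm : ∀ t p, G (L.pt t p) ≤ m → L.InBall t₀ n t) {y z : L.Space} {l : ℝ}
    (hl : L.PathLen y z l) (hz : G z + 2 * l ≤ m) : M.PathLen (φ y) (φ z) l := by
  induction hl with
  | nil => exact PathLen.nil _
  | @cons t p q z l hl ih =>
    have h1 := hG.le_of_pathLen (PathLen.cons t p q hl)
    obtain ⟨u, hu⟩ := h.left t (hm t p (h1.trans hz))
    have h2 := ih (by linarith [dist_nonneg (x := p) (y := q)])
    rw [hφ t u q hu] at h2
    rw [hφ t u p hu]
    exact PathLen.cons u p q h2

theorem BallRel.affDist_le (h : BallRel L M dL dM t₀ u₀ n r) (hL : L.TileConnected)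
    {φ : L.Space → M.Space} (hφ : ∀ t u p, r t u → φ (L.pt t p) = M.pt u p) {i : ZMod 5} {ρ : ℝ}
    (hn : 6 * ρ + 5 ≤ n) {y z : L.Space} (hy : y ∈ L.ball (L.pt t₀ (corner i)) ρ)
    (hz : z ∈ L.ball (L.pt t₀ (corner i)) ρ) : M.affDist (φ y) (φ z) ≤ L.affDist y z := by
  obtain ⟨G, hG, hG0, hGb⟩ := hL.exists_level t₀
  have hz' := hG.le_affDist two_pos hL z (L.pt t₀ (corner i))
  rw [affDist_comm] at hz'
  have hyz := hL.affDist_triangle y (L.pt t₀ (corner i)) z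
  rw [affDist_comm y (L.pt t₀ (corner i))] at hyz
  have h0 := hG0 i
  have hy2 : L.affDist (L.pt t₀ (corner i)) y ≤ ρ := hy
  have hz2 : L.affDist (L.pt t₀ (corner i)) z ≤ ρ := hz
  refine le_of_forall_pos_lt_add fun δ hδ => ?_
  obtain ⟨l, hl, h1⟩ := hL.exists_pathLen_lt (lt_add_of_pos_right (L.affDist y z)
    (lt_min hδ one_pos))
  have h2 := min_le_left δ 1
  have h3 := min_le_right δ 1
  -- Here `G z ≤ 2 * ρ` and the path has length below `2 * ρ + 1`, so along it `G ≤ 6 * ρ + 2 ≤ n -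
  -- 2`; its tiles are therefore within `n` steps of `t₀`.
  refine ((h.pathLen hφ hG (m := n - 2) (fun t p ht => ?_) hl (by linarith)).affDist_le).trans_lt
    (by linarith)
  have hn1 : 2 ≤ n := by
    have : (2 : ℝ) ≤ n := by linarith [affDist_nonneg (L.pt t₀ (corner i)) y]
    exact_mod_cast this
  have := hGb t p (n - 1) (by
    rw [Nat.cast_sub (by omega)]
    push_cast
    linarith)
  exact this.mono (by omega)

theorem TileConnected.inBall_of_mem_ball (hL : L.TileConnected) {i : ZMod 5} {ρ : ℝ} {m : ℕ}
    (hm : 2 * ρ + 2 ≤ m) {t : L.T} {p : Pentagon} (h : L.pt t p ∈ L.ball (L.pt t₀ (corner i)) ρ) :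
    L.InBall t₀ m t := by
  obtain ⟨G, hG, hG0, hGb⟩ := hL.exists_level t₀
  have hz' := hG.le_affDist two_pos hL (L.pt t p) (L.pt t₀ (corner i))
  rw [affDist_comm] at hz'
  have h0 := hG0 i
  have h1 : L.affDist (L.pt t₀ (corner i)) (L.pt t p) ≤ ρ := h
  have hn1 : 2 ≤ m := by
    have : (2 : ℝ) ≤ m := by linarith [affDist_nonneg (L.pt t₀ (corner i)) (L.pt t p)]
    exact_mod_cast this
  have := hGb t p (m - 1) (by
    rw [Nat.cast_sub (by omega)]
    push_cast
    linarith)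
  exact this.mono (by omega)

/-- The map given by the matching does not increase distances on the ball, nor does the map of the
reversed matching, and the second undoes the first. -/
theorem BallRel.exists_isometry (h : BallRel L M dL dM t₀ u₀ n r) (hL : L.TileConnected)
    (hM : M.TileConnected) (hL' : L.InjVert) (hM' : M.InjVert) {i : ZMod 5} {ρ : ℝ} (hρ : 0 ≤ ρ)
    (hn : 6 * ρ + 5 ≤ n) : ∃ φ : L.Space → M.Space,
      IsCellMapOn dL dM (L.ball (L.pt t₀ (corner i)) ρ) φ ∧
      (∀ y ∈ L.ball (L.pt t₀ (corner i)) ρ, ∀ z ∈ L.ball (L.pt t₀ (corner i)) ρ,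
        M.affDist (φ y) (φ z) = L.affDist y z) ∧
      PreservesDegreeOn (L.ball (L.pt t₀ (corner i)) ρ) φ ∧
      φ (L.pt t₀ (corner i)) = M.pt u₀ (corner i) := by
  obtain ⟨φ, hφ⟩ := h.exists_map hL'
  obtain ⟨φ', hφ'⟩ := h.symm.exists_map hM'
  obtain ⟨m, rfl⟩ : ∃ m, n = m + 1 := by
    have : (1 : ℝ) ≤ n := by linarith
    have : 1 ≤ n := by exact_mod_cast this
    exact ⟨n - 1, by omega⟩
  push_cast at hn
  have hin : ∀ t p, L.pt t p ∈ L.ball (L.pt t₀ (corner i)) ρ → L.InBall t₀ m t := fun t p hp =>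
    hL.inBall_of_mem_ball (by linarith) hp
  have hbase : φ (L.pt t₀ (corner i)) = M.pt u₀ (corner i) := hφ _ _ _ h.base
  have hmem : L.pt t₀ (corner i) ∈ L.ball (L.pt t₀ (corner i)) ρ := by
    change L.affDist _ _ ≤ ρ
    rwa [affDist_self]
  have hle : ∀ y ∈ L.ball (L.pt t₀ (corner i)) ρ, ∀ z ∈ L.ball (L.pt t₀ (corner i)) ρ,
      M.affDist (φ y) (φ z) ≤ L.affDist y z := fun y hy z hz =>
    h.affDist_le hL hφ (by push_cast; linarith) hy hz
  have hmaps : ∀ y ∈ L.ball (L.pt t₀ (corner i)) ρ, φ y ∈ M.ball (M.pt u₀ (corner i)) ρ := by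
    intro y hy
    change M.affDist _ _ ≤ ρ
    rw [← hbase]
    exact (hle _ hmem y hy).trans hy
  have hinv : ∀ y ∈ L.ball (L.pt t₀ (corner i)) ρ, φ' (φ y) = y := by
    intro y hy
    obtain ⟨t, p, rfl⟩ := L.exists_pt y
    obtain ⟨u, hu⟩ := h.left t ((hin t p hy).mono (Nat.le_succ m))
    rw [hφ t u p hu, hφ' u t p hu]
  refine ⟨φ, ?_, ?_, ?_, hbase⟩
  · rintro t ⟨p, -, hp⟩
    obtain ⟨u, hu⟩ := h.left t ((hin t p hp).mono (Nat.le_succ m))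
    refine ⟨u, ⟨0, 1⟩, IsometryEquiv.refl _, fun i => ?_, fun p _ => hφ t u p hu, fun f => ?_⟩
    · rw [show PentSym.act ⟨0, 1⟩ i = i by simp [PentSym.act]]
      rfl
    · rw [h.dec hu]
      simp [PentSym.act, PentSym.actFlag]
  · intro y hy z hz
    refine le_antisymm (hle y hy z hz) ?_
    have := h.symm.affDist_le hM hφ' (by push_cast; linarith) (hmaps y hy) (hmaps z hz)
    rwa [hinv y hy, hinv z hz] at this
  · intro t j t' j' hp he
    obtain ⟨u, hu⟩ := h.left t ((hin t _ hp).mono (Nat.le_succ m))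
    rw [hφ t u _ hu] at he
    rw [h.degree_eq le_rfl (hin t _ hp) hu, vert_eq_of_pt_corner_eq he]

end PentComplex

end PentHull
namespace PentHull

open PentComplex Topology

/-! ## The hull -/

theorem exists_range_eq_of_encard_le {α : Type*} {s : Set α} (hs : s.Nonempty) {N : ℕ}
    (h : s.encard ≤ N) : ∃ f : Fin N → α, ∀ a, a ∈ s ↔ ∃ k, f k = a := by
  have hfin : s.Finite := finite_of_encard_le_coe h
  have : Fintype s := hfin.fintype
  have : Nonempty s := hs.to_subtype
  have hc : Fintype.card s ≤ Fintype.card (Fin N) := by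
    rw [Fintype.card_fin, ← Nat.card_eq_fintype_card, Nat.card_coe_set_eq]
    have := hfin.cast_ncard_eq ▸ h
    exact_mod_cast this
  obtain ⟨e⟩ := Function.Embedding.nonempty_of_card_le hc
  refine ⟨fun k => (Function.invFun e k : s), fun a => ⟨fun ha => ⟨e ⟨a, ha⟩, ?_⟩, ?_⟩⟩
  · exact congrArg Subtype.val (Function.leftInverse_invFun e.injective ⟨a, ha⟩)
  · rintro ⟨k, rfl⟩
    exact Subtype.property _

universe u

variable {D : Type u} {δ : Decoration K D}

namespace Tiling

theorem locEmb (X : Tiling δ) : X.cpx.LocEmb K := X.locIso.locEmb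

theorem injVert (X : Tiling δ) : X.cpx.InjVert := X.locEmb.injVert K_injVert

theorem nonempty_homeomorph (X : Tiling δ) : Nonempty (X.cpx.Space ≃ₜ ℂ) := by
  obtain ⟨h⟩ := X.plane
  exact ⟨h.trans Complex.orthonormalBasisOneI.repr.toHomeomorph.symm⟩

theorem noBoundary (X : Tiling δ) : X.cpx.NoBoundary := by
  obtain ⟨h⟩ := X.nonempty_homeomorph
  exact noBoundary_of_plane X.injVert h

theorem tileConnected (X : Tiling δ) : X.cpx.TileConnected := by
  obtain ⟨h⟩ := X.nonempty_homeomorph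
  have : PreconnectedSpace X.cpx.Space :=
    h.symm.surjective.denseRange.preconnectedSpace h.symm.continuous
  exact fun t t' => exists_inBall_of_preconnected X.injVert t t'

theorem exists_nbr (X : Tiling δ) :
    ∃ nbr : X.cpx.T → Fin 20 → X.cpx.T, ∀ t u, X.cpx.Adj t u ↔ ∃ k, nbr t k = u := by
  choose f hf using fun t => exists_range_eq_of_encard_le (s := {u | X.cpx.Adj t u}) (N := 20)
    ⟨t, 0, 0, rfl⟩ (X.locEmb.encard_adj_le K_full t)
  exact ⟨f, hf⟩

/-- A connected complex without boundary that is locally isomorphic to `K` is a tiling. -/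
def ofNoBoundary {L : PentComplex} {d : Decoration L D} (h : L.LocallyIsomorphic K d δ)
    (hN : L.NoBoundary) (t₀ : L.T) (hc : ∀ t, ∃ n, L.InBall t₀ n t) : Tiling δ where
  cpx := L
  dec := d
  plane := by
    obtain ⟨e⟩ := h.locEmb.nonempty_homeomorph hN t₀ hc
    exact ⟨e.trans Complex.orthonormalBasisOneI.repr.toHomeomorph⟩
  locIso := h

end Tiling

/-! ### The metric of the hull -/

theorem zero_lt_of_mem_insert_Lam {a b : Omega δ} {x : ℝ}
    (h : x ∈ insert (1 / Real.sqrt 2) (Lam a b)) : 0 < x := by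
  rcases h with rfl | h
  · positivity
  · exact h.1

theorem hullDist_le {a b : Omega δ} {ε : ℝ} (h : ε ∈ Lam a b) : hullDist a b ≤ ε :=
  csInf_le ⟨0, fun _ hx => (zero_lt_of_mem_insert_Lam hx).le⟩ (mem_insert_of_mem _ h)

theorem exists_mem_Lam_of_hullDist_lt {a b : Omega δ} {r : ℝ} (h : hullDist a b < r)
    (hr : r ≤ 1 / Real.sqrt 2) : ∃ ε ∈ Lam a b, ε < r := by
  obtain ⟨x, hx, hxr⟩ := exists_lt_of_csInf_lt (insert_nonempty _ _) h
  rcases hx with rfl | hx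
  · exact absurd hxr (not_lt.2 hr)
  · exact ⟨x, hx, hxr⟩

theorem PentComplex.BallRel.approx {X Y : Pointed δ} {t₀ : X.cpx.T} {u₀ : Y.cpx.T} {n : ℕ}
    {r : X.cpx.T → Y.cpx.T → Prop} (h : BallRel X.cpx Y.cpx X.dec Y.dec t₀ u₀ n r) {i : ZMod 5}
    (hX : X.point = X.cpx.pt t₀ (corner i)) (hY : Y.point = Y.cpx.pt u₀ (corner i)) {ε : ℝ}
    (hε : 0 < ε) (hn : 6 * (1 / ε) + 5 ≤ n) : Approx ε X Y := by
  obtain ⟨φ, h1, h2, h3, h4⟩ := h.exists_isometry X.tileConnected Y.tileConnected X.injVert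
    Y.injVert (i := i) (one_div_nonneg.2 hε.le) hn
  refine ⟨φ, ?_, ?_, ?_, ?_⟩
  · rwa [hX]
  · rwa [hX]
  · rwa [hX]
  · rw [hX, h4, hY, affDist_self]
    exact hε.le

/-! ### Compactness -/

/-- One choice serves all classes, because the ultrafilter lives on the whole of `Omega δ`. Outside
`Xi δ` the tile and the index are irrelevant. -/
theorem exists_rep (b : Omega δ) : ∃ (X : Pointed δ) (t : X.cpx.T) (i : ZMod 5), cls X = b ∧
    (b ∈ Xi δ → X.point = X.cpx.pt t (corner i)) := by
  by_cases hb : b ∈ Xi δ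
  · obtain ⟨X, ⟨t, i, h⟩, rfl⟩ := hb
    exact ⟨X, t, i, rfl, fun _ => h⟩
  · obtain ⟨X, rfl⟩ := Quotient.exists_rep b
    obtain ⟨t, p, -⟩ := X.cpx.exists_pt X.point
    exact ⟨X, t, 0, rfl, fun h => absurd h hb⟩

theorem isCompact_Xi [Finite D] (δ : Decoration K D) : IsCompact (Xi δ) := by
  rw [isCompact_iff_ultrafilter_le_nhds]
  intro F hF
  choose X t i hX hXi using exists_rep (δ := δ)
  -- The family is indexed by the classes themselves. The corner of the base tile that carries the
  -- distinguished point is almost everywhere the same.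
  obtain ⟨i₀, hi₀⟩ : ∃ j, ∀ᶠ b in (F : Filter (Omega δ)), i b = j :=
    Ultrafilter.eventually_exists_iff.1 (Filter.Eventually.of_forall fun b => ⟨i b, rfl⟩)
  choose nbr hnbr using fun b => (X b).toTiling.exists_nbr
  let S : PointedFamily (Omega δ) D := ⟨fun b => (X b).cpx, fun b => (X b).dec, t, 20, nbr, hnbr⟩
  let Y : Pointed δ := ⟨Tiling.ofNoBoundary (S.lim_locallyIsomorphic F fun b => (X b).locIso)
    (S.lim_noBoundary F fun b => (X b).noBoundary) (S.limTile F []) (fun x => by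
      obtain ⟨w, rfl⟩ := S.exists_limTile F x
      exact ⟨_, S.lim_inBall F w⟩), (S.lim F).pt (S.limTile F []) (corner i₀)⟩
  refine ⟨cls Y, ⟨Y, ⟨S.limTile F [], i₀, rfl⟩, rfl⟩, ?_⟩
  have key : ∀ ε > 0, ∀ᶠ b in (F : Filter (Omega δ)), hullDist (cls Y) b ≤ ε := by
    intro ε hε
    obtain ⟨n, hn⟩ := exists_nat_ge (6 * (1 / ε) + 5)
    have hmem : ∀ᶠ b in (F : Filter (Omega δ)), b ∈ Xi δ := Filter.le_principal_iff.1 hF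
    filter_upwards [S.eventually_ballRel F n, hi₀, hmem] with b h1 h2 h3
    have h4 : (X b).point = (X b).cpx.pt (t b) (corner i₀) := by
      rw [← h2]
      exact hXi b h3
    exact hullDist_le ⟨hε, Y, X b, rfl, hX b, BallRel.approx (X := Y) (Y := X b) h1 rfl h4 hε hn,
      BallRel.approx (X := X b) (Y := Y) h1.symm h4 rfl hε hn⟩
  -- Only distances from the limit class enter the topology, so no triangle inequality for
  -- `hullDist` is required.
  rw [le_nhds_iff]
  intro U hU hU'
  obtain ⟨r, hr, h⟩ : ∃ r > 0, ∀ b, hullDist (cls Y) b < r → b ∈ U :=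
    (show ∀ a ∈ U, ∃ r > 0, ∀ b, hullDist a b < r → b ∈ U from hU') _ hU
  filter_upwards [key (r / 2) (half_pos hr)] with b hb
  exact h b (by linarith)

/-! ### Closedness -/

/-- The distance of a point of the pentagon from the corners. -/
def cornerDist (p : Pentagon) : ℝ :=
  Finset.univ.inf' ⟨0, Finset.mem_univ _⟩ fun i => dist p (corner i)

theorem cornerDist_le (p : Pentagon) (i : ZMod 5) : cornerDist p ≤ dist p (corner i) :=
  Finset.inf'_le _ (Finset.mem_univ i)

theorem exists_cornerDist_eq (p : Pentagon) : ∃ i, cornerDist p = dist p (corner i) := by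
  obtain ⟨i, -, h⟩ := Finset.exists_mem_eq_inf' (s := Finset.univ) ⟨(0 : ZMod 5), Finset.mem_univ _⟩
    fun i => dist p (corner i)
  exact ⟨i, h⟩

theorem cornerDist_nonneg (p : Pentagon) : 0 ≤ cornerDist p := by
  obtain ⟨i, h⟩ := exists_cornerDist_eq p
  rw [h]
  exact dist_nonneg

theorem cornerDist_corner (i : ZMod 5) : cornerDist (corner i) = 0 :=
  le_antisymm ((cornerDist_le _ i).trans_eq (dist_self _)) (cornerDist_nonneg _)

theorem cornerDist_map {σ : PentSym} {ρ : Pentagon ≃ᵢ Pentagon}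
    (h : ∀ i, ρ (corner i) = corner (σ.act i)) (p : Pentagon) :
    cornerDist (ρ p) = cornerDist p := by
  have hs : Function.Surjective σ.act := Finite.surjective_of_injective σ.act_injective
  apply le_antisymm
  · obtain ⟨i, hi⟩ := exists_cornerDist_eq p
    rw [hi, ← ρ.dist_eq, h]
    exact cornerDist_le _ _
  · obtain ⟨i, hi⟩ := exists_cornerDist_eq (ρ p)
    obtain ⟨j, rfl⟩ := hs i
    rw [hi, ← h, ρ.dist_eq]
    exact cornerDist_le _ _

theorem dist_centre_le (p : Pentagon) : dist p centre ≤ 1 := by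
  have : pentagon ⊆ Metric.closedBall (0 : ℂ) 1 := by
    refine convexHull_min ?_ (convex_closedBall _ _)
    rintro _ ⟨i, rfl⟩
    have := dist_centre_corner_le i
    rw [dist_comm] at this
    exact this
  exact this p.2

namespace PentComplex

variable {L M : PentComplex} {dL : Decoration L D} {dM : Decoration M D}

/-- The lower envelope of cones of slope one with height zero at every vertex. -/
theorem exists_vertexDist (L : PentComplex) : ∃ G : L.Space → ℝ,
    (∀ t p, G (L.pt t p) = cornerDist p) ∧ L.TileLip 1 G := by
  obtain ⟨G, h1, h2⟩ := exists_cone_function (L := L) (a := fun _ => 0) (C := 1) zero_le_one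
    (fun _ _ _ => by norm_num)
  refine ⟨G, fun t p => ?_, h2⟩
  rw [h1]
  simp [coneP, cornerDist]

/-- The distance of a point from the vertices of the tiles that contain it. -/
def vertexDist (L : PentComplex) : L.Space → ℝ := L.exists_vertexDist.choose

theorem vertexDist_pt (t : L.T) (p : Pentagon) : L.vertexDist (L.pt t p) = cornerDist p :=
  L.exists_vertexDist.choose_spec.1 t p

theorem TileConnected.vertexDist_le (h : L.TileConnected) (x y : L.Space) :
    L.vertexDist x ≤ L.vertexDist y + L.affDist x y := by
  have := TileLip.le_affDist one_pos L.exists_vertexDist.choose_spec.2 h x y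
  rwa [one_mul] at this

theorem isVertex_iff {x : L.Space} : L.IsVertex x ↔ L.vertexDist x = 0 := by
  constructor
  · rintro ⟨t, i, rfl⟩
    rw [vertexDist_pt, cornerDist_corner]
  · intro h
    obtain ⟨t, p, rfl⟩ := L.exists_pt x
    obtain ⟨i, hi⟩ := exists_cornerDist_eq p
    rw [vertexDist_pt, hi, dist_eq_zero] at h
    exact ⟨t, i, by rw [h]⟩

theorem vertexDist_nonneg (x : L.Space) : 0 ≤ L.vertexDist x := by
  obtain ⟨t, p, rfl⟩ := L.exists_pt x
  rw [vertexDist_pt]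
  exact cornerDist_nonneg p

/-- The unit ball around the point contains the centre of its tile, an interior point, so the
condition on cell maps applies to that tile; there the map is an isometry that permutes the corners.
-/
theorem IsCellMapOn.vertexDist_eq {S : Set L.Space} {φ : L.Space → M.Space}
    (h : IsCellMapOn dL dM S φ) {x : L.Space} (hS : L.ball x 1 ⊆ S) :
    M.vertexDist (φ x) = L.vertexDist x := by
  obtain ⟨t, p, rfl⟩ := L.exists_pt x
  have hc : L.pt t centre ∈ S := hS (((PathLen.single t p centre).affDist_le).trans
    (dist_centre_le p))
  have hp : L.pt t p ∈ S := hS (by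
    change L.affDist _ _ ≤ 1
    rw [affDist_self]
    exact zero_le_one)
  obtain ⟨t', σ, ρ, h1, h2, -⟩ := h t ⟨centre, zero_mem_interior_pentagon, hc⟩
  rw [h2 p hp, vertexDist_pt, vertexDist_pt, cornerDist_map h1]

end PentComplex

theorem vertexDist_eq_of_cls_eq {X Y : Pointed δ} (h : cls X = cls Y) :
    X.cpx.vertexDist X.point = Y.cpx.vertexDist Y.point := by
  obtain ⟨φ, h1, -, h3⟩ : Pointed.Iso X Y := Quotient.exact h
  rw [← h3, h1.vertexDist_eq (subset_univ _)]

theorem isClosed_Xi (δ : Decoration K D) : IsClosed (Xi δ) := by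
  rw [← isOpen_compl_iff]
  change ∀ a ∈ (Xi δ)ᶜ, ∃ r > 0, ∀ b, hullDist a b < r → b ∈ (Xi δ)ᶜ
  intro a ha
  obtain ⟨Y, rfl⟩ : ∃ Y : Pointed δ, cls Y = a := Quotient.exists_rep a
  have hc : 0 < Y.cpx.vertexDist Y.point :=
    (vertexDist_nonneg _).lt_of_ne fun h => ha ⟨Y, isVertex_iff.2 h.symm, rfl⟩
  have h2 : 0 < 1 / Real.sqrt 2 := by positivity
  -- The bound `1 / √2` makes `hullDist` come from an actual `ε` in `Lam`, and gives `ε ≤ 1`, so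
  -- that the ball of radius `1 / ε` contains the unit ball. The other bound contradicts `vertexDist
  -- ≤ ε`, which holds when the second point is a vertex.
  refine ⟨min (Y.cpx.vertexDist Y.point) (1 / Real.sqrt 2), lt_min hc h2, ?_⟩
  rintro b hb ⟨Z, hZ, rfl⟩
  obtain ⟨ε, ⟨hε, X, X', hX, hX', ⟨φ, h3, -, -, h4⟩, -⟩, hεr⟩ :=
    exists_mem_Lam_of_hullDist_lt hb (min_le_right _ _)
  rw [lt_min_iff] at hεr
  have hε1 : ε ≤ 1 := hεr.2.le.trans ((div_le_one (by positivity)).2 (Real.one_le_sqrt.2 one_le_two))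
  have h5 := h3.vertexDist_eq fun y (hy : X.cpx.affDist X.point y ≤ 1) =>
    hy.trans ((one_le_div hε).2 hε1)
  have h6 := X'.tileConnected.vertexDist_le (φ X.point) X'.point
  rw [h5, vertexDist_eq_of_cls_eq hX, vertexDist_eq_of_cls_eq hX', isVertex_iff.1 hZ] at h6
  linarith [hεr.1]

end PentHull

end

theorem mainTheorem7 {D : Type*} [Finite D] (δ : PentHull.Decoration PentHull.K D) :
    IsCompact (PentHull.Xi δ) ∧ IsClosed (PentHull.Xi δ) :=
  ⟨PentHull.isCompact_Xi δ, PentHull.isClosed_Xi δ⟩
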